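/- **Super-convergence for the state and adjoint variables.** *Continuous problem.* Let $n\in\{2,3\}$, let $\Omega\subset\mathbb R^n$ be a bounded domain and let $A:\Omega\to M_n(\mathbb R)$ be measurable, bounded, a.e. symmetric and uniformly elliptic. Write $\|\cdot\|$, $(\cdot,\cdot)$ for the norm and inner product of $L^2(\Omega)$ and of $L^2(\Omega)^n$, and $a(z,w)=\int_\Omega A\nabla z\cdot\nabla w\,dx$. Let $\alpha>0$, $f,\overline y_d,\overline u_d\in L^2(\Omega)$ and $\mathcal U_{ad}=\{u\in L^2(\Omega): a\le u\le b\text{ a.e.}\}$ with bounds $a,b$ (possibly infinite). Let $(\overline y,\overline p,\overline u)\in H^1_0(\Omega)\times H^1_0(\Omega)\times\mathcal U_{ad}$ solve $$a(\overline y,w)=(f+\overline u,w),\quad a(w,\overline p)=(\overline y-\overline y_d,w)\quad\forall w\in H^1_0(\Omega),\qquad (\overline p+\alpha(\overline u-\overline u_d),v-\overline u)\ge 0\quad\forall v\in\mathcal U_{ad}.$$ *Discretisation.* Let $\mathcal D=(X_{\mathcal D,0},\Pi_{\mathcal D},\nabla_{\mathcal D})$ be a gradient discretisation: $X_{\mathcal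 D,0}$ is a finite-dimensional real vector space, $\Pi_{\mathcal D}:X_{\mathcal D,0}\to L^2(\Omega)$ and $\nabla_{\mathcal D}:X_{\mathcal D,0}\to L^2(\Omega)^n$ are linear, and $\|\nabla_{\mathcal D}\cdot\|$ is a norm. Put $C_{\mathcal D}=\max_{w\ne0}\|\Pi_{\mathcal D}w\|/\|\nabla_{\mathcal D}w\|$ and $a_{\mathcal D}(z,w)=\int_\Omega A\nabla_{\mathcal D}z\cdot\nabla_{\mathcal D}w\,dx$. For $g\in L^2(\Omega)$, the gradient scheme for $-\operatorname{div}(A\nabla\psi)=g$ (with $\psi=0$ on $\partial\Omega$) is: find $\psi_{\mathcal D}\in X_{\mathcal D,0}$ with $a_{\mathcal D}(\psi_{\mathcal D},w)=(g,\Pi_{\mathcal D}w)$ for all $w\in X_{\mathcal D,0}$. Let $\mathcal T$ be a mesh of $\Omega$: a finite partition of $\Omega$ (up to faces) into non-empty open polygonal/polyhedral cells $K$, each star-shaped with respect to its centroid $\overline x_K$; let $h=\max_K\operatorname{diam}K$, $\rho_K=\max\{r>0:B(\overline x_K,r)\subset K\}$, and assume $\operatorname{diam}K/\rho_K\le\eta$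 for all $K\in\mathcal T$. Let $P_{\mathcal T}v$ be the piecewise constant function equal on each $K$ to the mean of $v$ over $K$. Let $\mathcal U_h$ be the space of functions constant on each cell and $\mathcal U_{ad,h}=\mathcal U_{ad}\cap\mathcal U_h$. Let $(\overline y_{\mathcal D},\overline p_{\mathcal D},\overline u_h)\in X_{\mathcal D,0}\times X_{\mathcal D,0}\times\mathcal U_{ad,h}$ solve $$a_{\mathcal D}(\overline y_{\mathcal D},w)=(f+\overline u_h,\Pi_{\mathcal D}w),\quad a_{\mathcal D}(w,\overline p_{\mathcal D})=(\Pi_{\mathcal D}\overline y_{\mathcal D}-\overline y_d,\Pi_{\mathcal D}w)\quad\forall w\in X_{\mathcal D,0},$$ $$(\Pi_{\mathcal D}\overline p_{\mathcal D}+\alpha(\overline u_h-\overline u_d),v-\overline u_h)\ge0\quad\forall v\in\mathcal U_{ad,h}.$$ *Active cells.* Let $\mathcal T_2$ be the set of cells $K$ on which a.e. $\overline u=a$, or a.e. $\overline u=b$, or a.e. $a<\overline u<b$; let $\mathcal T_1=\mathcal T\setminus\mathcal T_2$ and $\Omega_{1,\mathcal T}=\operatorname{int}\bigcup_{K\in\mathcal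 T_1}\overline K$. $W^{1,\infty}(\mathcal T_1)$ is the broken Sobolev space, normed by the maximum over $K\in\mathcal T_1$ and over $w$ and its first-order partial derivatives of the $L^\infty(K)$ norms (and by $0$ if $\mathcal T_1=\emptyset$). *Assumptions*, with a constant $\kappa$: * $\overline u_d,\overline y,\overline p\in H^2(\Omega)$ and $\overline y_d,f\in H^1(\Omega)$. * (A1) To each $w\in H^2(\Omega)$ is associated $w_{\mathcal T}\in L^2(\Omega)$ such that: (i) if $w\in H^2(\Omega)\cap H^1_0(\Omega)$ solves $-\operatorname{div}(A\nabla w)=g\in H^1(\Omega)$ and $w_{\mathcal D}$ is the solution of the gradient scheme with right-hand side $g$, then $\|\Pi_{\mathcal D}w_{\mathcal D}-w_{\mathcal T}\|\le\kappa h^2\|g\|_{H^1(\Omega)}$; (ii) for all $w\in H^2(\Omega)$, $|(w-w_{\mathcal T},\Pi_{\mathcal D}v)|\le\kappa h^2\|w\|_{H^2(\Omega)}\|\Pi_{\mathcal D}v\|$ for all $v\in X_{\mathcal D,0}$, and $\|P_{\mathcal T}(w-w_{\mathcal T})\|\le\kappa h^2\|w\|_{H^2(\Omega)}$. * (A2)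 $\|\Pi_{\mathcal D}v-P_{\mathcal T}(\Pi_{\mathcal D}v)\|\le\kappa h\|\nabla_{\mathcal D}v\|$ for all $v\in X_{\mathcal D,0}$. * (A4) $|\Omega_{1,\mathcal T}|\le\kappa h$ and $\overline u_{|\Omega_{1,\mathcal T}}\in W^{1,\infty}(\mathcal T_1)$. Set $\mathcal F=\operatorname{minmod}(a,b)+\|\overline y_d\|_{H^1(\Omega)}+\|\overline u_d\|_{H^2(\Omega)}+\|f\|_{H^1(\Omega)}+\|\overline y\|_{H^2(\Omega)}+\|\overline p\|_{H^2(\Omega)}$, where $\operatorname{minmod}(a,b)=0$ if $ab\le0$ and $\min(|a|,|b|)$ otherwise. *Conclusion.* 1. Assume also (A3): $\|\Pi_{\mathcal D}v\|_{L^{2^*}(\Omega)}\le\kappa\|\nabla_{\mathcal D}v\|$ for all $v\in X_{\mathcal D,0}$, where $2^*\in[2,\infty)$ if $n=2$ and $2^*=\frac{2n}{n-2}$ if $n=3$. Then, with $r=2-\frac1{2^*}$, $$\|\overline y_{\mathcal T}-\Pi_{\mathcal D}\overline y_{\mathcal D}\|\le C_\eta\big(C h^{r}\|\overline u\|_{W^{1,\infty}(\mathcal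 T_1)}+C h^2\mathcal F\big),\qquad \|\overline p_{\mathcal T}-\Pi_{\mathcal D}\overline p_{\mathcal D}\|\le C_\eta\big(C h^{r}\|\overline u\|_{W^{1,\infty}(\mathcal T_1)}+C h^2\mathcal F\big),$$ where $C$ depends only on $\alpha$. 2. Assume instead of (A3) that, for some $\delta>0$ and every $F\in L^2(\Omega)$, the solution $\psi_{\mathcal D}$ of the gradient scheme with right-hand side $F$ satisfies $\|\Pi_{\mathcal D}\psi_{\mathcal D}\|_{L^\infty(\Omega)}\le\delta\|F\|$. Then both estimates hold with $r=2$ and $C$ depending only on $\alpha$ and $\delta$. In both parts $C_\eta$ depends only on $\Omega$, $A$, an upper bound of $C_{\mathcal D}$, $\eta$ and $\kappa$. -/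

import Mathlib

open MeasureTheory
open scoped Matrix ENNReal ContDiff

universe u

namespace OptControl

noncomputable section

/-! ## Function spaces on subsets of `ℝⁿ` -/

/-- `ℝⁿ` with the Euclidean norm and the Lebesgue measure. -/
abbrev Space (n : ℕ) := EuclideanSpace ℝ (Fin n)

/-- Bounded domain: a bounded, connected, non-empty open set. -/
def IsBoundedDomain {n : ℕ} (Ω : Set (Space n)) : Prop :=
  IsOpen Ω ∧ IsConnected Ω ∧ Bornology.IsBounded Ω

/-- The Hilbert space `L²(Ω)`. -/
abbrev L2 {n : ℕ} (Ω : Set (Space n)) := Lp ℝ 2 (volume.restrict Ω)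

/-- The Hilbert space `L²(Ω)ⁿ`, with `‖G‖² = ∑ i, ‖G i‖²`. -/
abbrev L2vec {n : ℕ} (Ω : Set (Space n)) := PiLp 2 (fun _ : Fin n => L2 Ω)

/-- The `L²(Ω)` norm of a function. -/
def l2norm {n : ℕ} (Ω : Set (Space n)) (v : Space n → ℝ) : ℝ :=
  (eLpNorm v 2 (volume.restrict Ω)).toReal

/-- Test functions on `U`: smooth with compact support contained in `U`. -/
def IsTest {n : ℕ} (U : Set (Space n)) (φ : Space n → ℝ) : Prop :=
  ContDiff ℝ ∞ φ ∧ HasCompactSupport φ ∧ tsupport φ ⊆ U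

/-- `v` is a weak partial derivative of `w` in direction `i` on the open set `U`. -/
def HasWeakDeriv {n : ℕ} (U : Set (Space n)) (i : Fin n) (w v : Space n → ℝ) : Prop :=
  LocallyIntegrableOn w U ∧ LocallyIntegrableOn v U ∧
    ∀ φ : Space n → ℝ, IsTest U φ →
      ∫ x in U, w x * fderiv ℝ φ x (EuclideanSpace.single i 1) = - ∫ x in U, v x * φ x

open Classical in
/-- The weak partial derivative `∂ᵢ w` on `U` (unique up to a null set; zero by convention if
there is none). -/
def weakDeriv {n : ℕ} (U : Set (Space n)) (i : Fin n) (w : Space n → ℝ) : Space n → ℝ :=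
  if h : ∃ v, HasWeakDeriv U i w v then h.choose else 0

/-- `w ∈ W^{1,p}(U)`. -/
def MemW1 {n : ℕ} (U : Set (Space n)) (p : ℝ≥0∞) (w : Space n → ℝ) : Prop :=
  MemLp w p (volume.restrict U) ∧
    ∀ i, ∃ v, HasWeakDeriv U i w v ∧ MemLp v p (volume.restrict U)

/-- `w ∈ H¹(Ω)`. -/
def MemH1 {n : ℕ} (Ω : Set (Space n)) (w : Space n → ℝ) : Prop := MemW1 Ω 2 w

/-- `w ∈ H²(Ω)`. -/
def MemH2 {n : ℕ} (Ω : Set (Space n)) (w : Space n → ℝ) : Prop :=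
  MemH1 Ω w ∧ ∀ i, MemH1 Ω (weakDeriv Ω i w)

/-- The norm of `H¹(Ω)`. -/
def H1norm {n : ℕ} (Ω : Set (Space n)) (w : Space n → ℝ) : ℝ :=
  √(l2norm Ω w ^ 2 + ∑ i, l2norm Ω (weakDeriv Ω i w) ^ 2)

/-- The norm of `H²(Ω)`. -/
def H2norm {n : ℕ} (Ω : Set (Space n)) (w : Space n → ℝ) : ℝ :=
  √(l2norm Ω w ^ 2 + ∑ i, H1norm Ω (weakDeriv Ω i w) ^ 2)

/-- `w ∈ H¹₀(Ω)`: the closure of the test functions in `H¹(Ω)`. -/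
def MemH10 {n : ℕ} (Ω : Set (Space n)) (w : Space n → ℝ) : Prop :=
  MemH1 Ω w ∧ ∀ ε > 0, ∃ φ, IsTest Ω φ ∧ H1norm Ω (fun x => w x - φ x) < ε

/-- The norm of `W^{1,∞}(U)`, as an extended non-negative number. -/
def W1infNorm {n : ℕ} (U : Set (Space n)) (w : Space n → ℝ) : ℝ≥0∞ :=
  max (eLpNorm w ⊤ (volume.restrict U))
    (⨆ i, eLpNorm (weakDeriv U i w) ⊤ (volume.restrict U))

/-! ## The continuous problem -/

/-- `A` is measurable, bounded, symmetric and uniformly elliptic on `Ω`. -/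
def IsDiffusion {n : ℕ} (Ω : Set (Space n)) (A : Space n → Matrix (Fin n) (Fin n) ℝ) : Prop :=
  (∀ i j, AEMeasurable (fun x => A x i j) (volume.restrict Ω)) ∧
  (∃ Λ : ℝ, ∀ᵐ x ∂(volume.restrict Ω), ∀ i j, |A x i j| ≤ Λ) ∧
  (∀ᵐ x ∂(volume.restrict Ω), (A x).IsSymm) ∧
  (∃ a₀ > 0, ∀ᵐ x ∂(volume.restrict Ω), ∀ ξ : Fin n → ℝ, a₀ * (ξ ⬝ᵥ ξ) ≤ (A x *ᵥ ξ) ⬝ᵥ ξ)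

/-- `∫_Ω A G · H dx` for vector fields `G`, `H` given by their components. -/
def fluxForm {n : ℕ} (Ω : Set (Space n)) (A : Space n → Matrix (Fin n) (Fin n) ℝ)
    (G H : Fin n → Space n → ℝ) : ℝ :=
  ∫ x in Ω, (A x *ᵥ fun j => G j x) ⬝ᵥ fun i => H i x

/-- `a(z, w) = ∫_Ω A ∇z · ∇w dx`. -/
def aForm {n : ℕ} (Ω : Set (Space n)) (A : Space n → Matrix (Fin n) (Fin n) ℝ)
    (z w : Space n → ℝ) : ℝ :=
  fluxForm Ω A (fun j => weakDeriv Ω j z) (fun i => weakDeriv Ω i w)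

/-- `w ∈ H¹₀(Ω)` is the weak solution of `-div(A ∇w) = g` with homogeneous Dirichlet
conditions. Since `A` is symmetric, it also describes the adjoint equation. -/
def IsWeakSol {n : ℕ} (Ω : Set (Space n)) (A : Space n → Matrix (Fin n) (Fin n) ℝ)
    (w g : L2 Ω) : Prop :=
  MemH10 Ω w ∧ ∀ v : L2 Ω, MemH10 Ω v → aForm Ω A w v = inner ℝ g v

/-- Admissible controls `a ≤ u ≤ b` a.e.; the bounds may be infinite. -/
def Uad {n : ℕ} (Ω : Set (Space n)) (a b : EReal) : Set (L2 Ω) :=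
  {v | ∀ᵐ x ∂(volume.restrict Ω), a ≤ ((v x : ℝ) : EReal) ∧ ((v x : ℝ) : EReal) ≤ b}

/-- Optimality system of the control problem: `y`, `p`, `w` are the optimal state, adjoint state
and control for the regularisation parameter `α`, source `f`, desired state `yd` and desired
control `ud`. -/
structure IsKKT {n : ℕ} (Ω : Set (Space n)) (A : Space n → Matrix (Fin n) (Fin n) ℝ)
    (a b : EReal) (α : ℝ) (f yd ud y p w : L2 Ω) : Prop where
  mem_y : MemH10 Ω y
  mem_p : MemH10 Ω p
  mem_w : w ∈ Uad Ω a b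
  state : ∀ v : L2 Ω, MemH10 Ω v → aForm Ω A y v = inner ℝ (f + w) v
  adjoint : ∀ v : L2 Ω, MemH10 Ω v → aForm Ω A v p = inner ℝ (y - yd) v
  optimality : ∀ v ∈ Uad Ω a b, 0 ≤ inner ℝ (p + α • (w - ud)) (v - w)

/-! ## Gradient discretisations -/

/-- Gradient discretisation for homogeneous Dirichlet conditions. The last field says that
`v ↦ ‖∇_D v‖` is a norm (the other norm axioms follow from linearity). -/
structure GradDisc {n : ℕ} (Ω : Set (Space n)) where
  X : Type u
  [addCommGroup : AddCommGroup X]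
  [module : Module ℝ X]
  [finiteDimensional : FiniteDimensional ℝ X]
  recon : X →ₗ[ℝ] L2 Ω
  grad : X →ₗ[ℝ] L2vec Ω
  eq_zero_of_grad : ∀ v, ‖grad v‖ = 0 → v = 0

attribute [instance] GradDisc.addCommGroup GradDisc.module GradDisc.finiteDimensional

namespace GradDisc

variable {n : ℕ} {Ω : Set (Space n)}

/-- The coercivity constant `C_D = max_{w ≠ 0} ‖Π_D w‖ / ‖∇_D w‖`. -/
def coercConst (D : GradDisc.{u} Ω) : ℝ :=
  ⨆ w : {w : D.X // w ≠ 0}, ‖D.recon w‖ / ‖D.grad w‖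

/-- `a_D(z, w) = ∫_Ω A ∇_D z · ∇_D w dx`. -/
def form (D : GradDisc.{u} Ω) (A : Space n → Matrix (Fin n) (Fin n) ℝ) (z w : D.X) : ℝ :=
  fluxForm Ω A (fun j => D.grad z j) (fun i => D.grad w i)

/-- `z` solves the gradient scheme for `-div(A ∇ψ) = F`. -/
def IsSol (D : GradDisc.{u} Ω) (A : Space n → Matrix (Fin n) (Fin n) ℝ) (F : L2 Ω)
    (z : D.X) : Prop :=
  ∀ w, D.form A z w = inner ℝ F (D.recon w)

end GradDisc

/-! ## Meshes -/

/-- Polytopal open set: the interior of a finite union of convex hulls of finite sets. -/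
def IsPolytopal {n : ℕ} (K : Set (Space n)) : Prop :=
  ∃ S : Finset (Finset (Space n)), K = interior (⋃ P ∈ S, convexHull ℝ (P : Set (Space n)))

/-- The centroid of a cell. -/
def centroid {n : ℕ} (K : Set (Space n)) : Space n := ⨍ x in K, x

/-- The largest radius of balls centred at the centroid and included in `K`. -/
def inradius {n : ℕ} (K : Set (Space n)) : ℝ :=
  sSup {r : ℝ | 0 < r ∧ Metric.ball (centroid K) r ⊆ K}

/-- Mesh of `Ω`: finite partition of `Ω` (up to the faces) into non-empty polytopal open cells,
each star-shaped with respect to its centroid. -/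
structure Mesh {n : ℕ} (Ω : Set (Space n)) where
  cells : Finset (Set (Space n))
  nonempty : ∀ K ∈ cells, K.Nonempty
  polytopal : ∀ K ∈ cells, IsPolytopal K
  starShaped : ∀ K ∈ cells, StarConvex ℝ (centroid K) K
  subset : ∀ K ∈ cells, K ⊆ Ω
  disjoint : ∀ K ∈ cells, ∀ L ∈ cells, K ≠ L → Disjoint K L
  cover : closure Ω = ⋃ K ∈ cells, closure K

namespace Mesh

variable {n : ℕ} {Ω : Set (Space n)}

/-- The mesh size `h = max_K diam K`. -/
def size (T : Mesh Ω) : ℝ := ⨆ K : T.cells, Metric.diam (K : Set (Space n))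

/-- Mesh regularity: `diam K / ρ_K ≤ η` for every cell. -/
def IsRegular (T : Mesh Ω) (η : ℝ) : Prop :=
  ∀ K ∈ T.cells, Metric.diam K / inradius K ≤ η

/-- The projection on piecewise constant functions: on each cell, the mean value. -/
def proj (T : Mesh Ω) (v : Space n → ℝ) : Space n → ℝ :=
  fun x => ∑ K ∈ T.cells, K.indicator (fun _ => ⨍ z in K, v z) x

/-- `U_h`: functions that are constant on each cell. -/
def piecewiseConst (T : Mesh Ω) : Set (L2 Ω) :=
  {v | ∀ K ∈ T.cells, ∃ c : ℝ, ∀ᵐ x ∂(volume.restrict K), v x = c}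

/-- `T₂`: the fully active or fully inactive cells of the control `w`. -/
def cells₂ (T : Mesh Ω) (a b : EReal) (w : L2 Ω) : Set (Set (Space n)) :=
  {K | K ∈ T.cells ∧
    ((∀ᵐ x ∂(volume.restrict K), ((w x : ℝ) : EReal) = a) ∨
     (∀ᵐ x ∂(volume.restrict K), ((w x : ℝ) : EReal) = b) ∨
     (∀ᵐ x ∂(volume.restrict K), a < ((w x : ℝ) : EReal) ∧ ((w x : ℝ) : EReal) < b))}

/-- `T₁`: the remaining cells. -/
def cells₁ (T : Mesh Ω) (a b : EReal) (w : L2 Ω) : Set (Set (Space n)) :=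
  {K | K ∈ T.cells ∧ K ∉ T.cells₂ a b w}

/-- `Ω₁`: the interior of the union of the closures of the cells of `T₁`. -/
def region₁ (T : Mesh Ω) (a b : EReal) (w : L2 Ω) : Set (Space n) :=
  interior (⋃ K ∈ T.cells₁ a b w, closure K)

/-- The norm of `w` in the broken space `W^{1,∞}(T₁)`. -/
def brokenNorm (T : Mesh Ω) (a b : EReal) (w : L2 Ω) : ℝ :=
  (⨆ K ∈ T.cells₁ a b w, W1infNorm K w).toReal

end Mesh

/-! ## The discrete control problem and the assumptions -/

section

variable {n : ℕ} {Ω : Set (Space n)}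

/-- Discrete optimality system, with piecewise constant controls on `T`. -/
structure IsDiscreteKKT (D : GradDisc.{u} Ω) (T : Mesh Ω)
    (A : Space n → Matrix (Fin n) (Fin n) ℝ)
    (a b : EReal) (α : ℝ) (f yd ud : L2 Ω) (y p : D.X) (w : L2 Ω) : Prop where
  mem_w : w ∈ Uad Ω a b ∩ T.piecewiseConst
  state : ∀ v, D.form A y v = inner ℝ (f + w) (D.recon v)
  adjoint : ∀ v, D.form A v p = inner ℝ (D.recon y - yd) (D.recon v)
  optimality : ∀ v ∈ Uad Ω a b ∩ T.piecewiseConst,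
    0 ≤ inner ℝ (D.recon p + α • (w - ud)) (v - w)

/-- Approximation and interpolation errors: `τ w` is the function `w_T` attached to
`w ∈ H²(Ω)`, and `κ` is the hidden constant. -/
structure ApproxAssumption (D : GradDisc.{u} Ω) (T : Mesh Ω)
    (A : Space n → Matrix (Fin n) (Fin n) ℝ) (κ : ℝ) (τ : L2 Ω → L2 Ω) : Prop where
  superconv : ∀ w g : L2 Ω, MemH2 Ω w → MemH1 Ω g → IsWeakSol Ω A w g →
    ∀ z : D.X, D.IsSol A g z → ‖D.recon z - τ w‖ ≤ κ * T.size ^ 2 * H1norm Ω g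
  inner_le : ∀ w : L2 Ω, MemH2 Ω w → ∀ v : D.X,
    |inner ℝ (w - τ w) (D.recon v)| ≤ κ * T.size ^ 2 * H2norm Ω w * ‖D.recon v‖
  proj_le : ∀ w : L2 Ω, MemH2 Ω w →
    l2norm Ω (T.proj (w - τ w : L2 Ω)) ≤ κ * T.size ^ 2 * H2norm Ω w

/-- `‖Π_D v - P_T Π_D v‖ ≤ κ h ‖∇_D v‖`. -/
def ProjAssumption (D : GradDisc.{u} Ω) (T : Mesh Ω) (κ : ℝ) : Prop :=
  ∀ v : D.X, l2norm Ω (fun x => D.recon v x - T.proj (D.recon v) x)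
    ≤ κ * T.size * ‖D.grad v‖

/-- `q = 2*` is a Sobolev exponent of `2` in dimension `n ≥ 2`. -/
def IsSobolevExponent (n : ℕ) (q : ℝ) : Prop :=
  (n = 2 → 2 ≤ q) ∧ (3 ≤ n → q = 2 * n / (n - 2))

/-- Discrete Sobolev embedding: `‖Π_D v‖_{L^q} ≤ κ ‖∇_D v‖`. -/
def SobolevAssumption (D : GradDisc.{u} Ω) (q κ : ℝ) : Prop :=
  ∀ v : D.X, eLpNorm (D.recon v) (ENNReal.ofReal q) (volume.restrict Ω)
    ≤ ENNReal.ofReal (κ * ‖D.grad v‖)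

/-- `|Ω₁| ≤ κ h` and the control `w` belongs to `W^{1,∞}(T₁)`. -/
def ControlAssumption (T : Mesh Ω) (a b : EReal) (w : L2 Ω) (κ : ℝ) : Prop :=
  volume (T.region₁ a b w) ≤ ENNReal.ofReal (κ * T.size) ∧
    ∀ K ∈ T.cells₁ a b w, MemW1 K ⊤ w

/-- The `L^∞` bound `‖Π_D ψ_D‖_{L^∞} ≤ δ ‖F‖` on solutions of the gradient scheme. -/
def LinftyAssumption (D : GradDisc.{u} Ω) (A : Space n → Matrix (Fin n) (Fin n) ℝ)
    (δ : ℝ) : Prop :=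
  ∀ (F : L2 Ω) (z : D.X), D.IsSol A F z →
    eLpNorm (D.recon z) ⊤ (volume.restrict Ω) ≤ ENNReal.ofReal (δ * ‖F‖)

/-- `minmod(a, b)` is zero if `ab ≤ 0` and `min(|a|, |b|)` otherwise. -/
def minmod (a b : EReal) : ℝ :=
  if a * b ≤ 0 then 0 else (min a.abs b.abs).toReal

/-- The quantity `F(a, b, y_d, u_d, f, y, p)`. -/
def dataNorm (a b : EReal) (yd ud f y p : L2 Ω) : ℝ :=
  minmod a b + H1norm Ω yd + H2norm Ω ud + H1norm Ω f + H2norm Ω y + H2norm Ω p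

end

end

end OptControl

open OptControl

/-! The optimality condition says that the control `w` is the truncation to `[a, b]` of `g = ud -
α⁻¹ • p` (`control_ae_eq_clip`). Let `u` be the piecewise constant control whose value on a cell is
the truncated mean of `g` (`meanControl`). The discrete state is reached from `τ y` in three steps:
the scheme with source `f + w` (superconvergence, (A1)), then the scheme with source `f + u`, then
the scheme with source `f + wh`.

Second step. Let `ζ` solve the scheme whose source is the reconstructed error `e`; then `‖e‖² = (u -
w, Π ζ)`. On a cell of `T₂` either `u = w`, or truncation does nothing, so that `u - w` is the mean
of `g` minus `g`. There `u - w` has zero mean, so `Π ζ` may be replaced by `Π ζ - P Π ζ`: (A2) and a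
Poincaré inequality give `h` each. On a cell of `T₁` the truncated mean lies within the oscillation
of `w`, so `|u - w|` is of order `h ‖w‖` in `W^{1,∞}`. What remains is the `L¹` norm of `Π ζ` on a
region of measure at most `κ h`; Hölder with (A3) or with the `L^∞` bound gives the power `1 - 1/2*`
or `1` of `h`. This is `norm_recon_sub_le_of_meanControl`.

Third step. Testing the two discrete variational inequalities against each other bounds `α ‖u -
wh‖²` by `(Π pD - p, u - wh)`. The part of `Π pD` that comes from the change of control is monotone
and has the right sign; the rest is an adjoint consistency error, plus `τ p - p` paired with a
piecewise constant, which sees only the cell means. Stability of the scheme then carries `u - wh` to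
the state and the adjoint: `state_adjoint_error_le`.

Two facts about Sobolev functions are proved on the way, both by mollification along segments
(`lintegral_enorm_sub_sq_le`): the Poincaré inequality on cells that are star-shaped with respect to
their centroid, and the stability of `H¹` under Lipschitz maps. The second bounds the `H¹` norm of
the source `f + w`, as superconvergence requires. -/

namespace OptControl

noncomputable section

open Filter Topology

/-! ### Weak derivatives and Sobolev norms. -/

section WeakDeriv

variable {n : ℕ} {U V : Set (Space n)} {i : Fin n}

theorem IsTest.mono {φ : Space n → ℝ} (h : IsTest U φ) (hUV : U ⊆ V) : IsTest V φ :=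
  ⟨h.1, h.2.1, h.2.2.trans hUV⟩

theorem integrable_mul_of_tsupport_subset {f φ : Space n → ℝ} (hf : LocallyIntegrableOn f U)
    (hφ : Continuous φ) (hc : HasCompactSupport φ) (hs : tsupport φ ⊆ U) :
    Integrable (fun x => f x * φ x) := by
  have h1 : IntegrableOn f (tsupport φ) := hf.integrableOn_compact_subset hs hc
  have h2 : IntegrableOn (fun x => f x * φ x) (tsupport φ) :=
    h1.mul_continuousOn hφ.continuousOn hc
  refine (integrableOn_iff_integrable_of_support_subset ?_).1 h2
  intro x hx
  refine subset_tsupport _ ?_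
  simp only [Function.mem_support] at hx ⊢
  exact right_ne_zero_of_mul hx

theorem IsTest.continuous_fderiv_apply {φ : Space n → ℝ} (h : IsTest U φ) (e : Space n) :
    Continuous fun x => fderiv ℝ φ x e :=
  (h.1.continuous_fderiv (by simp)).clm_apply continuous_const

theorem IsTest.tsupport_fderiv_apply {φ : Space n → ℝ} (h : IsTest U φ) (e : Space n) :
    tsupport (fun x => fderiv ℝ φ x e) ⊆ U :=
  (tsupport_fderiv_apply_subset ℝ e).trans h.2.2

theorem IsTest.hasCompactSupport_fderiv_apply {φ : Space n → ℝ} (h : IsTest U φ) (e : Space n) :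
    HasCompactSupport (fun x => fderiv ℝ φ x e) :=
  h.2.1.fderiv_apply ℝ e

theorem HasWeakDeriv.integrable_left {w v φ : Space n → ℝ} (h : HasWeakDeriv U i w v)
    (hφ : IsTest U φ) (e : Space n) : Integrable (fun x => w x * fderiv ℝ φ x e) :=
  integrable_mul_of_tsupport_subset h.1 (hφ.continuous_fderiv_apply e)
    (hφ.hasCompactSupport_fderiv_apply e) (hφ.tsupport_fderiv_apply e)

theorem HasWeakDeriv.integrable_right {w v φ : Space n → ℝ} (h : HasWeakDeriv U i w v)
    (hφ : IsTest U φ) : Integrable (fun x => v x * φ x) :=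
  integrable_mul_of_tsupport_subset h.2.1 hφ.1.continuous hφ.2.1 hφ.2.2

theorem setIntegral_mul_of_tsupport_subset {f φ : Space n → ℝ} (hs : tsupport φ ⊆ U) :
    ∫ x in U, f x * φ x = ∫ x, f x * φ x := by
  refine setIntegral_eq_integral_of_forall_compl_eq_zero fun x hx => ?_
  rw [image_eq_zero_of_notMem_tsupport fun h => hx (hs h), mul_zero]

theorem HasWeakDeriv.mono {w v : Space n → ℝ} (h : HasWeakDeriv V i w v) (hUV : U ⊆ V) :
    HasWeakDeriv U i w v := by
  refine ⟨h.1.mono_set hUV, h.2.1.mono_set hUV, fun φ hφ => ?_⟩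
  have := h.2.2 φ (hφ.mono hUV)
  rw [setIntegral_mul_of_tsupport_subset ((hφ.mono hUV).tsupport_fderiv_apply _),
    setIntegral_mul_of_tsupport_subset (hφ.mono hUV).2.2] at this
  rw [setIntegral_mul_of_tsupport_subset (hφ.tsupport_fderiv_apply _),
    setIntegral_mul_of_tsupport_subset hφ.2.2, this]

theorem HasWeakDeriv.congr {w w' v v' : Space n → ℝ} (h : HasWeakDeriv U i w v)
    (hw : w =ᵐ[volume.restrict U] w') (hv : v =ᵐ[volume.restrict U] v') :
    HasWeakDeriv U i w' v' := by
  refine ⟨h.1.congr hw, h.2.1.congr hv, fun φ hφ => ?_⟩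
  have h1 : ∫ x in U, w x * fderiv ℝ φ x (EuclideanSpace.single i 1) =
      ∫ x in U, w' x * fderiv ℝ φ x (EuclideanSpace.single i 1) :=
    integral_congr_ae (hw.mono fun x hx => by simp only [hx])
  have h2 : ∫ x in U, v x * φ x = ∫ x in U, v' x * φ x :=
    integral_congr_ae (hv.mono fun x hx => by simp only [hx])
  rw [← h1, ← h2, h.2.2 φ hφ]

theorem HasWeakDeriv.add {w w' v v' : Space n → ℝ} (h : HasWeakDeriv U i w v)
    (h' : HasWeakDeriv U i w' v') :
    HasWeakDeriv U i (fun x => w x + w' x) (fun x => v x + v' x) := by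
  refine ⟨h.1.add h'.1, h.2.1.add h'.2.1, fun φ hφ => ?_⟩
  simp only [add_mul]
  rw [integral_add (h.integrable_left hφ _).integrableOn (h'.integrable_left hφ _).integrableOn,
    integral_add (h.integrable_right hφ).integrableOn (h'.integrable_right hφ).integrableOn,
    h.2.2 φ hφ, h'.2.2 φ hφ, neg_add]

theorem HasWeakDeriv.const_mul {w v : Space n → ℝ} (h : HasWeakDeriv U i w v) (c : ℝ) :
    HasWeakDeriv U i (fun x => c * w x) (fun x => c * v x) := by
  refine ⟨h.1.smul c, h.2.1.smul c, fun φ hφ => ?_⟩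
  simp only [mul_assoc]
  rw [integral_const_mul, integral_const_mul, h.2.2 φ hφ, mul_neg]

theorem HasWeakDeriv.sub {w w' v v' : Space n → ℝ} (h : HasWeakDeriv U i w v)
    (h' : HasWeakDeriv U i w' v') :
    HasWeakDeriv U i (fun x => w x - w' x) (fun x => v x - v' x) := by
  have := h.add (h'.const_mul (-1))
  simpa only [neg_mul, one_mul, ← sub_eq_add_neg] using this

/-- The fundamental lemma of the calculus of variations. Through it the chosen representative
`weakDeriv` can be replaced a.e. by any explicit weak derivative. -/
theorem HasWeakDeriv.unique {w v v' : Space n → ℝ} (hU : IsOpen U) (h : HasWeakDeriv U i w v)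
    (h' : HasWeakDeriv U i w v') : v =ᵐ[volume.restrict U] v' := by
  have h0 := h.sub h'
  have : ∀ᵐ x, x ∈ U → v x - v' x = 0 := by
    refine hU.ae_eq_zero_of_integral_contDiff_smul_eq_zero h0.2.1 fun φ h1 h2 h3 => ?_
    have h4 := h0.2.2 φ ⟨h1, h2, h3⟩
    rw [setIntegral_mul_of_tsupport_subset h3] at h4
    simp only [sub_self, zero_mul, integral_zero, zero_eq_neg] at h4
    simpa only [smul_eq_mul, mul_comm] using h4
  rw [EventuallyEq, ae_restrict_iff' hU.measurableSet]
  exact this.mono fun x hx hxU => sub_eq_zero.1 (hx hxU)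

theorem HasWeakDeriv.weakDeriv {w v : Space n → ℝ} (h : HasWeakDeriv U i w v) :
    HasWeakDeriv U i w (weakDeriv U i w) := by
  have h' : ∃ v, HasWeakDeriv U i w v := ⟨v, h⟩
  rw [OptControl.weakDeriv, dif_pos h']
  exact h'.choose_spec

theorem HasWeakDeriv.weakDeriv_ae_eq {w v : Space n → ℝ} (hU : IsOpen U)
    (h : HasWeakDeriv U i w v) : OptControl.weakDeriv U i w =ᵐ[volume.restrict U] v :=
  h.weakDeriv.unique hU h

theorem MemW1.hasWeakDeriv {p : ℝ≥0∞} {w : Space n → ℝ} (h : MemW1 U p w) (i : Fin n) :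
    HasWeakDeriv U i w (weakDeriv U i w) :=
  (h.2 i).choose_spec.1.weakDeriv

theorem MemW1.memLp_weakDeriv (hU : IsOpen U) {p : ℝ≥0∞} {w : Space n → ℝ} (h : MemW1 U p w)
    (i : Fin n) : MemLp (weakDeriv U i w) p (volume.restrict U) := by
  obtain ⟨v, hv, hm⟩ := h.2 i
  exact hm.ae_eq (hv.weakDeriv_ae_eq hU).symm

theorem l2norm_nonneg (v : Space n → ℝ) : 0 ≤ l2norm U v := ENNReal.toReal_nonneg

theorem l2norm_congr {v w : Space n → ℝ} (h : v =ᵐ[volume.restrict U] w) :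
    l2norm U v = l2norm U w := by
  rw [l2norm, l2norm, eLpNorm_congr_ae h]

theorem l2norm_coe (v : L2 U) : l2norm U v = ‖v‖ := (Lp.norm_def v).symm

theorem l2norm_add_le {v w : Space n → ℝ} (hv : MemLp v 2 (volume.restrict U))
    (hw : MemLp w 2 (volume.restrict U)) :
    l2norm U (fun x => v x + w x) ≤ l2norm U v + l2norm U w := by
  rw [l2norm, l2norm, l2norm, ← ENNReal.toReal_add hv.eLpNorm_ne_top hw.eLpNorm_ne_top]
  exact ENNReal.toReal_mono (ENNReal.add_ne_top.2 ⟨hv.eLpNorm_ne_top, hw.eLpNorm_ne_top⟩)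
    (eLpNorm_add_le hv.1 hw.1 one_le_two)

theorem l2norm_const_mul (c : ℝ) (v : Space n → ℝ) :
    l2norm U (fun x => c * v x) = |c| * l2norm U v := by
  have := eLpNorm_const_smul (μ := volume.restrict U) c v 2
  rw [l2norm, l2norm]
  change (eLpNorm (c • v) 2 _).toReal = _
  rw [this, ENNReal.toReal_mul]
  simp

theorem H1norm_nonneg (w : Space n → ℝ) : 0 ≤ H1norm U w := Real.sqrt_nonneg _

theorem H2norm_nonneg (w : Space n → ℝ) : 0 ≤ H2norm U w := Real.sqrt_nonneg _

theorem l2norm_le_H1norm (w : Space n → ℝ) : l2norm U w ≤ H1norm U w :=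
  Real.le_sqrt_of_sq_le (le_add_of_nonneg_right (Finset.sum_nonneg fun _ _ => sq_nonneg _))

theorem l2norm_weakDeriv_le_H1norm (w : Space n → ℝ) (i : Fin n) :
    l2norm U (weakDeriv U i w) ≤ H1norm U w := by
  refine Real.le_sqrt_of_sq_le (le_add_of_nonneg_of_le (sq_nonneg _) ?_)
  exact Finset.single_le_sum (f := fun i => l2norm U (weakDeriv U i w) ^ 2)
    (fun _ _ => sq_nonneg _) (Finset.mem_univ i)

theorem H1norm_le_H2norm (w : Space n → ℝ) : H1norm U w ≤ H2norm U w := by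
  refine Real.sqrt_le_sqrt (add_le_add le_rfl (Finset.sum_le_sum fun i _ => ?_))
  exact pow_le_pow_left₀ (l2norm_nonneg _) (l2norm_le_H1norm _) 2

theorem H1norm_le_sum (w : Space n → ℝ) :
    H1norm U w ≤ l2norm U w + ∑ i, l2norm U (weakDeriv U i w) := by
  have hs : 0 ≤ ∑ i, l2norm U (weakDeriv U i w) := Finset.sum_nonneg fun _ _ => l2norm_nonneg _
  refine Real.sqrt_le_iff.2 ⟨add_nonneg (l2norm_nonneg _) hs, ?_⟩
  have h1 := Finset.sum_sq_le_sq_sum_of_nonneg (s := Finset.univ)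
    (f := fun i => l2norm U (weakDeriv U i w)) fun _ _ => l2norm_nonneg _
  nlinarith [mul_nonneg (l2norm_nonneg (U := U) w) hs]

theorem MemW1.congr {p : ℝ≥0∞} {w w' : Space n → ℝ} (h : MemW1 U p w)
    (hw : w =ᵐ[volume.restrict U] w') : MemW1 U p w' :=
  ⟨h.1.ae_eq hw, fun i => let ⟨v, hv, hm⟩ := h.2 i; ⟨v, hv.congr hw .rfl, hm⟩⟩

theorem MemW1.add {p : ℝ≥0∞} {w w' : Space n → ℝ} (h : MemW1 U p w) (h' : MemW1 U p w') :
    MemW1 U p (fun x => w x + w' x) := by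
  refine ⟨h.1.add h'.1, fun i => ?_⟩
  obtain ⟨v, hv, hm⟩ := h.2 i
  obtain ⟨v', hv', hm'⟩ := h'.2 i
  exact ⟨_, hv.add hv', hm.add hm'⟩

theorem MemW1.const_mul {p : ℝ≥0∞} {w : Space n → ℝ} (h : MemW1 U p w) (c : ℝ) :
    MemW1 U p (fun x => c * w x) := by
  refine ⟨h.1.const_mul c, fun i => ?_⟩
  obtain ⟨v, hv, hm⟩ := h.2 i
  exact ⟨_, hv.const_mul c, hm.const_mul c⟩

/-- The factor `1 + n` comes from comparing the Euclidean combination of the norms with their sum.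
It is crude but harmless, since the final constant may depend on the dimension. -/
theorem H1norm_add_le (hU : IsOpen U) {w w' : Space n → ℝ} (h : MemH1 U w) (h' : MemH1 U w') :
    H1norm U (fun x => w x + w' x) ≤ (1 + n) * (H1norm U w + H1norm U w') := by
  refine (H1norm_le_sum _).trans ?_
  have h1 : ∀ i, l2norm U (weakDeriv U i fun x => w x + w' x) ≤ H1norm U w + H1norm U w' := by
    intro i
    rw [l2norm_congr (((h.hasWeakDeriv i).add (h'.hasWeakDeriv i)).weakDeriv_ae_eq hU)]
    exact (l2norm_add_le (h.memLp_weakDeriv hU i) (h'.memLp_weakDeriv hU i)).trans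
      (add_le_add (l2norm_weakDeriv_le_H1norm _ _) (l2norm_weakDeriv_le_H1norm _ _))
  have h2 := (l2norm_add_le h.1 h'.1).trans
    (add_le_add (l2norm_le_H1norm (U := U) w) (l2norm_le_H1norm (U := U) w'))
  have h3 := Finset.sum_le_sum fun i (_ : i ∈ Finset.univ) => h1 i
  simp only [Finset.sum_const, Finset.card_univ, Fintype.card_fin, nsmul_eq_mul] at h3
  linarith

theorem H1norm_const_mul_le (hU : IsOpen U) {w : Space n → ℝ} (h : MemH1 U w) (c : ℝ) :
    H1norm U (fun x => c * w x) ≤ (1 + n) * (|c| * H1norm U w) := by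
  refine (H1norm_le_sum _).trans ?_
  have h1 : ∀ i, l2norm U (weakDeriv U i fun x => c * w x) ≤ |c| * H1norm U w := by
    intro i
    rw [l2norm_congr (((h.hasWeakDeriv i).const_mul c).weakDeriv_ae_eq hU), l2norm_const_mul]
    exact mul_le_mul_of_nonneg_left (l2norm_weakDeriv_le_H1norm _ _) (abs_nonneg c)
  have h2 : l2norm U (fun x => c * w x) ≤ |c| * H1norm U w := by
    rw [l2norm_const_mul]
    exact mul_le_mul_of_nonneg_left (l2norm_le_H1norm _) (abs_nonneg c)
  have h3 := Finset.sum_le_sum fun i (_ : i ∈ Finset.univ) => h1 i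
  simp only [Finset.sum_const, Finset.card_univ, Fintype.card_fin, nsmul_eq_mul] at h3
  linarith

theorem H1norm_congr (hU : IsOpen U) {w w' : Space n → ℝ} (h : MemH1 U w)
    (hw : w =ᵐ[volume.restrict U] w') : H1norm U w = H1norm U w' := by
  have h1 : ∀ i, l2norm U (weakDeriv U i w) = l2norm U (weakDeriv U i w') := fun i =>
    l2norm_congr (((h.hasWeakDeriv i).congr hw .rfl).weakDeriv_ae_eq hU).symm
  simp only [H1norm, l2norm_congr hw, h1]

end WeakDeriv

/-! ### Mollification and differences along segments. -/

section Mollification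

variable {n : ℕ} {U : Set (Space n)}

/-- The mollification of `w` (extended by zero outside `U`) by the bump function `φ`. -/
def mollify (U : Set (Space n)) (φ : ContDiffBump (0 : Space n)) (w : Space n → ℝ) :
    Space n → ℝ :=
  convolution (φ.normed volume) (U.indicator w) (ContinuousLinearMap.lsmul ℝ ℝ) volume

/-- The probability measure with density `φ`. -/
def bumpMeasure (φ : ContDiffBump (0 : Space n)) : Measure (Space n) :=
  volume.withDensity fun x => ENNReal.ofReal (φ.normed volume x)

instance (φ : ContDiffBump (0 : Space n)) : IsProbabilityMeasure (bumpMeasure φ) := by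
  constructor
  rw [bumpMeasure, withDensity_apply _ MeasurableSet.univ, Measure.restrict_univ,
    ← ofReal_integral_eq_lintegral_ofReal φ.integrable_normed
      (Eventually.of_forall fun x => φ.nonneg_normed x), φ.integral_normed, ENNReal.ofReal_one]

theorem contDiff_mollify (φ : ContDiffBump (0 : Space n)) {w : Space n → ℝ} (hU : IsOpen U)
    (hw : IntegrableOn w U) : ContDiff ℝ 1 (mollify U φ w) :=
  φ.hasCompactSupport_normed.contDiff_convolution_left _ φ.contDiff_normed
    (hw.integrable_indicator hU.measurableSet).locallyIntegrable

theorem fderiv_mollify_apply (φ : ContDiffBump (0 : Space n)) {w : Space n → ℝ} (hU : IsOpen U)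
    (hw : IntegrableOn w U) (z e : Space n) :
    fderiv ℝ (mollify U φ w) z e =
      ∫ t in U, w t * fderiv ℝ (φ.normed volume) (z - t) e := by
  have hl : LocallyIntegrable (U.indicator w) volume :=
    (hw.integrable_indicator hU.measurableSet).locallyIntegrable
  have h1 := φ.hasCompactSupport_normed (μ := volume).hasFDerivAt_convolution_left
    (ContinuousLinearMap.lsmul ℝ ℝ) (φ.contDiff_normed (n := 1)) hl z
  have h2 : ConvolutionExists (fderiv ℝ (φ.normed volume)) (U.indicator w)
      ((ContinuousLinearMap.lsmul ℝ ℝ).precompL (Space n)) volume :=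
    HasCompactSupport.convolutionExists_left _ (φ.hasCompactSupport_normed.fderiv ℝ)
      ((φ.contDiff_normed (n := 1)).continuous_fderiv one_ne_zero) hl
  rw [mollify, h1.fderiv, convolution_eq_swap, ContinuousLinearMap.integral_apply]
  · rw [← integral_indicator hU.measurableSet]
    refine integral_congr_ae (Eventually.of_forall fun t => ?_)
    by_cases ht : t ∈ U <;> simp [ht, ContinuousLinearMap.precompL_apply, mul_comm]
  · exact (h2 z).integrable_swap

/-- When the ball of radius `rOut` about `z` lies in `U`, the reflected and translated bump is a
test function on `U`, so the derivative passes from the bump to `w`. -/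
theorem fderiv_mollify_single (φ : ContDiffBump (0 : Space n)) {w v : Space n → ℝ}
    (hU : IsOpen U) (hw : IntegrableOn w U) {i : Fin n} (h : HasWeakDeriv U i w v) {z : Space n}
    (hz : Metric.closedBall z φ.rOut ⊆ U) :
    fderiv ℝ (mollify U φ w) z (EuclideanSpace.single i 1) =
      ∫ t in U, v t * φ.normed volume (z - t) := by
  rw [fderiv_mollify_apply φ hU hw]
  have hs : tsupport (fun t => φ.normed volume (z - t)) ⊆ Metric.closedBall z φ.rOut := by
    refine closure_minimal (fun t ht => ?_) Metric.isClosed_closedBall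
    have : z - t ∈ Function.support (φ.normed volume) := ht
    rw [φ.support_normed_eq, mem_ball_zero_iff] at this
    rw [mem_closedBall_iff_norm, norm_sub_rev]
    exact this.le
  have ht : IsTest U (fun t => φ.normed volume (z - t)) :=
    ⟨φ.contDiff_normed.comp (contDiff_const.sub contDiff_id),
      HasCompactSupport.of_support_subset_isCompact (isCompact_closedBall z φ.rOut)
        ((subset_tsupport _).trans hs), hs.trans hz⟩
  have h1 := h.2.2 _ ht
  have h2 : ∀ t, fderiv ℝ (fun t => φ.normed volume (z - t)) t (EuclideanSpace.single i 1) =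
      - fderiv ℝ (φ.normed volume) (z - t) (EuclideanSpace.single i 1) := by
    intro t
    have h3 : HasFDerivAt (φ.normed volume) (fderiv ℝ (φ.normed volume) (z - t)) (z - t) :=
      ((φ.contDiff_normed (n := 1)).differentiable one_ne_zero _).hasFDerivAt
    have h4 : HasFDerivAt (fun t => φ.normed volume (z - t)) _ t :=
      h3.comp t ((hasFDerivAt_const z t).sub (hasFDerivAt_id t))
    rw [h4.fderiv]
    simp
  simp only [h2, mul_neg, integral_neg, neg_inj] at h1
  exact h1

/-- The bound is an average of translates of `H` against a probability measure. This form survives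
Jensen's inequality and translation-invariant integration in the later estimates. -/
theorem enorm_fderiv_mollify_le (φ : ContDiffBump (0 : Space n)) {w : Space n → ℝ}
    {v : Fin n → Space n → ℝ} (hU : IsOpen U) (hw : IntegrableOn w U)
    (hv : ∀ i, IntegrableOn (v i) U) (h : ∀ i, HasWeakDeriv U i w (v i)) {H : Space n → ℝ≥0∞}
    (hHm : Measurable H) (hH : ∀ᵐ x ∂(volume.restrict U), ∑ i, ‖v i x‖ₑ ≤ H x) {z : Space n}
    (hz : Metric.closedBall z φ.rOut ⊆ U) (d : Space n) :
    ‖fderiv ℝ (mollify U φ w) z d‖ₑ ≤ ‖d‖ₑ * ∫⁻ t, H (z - t) ∂(bumpMeasure φ) := by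
  have hψ : Continuous fun t => φ.normed volume (z - t) :=
    φ.continuous_normed.comp (continuous_const.sub continuous_id)
  have h1 : fderiv ℝ (mollify U φ w) z d =
      ∑ i, d i * ∫ t in U, v i t * φ.normed volume (z - t) := by
    conv_lhs => rw [← (EuclideanSpace.basisFun (Fin n) ℝ).sum_repr d]
    simp [map_sum, fderiv_mollify_single φ hU hw (h _) hz]
  have h2 : ∀ i, ‖∫ t in U, v i t * φ.normed volume (z - t)‖ₑ ≤
      ∫⁻ t in U, ‖v i t‖ₑ * ENNReal.ofReal (φ.normed volume (z - t)) := by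
    intro i
    refine (enorm_integral_le_lintegral_enorm _).trans_eq (lintegral_congr fun t => ?_)
    rw [enorm_mul, Real.enorm_of_nonneg (φ.nonneg_normed _)]
  calc ‖fderiv ℝ (mollify U φ w) z d‖ₑ
      ≤ ∑ i, ‖d i‖ₑ * ‖∫ t in U, v i t * φ.normed volume (z - t)‖ₑ := by
        rw [h1]
        refine (enorm_sum_le _ _).trans_eq (Finset.sum_congr rfl fun i _ => enorm_mul _ _)
    _ ≤ ∑ i, ‖d‖ₑ * ∫⁻ t in U, ‖v i t‖ₑ * ENNReal.ofReal (φ.normed volume (z - t)) := by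
        refine Finset.sum_le_sum fun i _ => mul_le_mul' ?_ (h2 i)
        exact enorm_le_iff_norm_le.2 (PiLp.norm_apply_le d i)
    _ = ‖d‖ₑ * ∫⁻ t in U, (∑ i, ‖v i t‖ₑ) * ENNReal.ofReal (φ.normed volume (z - t)) := by
        rw [← Finset.mul_sum, ← lintegral_finsetSum']
        · simp only [Finset.sum_mul]
        · exact fun i _ => (hv i).1.enorm.mul (hψ.measurable.ennreal_ofReal.aemeasurable)
    _ ≤ ‖d‖ₑ * ∫⁻ t, H t * ENNReal.ofReal (φ.normed volume (z - t)) := by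
        refine mul_le_mul' le_rfl ((lintegral_mono_ae ?_).trans (setLIntegral_le_lintegral U _))
        exact hH.mono fun t ht => mul_le_mul' ht le_rfl
    _ = ‖d‖ₑ * ∫⁻ t, H (z - t) ∂(bumpMeasure φ) := by
        have hHz : Measurable fun t => H (z - t) := hHm.comp (measurable_const.sub measurable_id)
        rw [bumpMeasure, lintegral_withDensity_eq_lintegral_mul _
          φ.continuous_normed.measurable.ennreal_ofReal hHz,
          ← lintegral_sub_left_eq_self _ z]
        simp [mul_comm]

/-- A segment in `U` is compact, so it has a neighbourhood in `U` and all sufficiently fine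
mollifications obey the gradient bound along it. The threshold depends on the segment, hence the
`∀ᶠ` inside the quantifiers on `x` and `y`. -/
theorem exists_mollification (hU : IsOpen U) {w : Space n → ℝ} {v : Fin n → Space n → ℝ}
    (hw : IntegrableOn w U) (hv : ∀ i, IntegrableOn (v i) U)
    (h : ∀ i, HasWeakDeriv U i w (v i)) {H : Space n → ℝ≥0∞} (hHm : Measurable H)
    (hH : ∀ᵐ x ∂(volume.restrict U), ∑ i, ‖v i x‖ₑ ≤ H x) :
    ∃ (W : ℕ → Space n → ℝ) (ν : ℕ → Measure (Space n)), (∀ k, IsProbabilityMeasure (ν k)) ∧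
      (∀ᵐ x ∂(volume.restrict U), Tendsto (fun k => W k x) atTop (𝓝 (w x))) ∧
      ∀ x y, segment ℝ x y ⊆ U → ∀ᶠ k in atTop, ‖W k y - W k x‖ₑ ≤
        ‖y - x‖ₑ * ∫⁻ s in Set.Icc (0 : ℝ) 1, ∫⁻ t, H (x + s • (y - x) - t) ∂(ν k) := by
  -- The bounded ratio of outer to inner radius is what the a.e. convergence by Lebesgue
  -- differentiation needs.
  let φ : ℕ → ContDiffBump (0 : Space n) := fun k =>
    ⟨1 / (2 * ((k : ℝ) + 1)), 1 / ((k : ℝ) + 1), by positivity, by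
      rw [one_div_lt_one_div (by positivity) (by positivity)]; linarith [k.cast_nonneg (α := ℝ)]⟩
  have hφ : Tendsto (fun k => (φ k).rOut) atTop (𝓝 0) := tendsto_one_div_add_atTop_nhds_zero_nat
  have hφ' : ∀ᶠ k in atTop, (φ k).rOut ≤ 2 * (φ k).rIn := by
    refine Eventually.of_forall fun k => le_of_eq ?_
    simp only [φ]
    field_simp
  refine ⟨fun k => mollify U (φ k) w, fun k => bumpMeasure (φ k), fun k => inferInstance, ?_, ?_⟩
  · have := ContDiffBump.ae_convolution_tendsto_right_of_locallyIntegrable (μ := volume) hφ hφ'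
      (hw.integrable_indicator hU.measurableSet).locallyIntegrable
    rw [ae_restrict_iff' hU.measurableSet]
    filter_upwards [this] with x hx hxU
    rw [Set.indicator_of_mem hxU] at hx
    exact hx
  · intro x y hxy
    have hc : IsCompact (segment ℝ x y) := by
      rw [segment_eq_image_lineMap]
      exact isCompact_Icc.image AffineMap.lineMap_continuous
    obtain ⟨δ, hδ, hδU⟩ := hc.exists_cthickening_subset_open hU hxy
    filter_upwards [hφ.eventually (gt_mem_nhds hδ)] with k hk
    have hseg : ∀ s ∈ Set.Icc (0 : ℝ) 1, Metric.closedBall (x + s • (y - x)) (φ k).rOut ⊆ U := by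
      intro s hs
      refine (Metric.closedBall_subset_closedBall hk.le).trans (le_trans ?_ hδU)
      refine Metric.closedBall_subset_cthickening ?_ δ
      rw [segment_eq_image']
      exact ⟨s, hs, rfl⟩
    have hC := contDiff_mollify (φ k) hU hw
    have hd : ∀ s : ℝ, HasDerivAt (fun s : ℝ => mollify U (φ k) w (x + s • (y - x)))
        (fderiv ℝ (mollify U (φ k) w) (x + s • (y - x)) (y - x)) s := by
      intro s
      have h3 : HasDerivAt (fun s : ℝ => x + s • (y - x)) (y - x) s := by
        simpa using ((hasDerivAt_id s).smul_const (y - x)).const_add x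
      exact ((hC.differentiable one_ne_zero _).hasFDerivAt).comp_hasDerivAt s h3
    have hcont : Continuous fun s : ℝ =>
        fderiv ℝ (mollify U (φ k) w) (x + s • (y - x)) (y - x) :=
      ((hC.continuous_fderiv one_ne_zero).comp (by fun_prop)).clm_apply continuous_const
    have hF := intervalIntegral.integral_eq_sub_of_hasDerivAt (a := 0) (b := 1)
      (fun s _ => hd s) (hcont.intervalIntegrable _ _)
    simp only [one_smul, add_sub_cancel, zero_smul, add_zero] at hF
    rw [← hF, intervalIntegral.integral_of_le zero_le_one, ← integral_Icc_eq_integral_Ioc]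
    refine (enorm_integral_le_lintegral_enorm _).trans ?_
    rw [← lintegral_const_mul' _ _ enorm_ne_top]
    refine setLIntegral_mono' measurableSet_Icc fun s hs => ?_
    exact enorm_fderiv_mollify_le (φ k) hU hw hv h hHm hH (hseg s hs) _

end Mollification

/-! ### Integrated and pointwise difference estimates. -/

section MollifiedEstimates

variable {n : ℕ} {U : Set (Space n)}

theorem sq_lintegral_le {Z : Type*} [MeasurableSpace Z] (μ : Measure Z) [IsProbabilityMeasure μ]
    {f : Z → ℝ≥0∞} (hf : AEMeasurable f μ) : (∫⁻ z, f z ∂μ) ^ 2 ≤ ∫⁻ z, f z ^ 2 ∂μ := by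
  have h := ENNReal.lintegral_mul_le_Lp_mul_Lq μ Real.HolderConjugate.two_two hf
    (aemeasurable_const (b := (1 : ℝ≥0∞)))
  simp only [Pi.mul_apply, mul_one, ENNReal.one_rpow, lintegral_const, measure_univ] at h
  have h2 := pow_le_pow_left' h 2
  rwa [← ENNReal.rpow_mul_natCast, Nat.cast_two, one_div, inv_mul_cancel₀ two_ne_zero,
    ENNReal.rpow_one, lintegral_congr fun z => ENNReal.rpow_two (f z)] at h2

/-- The common source of the translation estimate and of both halves of the Poincaré inequality.
Hypothesis `hc` says that each map `z ↦ X z + s • (Y z - X z)` pushes `σ` to a measure of density at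
most `c`; Jensen, Tonelli and Fatou then pass the mollified bound to the limit. -/
theorem lintegral_enorm_sub_sq_le {Z : Type*} [MeasurableSpace Z] {σ : Measure Z} [SFinite σ]
    (hU : IsOpen U) {w : Space n → ℝ} {v : Fin n → Space n → ℝ}
    (hw : IntegrableOn w U) (hv : ∀ i, IntegrableOn (v i) U)
    (h : ∀ i, HasWeakDeriv U i w (v i)) {H : Space n → ℝ≥0∞} (hHm : Measurable H)
    (hH : ∀ᵐ x ∂(volume.restrict U), ∑ i, ‖v i x‖ₑ ≤ H x) {X Y : Z → Space n}
    (hX : Measurable X) (hY : Measurable Y) (hseg : ∀ᵐ z ∂σ, segment ℝ (X z) (Y z) ⊆ U)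
    {c d : ℝ≥0∞} (hd : ∀ᵐ z ∂σ, ‖Y z - X z‖ₑ ≤ d)
    (hc : ∀ s ∈ Set.Icc (0 : ℝ) 1, ∀ Q : Space n → ℝ≥0∞, Measurable Q →
      ∫⁻ z, Q (X z + s • (Y z - X z)) ∂σ ≤ c * ∫⁻ x, Q x) :
    ∫⁻ z, ‖w (Y z) - w (X z)‖ₑ ^ 2 ∂σ ≤ d ^ 2 * (c * ∫⁻ x, H x ^ 2) := by
  obtain ⟨W, ν, hν, hW, hWs⟩ := exists_mollification hU hw hv h hHm hH
  -- Testing `hc` with the indicator of a null set shows that its preimage is null. For `s = 0` and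
  -- `s = 1` this gives convergence of the mollifications at `X z` and `Y z` for a.e. `z`.
  have hnull : ∀ s ∈ Set.Icc (0 : ℝ) 1, ∀ N : Set (Space n), volume N = 0 →
      ∀ᵐ z ∂σ, X z + s • (Y z - X z) ∉ N := by
    intro s hs N hN
    have hN' : volume (toMeasurable volume N) = 0 := by rw [measure_toMeasurable, hN]
    have hm := measurableSet_toMeasurable volume N
    have h1 := hc s hs ((toMeasurable volume N).indicator 1) (measurable_one.indicator hm)
    have hm' : Measurable fun z => (toMeasurable volume N).indicator (1 : Space n → ℝ≥0∞)
        (X z + s • (Y z - X z)) :=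
      (measurable_one.indicator hm).comp (hX.add ((hY.sub hX).const_smul s))
    rw [lintegral_indicator_one hm, hN', mul_zero, nonpos_iff_eq_zero,
      lintegral_eq_zero_iff hm'] at h1
    filter_upwards [h1] with z hz hzN
    have := subset_toMeasurable volume N hzN
    simp [Set.indicator_of_mem this] at hz
  rw [ae_restrict_iff' hU.measurableSet] at hW
  have hX0 := hnull 0 (by simp) _ hW
  have hY0 := hnull 1 (by simp) _ hW
  have hHs : ∀ s : ℝ, Measurable fun q : Z × Space n =>
      H (X q.1 + s • (Y q.1 - X q.1) - q.2) ^ 2 := fun s =>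
    (hHm.comp (((hX.comp measurable_fst).add
      (((hY.comp measurable_fst).sub (hX.comp measurable_fst)).const_smul s)).sub
        measurable_snd)).pow_const 2
  have hm3 : Measurable fun q : (Z × ℝ) × Space n =>
      H (X q.1.1 + q.1.2 • (Y q.1.1 - X q.1.1) - q.2) :=
    hHm.comp (((hX.comp measurable_fst.fst).add (measurable_fst.snd.smul
      ((hY.comp measurable_fst.fst).sub (hX.comp measurable_fst.fst)))).sub measurable_snd)
  have hm2 : ∀ k, Measurable fun q : Z × ℝ =>
      ∫⁻ t, H (X q.1 + q.2 • (Y q.1 - X q.1) - t) ^ 2 ∂(ν k) := fun k =>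
    (hm3.pow_const 2).lintegral_prod_right'
  let R : ℕ → Z → ℝ≥0∞ := fun k z => d ^ 2 * ∫⁻ s in Set.Icc (0 : ℝ) 1,
    ∫⁻ t, H (X z + s • (Y z - X z) - t) ^ 2 ∂(ν k)
  have hR : ∀ k, Measurable (R k) := fun k =>
    ((hm2 k).lintegral_prod_right' (ν := volume.restrict (Set.Icc (0 : ℝ) 1))).const_mul _
  have hprob : IsProbabilityMeasure (volume.restrict (Set.Icc (0 : ℝ) 1)) :=
    ⟨by simp⟩
  have hpt : ∀ᵐ z ∂σ, ‖w (Y z) - w (X z)‖ₑ ^ 2 ≤ liminf (fun k => R k z) atTop := by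
    filter_upwards [hX0, hY0, hseg, hd] with z h0 h1 h2 h3
    simp only [zero_smul, add_zero, one_smul, add_sub_cancel, not_not, Set.mem_compl_iff,
      Set.mem_ofPred_eq] at h0 h1
    have hx := h0 (h2 (left_mem_segment ℝ _ _))
    have hy := h1 (h2 (right_mem_segment ℝ _ _))
    have ht : Tendsto (fun k => ‖W k (Y z) - W k (X z)‖ₑ ^ 2) atTop
        (𝓝 (‖w (Y z) - w (X z)‖ₑ ^ 2)) := ENNReal.Tendsto.pow (hy.sub hx).enorm
    rw [← ht.liminf_eq]
    refine liminf_le_liminf ?_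
    filter_upwards [hWs _ _ h2] with k hk
    refine (pow_le_pow_left' hk 2).trans ?_
    rw [mul_pow]
    refine mul_le_mul' (pow_le_pow_left' h3 2) ?_
    have hms : Measurable fun q : ℝ × Space n => H (X z + q.1 • (Y z - X z) - q.2) :=
      hm3.comp ((measurable_const.prodMk measurable_fst).prodMk measurable_snd)
    refine (sq_lintegral_le _ (hms.lintegral_prod_right' (ν := ν k)).aemeasurable).trans ?_
    refine lintegral_mono fun s => sq_lintegral_le _ ?_
    exact (hms.comp (measurable_const.prodMk measurable_id)).aemeasurable
  refine (lintegral_mono_ae hpt).trans ((lintegral_liminf_le hR).trans ?_)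
  refine liminf_le_of_le (by isBoundedDefault) fun b hb => ?_
  obtain ⟨k, hk⟩ := hb.exists
  refine hk.trans ?_
  simp only [R]
  rw [lintegral_const_mul _ ((hm2 k).lintegral_prod_right')]
  refine mul_le_mul' le_rfl ?_
  rw [lintegral_lintegral_swap (hm2 k).aemeasurable]
  calc _ ≤ ∫⁻ _ in Set.Icc (0 : ℝ) 1, c * ∫⁻ x, H x ^ 2 := by
        refine setLIntegral_mono' measurableSet_Icc fun s hs => ?_
        -- With the shift `t` outermost, `hc` applies to a translate of `H ^ 2`, whose integral does
        -- not depend on `t`.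
        rw [lintegral_lintegral_swap (hHs s).aemeasurable]
        calc _ ≤ ∫⁻ _, (c * ∫⁻ x, H x ^ 2) ∂(ν k) := by
              refine lintegral_mono fun t => ?_
              refine (hc s hs (fun x => H (x - t) ^ 2)
                ((hHm.comp (measurable_id.sub_const t)).pow_const 2)).trans_eq ?_
              rw [lintegral_sub_right_eq_self (fun x => H x ^ 2) t]
          _ = _ := by simp
    _ = _ := by simp

/-- Both points are joined to the centre. The mollifications need not converge at that single point,
but their value there cancels before the limit is taken. -/
theorem exists_forall_enorm_sub_le_of_starConvex (hU : IsOpen U) {w : Space n → ℝ}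
    {v : Fin n → Space n → ℝ} (hw : IntegrableOn w U) (hv : ∀ i, IntegrableOn (v i) U)
    (h : ∀ i, HasWeakDeriv U i w (v i)) {M : ℝ≥0∞}
    (hM : ∀ᵐ x ∂(volume.restrict U), ∑ i, ‖v i x‖ₑ ≤ M) {c : Space n} (hs : StarConvex ℝ c U)
    {d : ℝ≥0∞} (hd : ∀ x ∈ U, ‖x - c‖ₑ ≤ d) :
    ∃ G : Set (Space n), (∀ᵐ x ∂(volume.restrict U), x ∈ G) ∧
      ∀ x ∈ G, ∀ y ∈ G, ‖w x - w y‖ₑ ≤ 2 * (d * M) := by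
  obtain ⟨W, ν, hν, hW, hWs⟩ := exists_mollification hU hw hv h measurable_const hM
  refine ⟨{x | x ∈ U ∧ Tendsto (fun k => W k x) atTop (𝓝 (w x))}, ?_, ?_⟩
  · filter_upwards [hW, ae_restrict_mem hU.measurableSet] with x hx hxU using ⟨hxU, hx⟩
  rintro x ⟨hx, hxW⟩ y ⟨hy, hyW⟩
  refine le_of_tendsto (hxW.sub hyW).enorm ?_
  have hk : ∀ x ∈ U, ∀ᶠ k in atTop, ‖W k x - W k c‖ₑ ≤ d * M := by
    intro x hx
    filter_upwards [hWs c x (starConvex_iff_segment_subset.1 hs hx)] with k hk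
    simp only [lintegral_const, measure_univ, mul_one, MeasurableSet.univ,
      Measure.restrict_apply, Set.univ_inter, Real.volume_Icc, sub_zero, ENNReal.ofReal_one] at hk
    exact hk.trans (mul_le_mul' (hd x hx) le_rfl)
  filter_upwards [hk x hx, hk y hy] with k h1 h2
  have : W k x - W k y = (W k x - W k c) - (W k y - W k c) := by ring
  rw [this, two_mul]
  exact (enorm_sub_le).trans (add_le_add h1 h2)

end MollifiedEstimates

/-! ### Stability of `H¹` under Lipschitz maps. -/

section Truncation

variable {n : ℕ} {U : Set (Space n)}

/-- The bound makes `l` factor through the range of `J`; Hahn–Banach extends the factor with the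
same norm and Riesz represents it. The range need be neither closed nor dense. -/
theorem exists_eq_inner_of_le {V F : Type*} [AddCommGroup V] [Module ℝ V] [NormedAddCommGroup F]
    [InnerProductSpace ℝ F] [CompleteSpace F] (J : V →ₗ[ℝ] F) (l : V →ₗ[ℝ] ℝ) {A : ℝ} (hA : 0 ≤ A)
    (h : ∀ x, |l x| ≤ A * ‖J x‖) : ∃ v : F, ‖v‖ ≤ A ∧ ∀ x, l x = inner ℝ v (J x) := by
  have hk : LinearMap.ker J ≤ LinearMap.ker l := by
    intro x hx
    have := h x
    rw [LinearMap.mem_ker.1 hx, norm_zero, mul_zero] at this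
    exact abs_nonpos_iff.1 this
  let l' : LinearMap.range J →ₗ[ℝ] ℝ :=
    (LinearMap.ker J).liftQ l hk ∘ₗ (J.quotKerEquivRange.symm : LinearMap.range J →ₗ[ℝ] _)
  have hl' : ∀ x, l' ⟨J x, LinearMap.mem_range_self J x⟩ = l x := by
    intro x
    simp only [l', LinearMap.comp_apply, LinearEquiv.coe_coe]
    rw [J.quotKerEquivRange_symm_apply_image x (LinearMap.mem_range_self J x)]
    simp
  have hb : ∀ y : LinearMap.range J, ‖l' y‖ ≤ A * ‖y‖ := by
    rintro ⟨_, x, rfl⟩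
    rw [hl', Real.norm_eq_abs]
    exact h x
  obtain ⟨g, hg, hgn⟩ := exists_extension_norm_eq (LinearMap.range J) (l'.mkContinuous A hb)
  refine ⟨(InnerProductSpace.toDual ℝ F).symm g, ?_, fun x => ?_⟩
  · rw [LinearIsometryEquiv.norm_map, hgn]
    exact LinearMap.mkContinuous_norm_le _ hA _
  · rw [InnerProductSpace.toDual_symm_apply, ← hl' x]
    exact (hg ⟨J x, LinearMap.mem_range_self J x⟩).symm

/-- Duality characterisation of `H¹`: a distributional derivative bounded on test functions in the
`L²` norm is an `L²` function. -/
theorem exists_weakDeriv_of_le {u : Space n → ℝ} (hu : LocallyIntegrableOn u U) {i : Fin n} {A : ℝ}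
    (hA : 0 ≤ A) (hU' : volume U ≠ ⊤)
    (h : ∀ φ, IsTest U φ → |∫ x in U, u x * fderiv ℝ φ x (EuclideanSpace.single i 1)| ≤
      A * l2norm U φ) :
    ∃ v : L2 U, ‖v‖ ≤ A ∧ HasWeakDeriv U i u v := by
  have hfin : IsFiniteMeasure (volume.restrict U) := ⟨by simpa using hU'.lt_top⟩
  let S : Submodule ℝ (Space n → ℝ) :=
    { carrier := {φ | IsTest U φ}
      add_mem' := fun {φ ψ} hφ hψ => ⟨hφ.1.add hψ.1, hφ.2.1.add hψ.2.1,
        (tsupport_add _ _).trans (Set.union_subset hφ.2.2 hψ.2.2)⟩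
      zero_mem' := ⟨contDiff_const, HasCompactSupport.zero, by simp [tsupport]⟩
      smul_mem' := fun c φ hφ => ⟨hφ.1.const_smul c, hφ.2.1.smul_left (f := fun _ => c),
        (tsupport_smul_subset_right (fun _ => c) φ).trans hφ.2.2⟩ }
  have hS : ∀ φ : S, MemLp (φ : Space n → ℝ) 2 (volume.restrict U) := fun φ =>
    (φ.2.1.continuous.memLp_of_hasCompactSupport φ.2.2.1).restrict U
  have hi : ∀ φ : S, IntegrableOn
      (fun x => u x * fderiv ℝ (φ : Space n → ℝ) x (EuclideanSpace.single i 1)) U := fun φ =>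
    (integrable_mul_of_tsupport_subset hu (φ.2.continuous_fderiv_apply _)
      (φ.2.hasCompactSupport_fderiv_apply _) (φ.2.tsupport_fderiv_apply _)).integrableOn
  have hd : ∀ (φ : S) (x : Space n), DifferentiableAt ℝ (φ : Space n → ℝ) x := fun φ x =>
    φ.2.1.differentiable (by simp) x
  let J : S →ₗ[ℝ] L2 U :=
    { toFun := fun φ => (hS φ).toLp
      map_add' := fun φ ψ => MemLp.toLp_add (hS φ) (hS ψ)
      map_smul' := fun c φ => MemLp.toLp_const_smul c (hS φ) }
  let l : S →ₗ[ℝ] ℝ :=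
    { toFun := fun φ => -∫ x in U, u x * fderiv ℝ φ x (EuclideanSpace.single i 1)
      map_add' := fun φ ψ => by
        rw [← neg_add, ← integral_add (hi φ) (hi ψ)]
        congr 1
        refine integral_congr_ae (Eventually.of_forall fun x => ?_)
        simp only [Submodule.coe_add]
        rw [fderiv_add (hd φ x) (hd ψ x), add_apply, mul_add]
      map_smul' := fun c φ => by
        rw [RingHom.id_apply, smul_eq_mul, mul_neg, ← integral_const_mul]
        congr 1
        refine integral_congr_ae (Eventually.of_forall fun x => ?_)
        simp only [Submodule.coe_smul]
        rw [fderiv_const_smul (hd φ x), smul_apply, smul_eq_mul]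
        ring }
  obtain ⟨v, hv, hvl⟩ := exists_eq_inner_of_le J l hA fun φ => by
    simp only [l, J, LinearMap.coe_mk, AddHom.coe_mk, abs_neg]
    rw [Lp.norm_toLp]
    exact h φ φ.2
  refine ⟨v, hv, hu, IntegrableOn.locallyIntegrableOn ((Lp.memLp v).integrable one_le_two),
    fun φ hφ => ?_⟩
  have h1 := hvl ⟨φ, hφ⟩
  simp only [l, J, LinearMap.coe_mk, AddHom.coe_mk] at h1
  rw [L2.inner_def] at h1
  rw [neg_eq_iff_eq_neg.1 h1]
  congr 1
  refine integral_congr_ae ?_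
  filter_upwards [(hS ⟨φ, hφ⟩).coeFn_toLp] with x hx
  rw [hx]
  simp [mul_comm]

/-- The majorant of the gradient is measurable and extended by zero to the whole space, so that it
can be translated freely. -/
theorem MemW1.exists_measurable_bound (hU : IsOpen U) {g : Space n → ℝ} (h : MemH1 U g) :
    ∃ H : Space n → ℝ≥0∞, Measurable H ∧
      (∀ᵐ x ∂(volume.restrict U), ∑ i, ‖weakDeriv U i g x‖ₑ ≤ H x) ∧
      ∫⁻ x, H x ^ 2 ≤ ENNReal.ofReal (∑ i, l2norm U (weakDeriv U i g)) ^ 2 := by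
  have hm := fun i => h.memLp_weakDeriv hU i
  let v : Fin n → Space n → ℝ := fun i => (hm i).1.mk
  have hv : ∀ i, Measurable fun x => ‖v i x‖ₑ := fun i => (hm i).1.stronglyMeasurable_mk.enorm
  have hvm : Measurable fun x => ∑ i, ‖v i x‖ₑ := Finset.measurable_sum _ fun i _ => hv i
  refine ⟨U.indicator fun x => ∑ i, ‖v i x‖ₑ, hvm.indicator hU.measurableSet, ?_, ?_⟩
  · have : ∀ i, ∀ᵐ x ∂(volume.restrict U), weakDeriv U i g x = v i x := fun i => (hm i).1.ae_eq_mk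
    filter_upwards [ae_all_iff.2 this, ae_restrict_mem hU.measurableSet] with x hx hxU
    rw [Set.indicator_of_mem hxU]
    exact Finset.sum_le_sum fun i _ => by rw [hx i]
  · have h1 : ∫⁻ x, U.indicator (fun x => ∑ i, ‖v i x‖ₑ) x ^ 2 =
        eLpNorm (fun x => ∑ i, ‖v i x‖ₑ) 2 (volume.restrict U) ^ 2 := by
      rw [eLpNorm_eq_lintegral_rpow_enorm_toReal two_ne_zero ENNReal.ofNat_ne_top,
        ENNReal.toReal_ofNat, ← ENNReal.rpow_natCast, ← ENNReal.rpow_mul]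
      norm_num
      rw [← lintegral_indicator hU.measurableSet]
      refine lintegral_congr fun x => ?_
      by_cases hx : x ∈ U <;> simp [hx]
    rw [h1]
    refine pow_le_pow_left' ?_ 2
    have h2 : (fun x => ∑ i, ‖v i x‖ₑ) = ∑ i, fun x => ‖v i x‖ₑ := by
      ext x; rw [Finset.sum_apply]
    rw [h2]
    refine (eLpNorm_sum_le (fun i _ => (hv i).aestronglyMeasurable) one_le_two).trans ?_
    rw [ENNReal.ofReal_sum_of_nonneg fun i _ => l2norm_nonneg _]
    refine Finset.sum_le_sum fun i _ => ?_
    rw [l2norm, ENNReal.ofReal_toReal (hm i).eLpNorm_ne_top, eLpNorm_enorm,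
      eLpNorm_congr_ae (hm i).1.ae_eq_mk]

theorem MemH1.integrableOn {g : Space n → ℝ} (hU' : volume U ≠ ⊤)
    (h : MemLp g 2 (volume.restrict U)) : IntegrableOn g U := by
  have hfin : IsFiniteMeasure (volume.restrict U) := ⟨by simpa using hU'.lt_top⟩
  exact h.integrable one_le_two

/-- Translations preserve volume, so the segment estimate applies with density bound `1`. -/
theorem lintegral_translate_sub_sq_le (hU : IsOpen U) (hU' : volume U ≠ ⊤) {g : Space n → ℝ}
    (h : MemH1 U g) {H : Space n → ℝ≥0∞} (hHm : Measurable H)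
    (hH : ∀ᵐ x ∂(volume.restrict U), ∑ i, ‖weakDeriv U i g x‖ₑ ≤ H x) {K : Set (Space n)}
    (hK : MeasurableSet K) {δ : ℝ} (hKU : Metric.cthickening δ K ⊆ U) {e : Space n}
    (he : ‖e‖ ≤ δ) :
    ∫⁻ x in K, ‖g (x + e) - g x‖ₑ ^ 2 ≤ ‖e‖ₑ ^ 2 * ∫⁻ x, H x ^ 2 := by
  have := lintegral_enorm_sub_sq_le (σ := volume.restrict K) hU (MemH1.integrableOn hU' h.1)
    (fun i => MemH1.integrableOn hU' (h.memLp_weakDeriv hU i)) h.hasWeakDeriv hHm hH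
    (X := fun x => x) (Y := fun x => x + e) measurable_id (measurable_id.add_const e) (c := 1)
    (d := ‖e‖ₑ) ?_ ?_ ?_
  · simpa using this
  · filter_upwards [ae_restrict_mem hK] with x hx
    refine le_trans ?_ ((Metric.closedBall_subset_cthickening hx δ).trans hKU)
    refine (convex_closedBall x δ).segment_subset ?_ ?_
    · exact Metric.mem_closedBall_self ((norm_nonneg _).trans he)
    · simpa using he
  · simp
  · intro s _ Q hQ
    refine (setLIntegral_le_lintegral K _).trans ?_
    simp only [add_sub_cancel_left, one_mul]
    rw [lintegral_add_right_eq_self Q (s • e)]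

/-- No chain rule is needed. The derivative of `φ` is a limit of difference quotients, the
difference moves onto `Φ ∘ g`, and there the Lipschitz bound reduces it to differences of `g`. -/
theorem abs_integral_comp_mul_fderiv_le (hU : IsOpen U) (hU' : volume U ≠ ⊤) {g : Space n → ℝ}
    (hg : Measurable g) (h : MemH1 U g) {H : Space n → ℝ≥0∞} (hHm : Measurable H)
    (hH : ∀ᵐ x ∂(volume.restrict U), ∑ i, ‖weakDeriv U i g x‖ₑ ≤ H x) {A : ℝ} (hA : 0 ≤ A)
    (hHA : ∫⁻ x, H x ^ 2 ≤ ENNReal.ofReal A ^ 2) {Φ : ℝ → ℝ} (hΦ : LipschitzWith 1 Φ)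
    (hu : IntegrableOn (fun x => Φ (g x)) U) {e : Space n} (he : ‖e‖ = 1) {φ : Space n → ℝ}
    (hφ : IsTest U φ) :
    |∫ x in U, Φ (g x) * fderiv ℝ φ x e| ≤ A * l2norm U φ := by
  set u : Space n → ℝ := fun x => Φ (g x) with hudef
  obtain ⟨δ, hδ, hδU⟩ := IsCompact.exists_cthickening_subset_open hφ.2.1 hU hφ.2.2
  obtain ⟨L, hL⟩ := hφ.1.lipschitzWith_of_hasCompactSupport hφ.2.1 (by simp)
  have hφ2 : MemLp φ 2 (volume.restrict U) :=
    (hφ.1.continuous.memLp_of_hasCompactSupport hφ.2.1).restrict U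
  have hlim : Tendsto (fun t : ℝ => ∫ x in U, u x * (t⁻¹ * (φ (x + t • e) - φ x))) (𝓝[>] 0)
      (𝓝 (∫ x in U, u x * fderiv ℝ φ x e)) := by
    refine tendsto_integral_filter_of_dominated_convergence (fun x => ‖u x‖ * L) ?_ ?_ ?_ ?_
    · refine Eventually.of_forall fun t => hu.1.mul ?_
      have : Continuous fun x => t⁻¹ * (φ (x + t • e) - φ x) := by
        have := hφ.1.continuous
        fun_prop
      exact this.aestronglyMeasurable
    · filter_upwards [self_mem_nhdsWithin] with t ht
      refine Eventually.of_forall fun x => ?_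
      have ht' : 0 < t := ht
      rw [norm_mul, norm_mul, norm_inv]
      refine mul_le_mul_of_nonneg_left ?_ (norm_nonneg _)
      have := hL.dist_le_mul (x + t • e) x
      rw [dist_eq_norm, dist_eq_norm, add_sub_cancel_left, norm_smul, he, mul_one] at this
      rw [inv_mul_le_iff₀ (by simpa using ht'.ne'), mul_comm]
      exact this
    · exact hu.norm.mul_const _
    · refine Eventually.of_forall fun x => Tendsto.const_mul _ ?_
      have h1 : HasFDerivAt φ (fderiv ℝ φ x) x :=
        (hφ.1.differentiable (by simp) x).hasFDerivAt
      have h2 := (h1.hasLineDerivAt e).tendsto_slope_zero_right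
      simpa using h2
  refine le_of_tendsto hlim.abs ?_
  filter_upwards [Ioc_mem_nhdsGT hδ] with t ht
  have hlu : LocallyIntegrableOn u U := hu.locallyIntegrableOn
  have hφt : Continuous fun x => φ (x + t • e) := hφ.1.continuous.comp (continuous_add_const _)
  have hnorm : ‖t • e‖ = t := by rw [norm_smul, he, mul_one, Real.norm_of_nonneg ht.1.le]
  have hsupp : tsupport (fun x => φ (x + t • e)) ⊆ Metric.cthickening δ (tsupport φ) := by
    refine closure_minimal (fun x hx => ?_) Metric.isClosed_cthickening
    refine Metric.mem_cthickening_of_dist_le x (x + t • e) δ _ (subset_tsupport _ hx) ?_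
    rw [dist_eq_norm, sub_add_cancel_left, norm_neg, hnorm]
    exact ht.2
  have hct : HasCompactSupport fun x => φ (x + t • e) :=
    (IsCompact.cthickening hφ.2.1).of_isClosed_subset (isClosed_tsupport _) hsupp
  have hi1 := integrable_mul_of_tsupport_subset hlu hφt hct (hsupp.trans hδU)
  have hi2 := integrable_mul_of_tsupport_subset hlu hφ.1.continuous hφ.2.1 hφ.2.2
  have hi3 := hi1.comp_sub_right (t • e)
  simp only [sub_add_cancel] at hi3
  -- Discrete integration by parts. After the change of variable the integrand lives on the support
  -- of `φ`, whose `δ`-neighbourhood is in `U`, so `u` is only evaluated inside `U`.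
  have heq : ∫ x in U, u x * (t⁻¹ * (φ (x + t • e) - φ x)) =
      t⁻¹ * ∫ x in tsupport φ, (u (x + -(t • e)) - u x) * φ x := by
    have e1 : ∫ x in U, u x * (t⁻¹ * (φ (x + t • e) - φ x)) =
        t⁻¹ * ((∫ x in U, u x * φ (x + t • e)) - ∫ x in U, u x * φ x) := by
      rw [← integral_sub hi1.integrableOn hi2.integrableOn, ← integral_const_mul]
      refine integral_congr_ae (Eventually.of_forall fun x => ?_)
      simp only
      ring
    rw [e1, setIntegral_mul_of_tsupport_subset (hsupp.trans hδU),
      setIntegral_mul_of_tsupport_subset hφ.2.2, setIntegral_mul_of_tsupport_subset subset_rfl,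
      ← integral_sub_right_eq_self _ (t • e)]
    simp only [sub_add_cancel]
    rw [← integral_sub hi3 hi2]
    congr 1
    refine integral_congr_ae (Eventually.of_forall fun x => ?_)
    simp only [sub_mul, ← sub_eq_add_neg]
  rw [heq, abs_mul, abs_of_pos (inv_pos.2 ht.1), inv_mul_le_iff₀ ht.1]
  have hum : Measurable u := hΦ.continuous.measurable.comp hg
  have hdm : Measurable fun x => u (x + -(t • e)) - u x :=
    (hum.comp (measurable_id.add_const _)).sub hum
  have hsub := lintegral_translate_sub_sq_le hU hU' h hHm hH
    (isClosed_tsupport φ).measurableSet hδU (e := -(t • e)) (by rw [norm_neg, hnorm]; exact ht.2)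
  have henorm : ‖∫ x in tsupport φ, (u (x + -(t • e)) - u x) * φ x‖ₑ ≤
      ENNReal.ofReal (t * A) * eLpNorm φ 2 (volume.restrict U) := by
    refine (enorm_integral_le_lintegral_enorm _).trans ?_
    simp only [enorm_mul]
    refine (ENNReal.lintegral_mul_le_Lp_mul_Lq _ Real.HolderConjugate.two_two
      hdm.enorm.aemeasurable hφ.1.continuous.measurable.enorm.aemeasurable).trans ?_
    refine mul_le_mul' ?_ ?_
    · have h3 : ∫⁻ x in tsupport φ, ‖u (x + -(t • e)) - u x‖ₑ ^ (2 : ℝ) ≤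
          ENNReal.ofReal (t * A) ^ (2 : ℝ) := by
        simp only [ENNReal.rpow_two]
        refine le_trans (lintegral_mono fun x => pow_le_pow_left' ?_ 2) (hsub.trans ?_)
        · simpa [edist_eq_enorm_sub] using hΦ (g (x + -(t • e))) (g x)
        · rw [ENNReal.ofReal_mul ht.1.le, mul_pow, enorm_neg,
            ← ofReal_norm, hnorm]
          exact mul_le_mul' le_rfl hHA
      refine (ENNReal.rpow_le_rpow h3 (by norm_num)).trans_eq ?_
      rw [← ENNReal.rpow_mul]
      norm_num
    · rw [eLpNorm_eq_lintegral_rpow_enorm_toReal two_ne_zero ENNReal.ofNat_ne_top,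
        ENNReal.toReal_ofNat]
      exact ENNReal.rpow_le_rpow (lintegral_mono_set hφ.2.2) (by norm_num)
  have h4 := ENNReal.toReal_mono
    (ENNReal.mul_ne_top ENNReal.ofReal_ne_top hφ2.eLpNorm_ne_top) henorm
  rw [toReal_enorm, ENNReal.toReal_mul, ENNReal.toReal_ofReal (mul_nonneg ht.1.le hA),
    Real.norm_eq_abs, mul_assoc] at h4
  exact h4

/-- A Lipschitz function of an `H¹` function is an `H¹` function. -/
theorem MemH1.lipschitz_comp (hU : IsOpen U) (hU' : volume U ≠ ⊤) {g : Space n → ℝ}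
    (hg : Measurable g) (h : MemH1 U g) {Φ : ℝ → ℝ} (hΦ : LipschitzWith 1 Φ)
    (hu : MemLp (fun x => Φ (g x)) 2 (volume.restrict U)) :
    MemH1 U (fun x => Φ (g x)) ∧ ∀ i, l2norm U (weakDeriv U i fun x => Φ (g x)) ≤
      ∑ i, l2norm U (weakDeriv U i g) := by
  obtain ⟨H, hHm, hH, hHA⟩ := MemW1.exists_measurable_bound hU h
  have hA : 0 ≤ ∑ i, l2norm U (weakDeriv U i g) := Finset.sum_nonneg fun _ _ => l2norm_nonneg _
  have hui := MemH1.integrableOn hU' hu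
  have key := fun i : Fin n => exists_weakDeriv_of_le hui.locallyIntegrableOn hA hU' fun φ hφ =>
    abs_integral_comp_mul_fderiv_le hU hU' hg h hHm hH hA hHA hΦ hui
      (e := EuclideanSpace.single i 1) (by simp) hφ
  choose v hv hvd using key
  refine ⟨⟨hu, fun i => ⟨v i, hvd i, Lp.memLp _⟩⟩, fun i => ?_⟩
  rw [l2norm_congr ((hvd i).weakDeriv_ae_eq hU), l2norm_coe]
  exact hv i

end Truncation

/-! ### The Poincaré inequality on star-shaped sets. -/

section Poincare

variable {n : ℕ}

theorem lintegral_comp_add_smul (Q : Space n → ℝ≥0∞) (hQ : Measurable Q) (a : Space n) {t : ℝ}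
    (ht : 0 < t) : ∫⁻ x, Q (a + t • x) = ENNReal.ofReal (t⁻¹ ^ n) * ∫⁻ x, Q x := by
  have h1 := lintegral_map (μ := volume) (f := fun x => Q (a + x)) (g := fun x : Space n => t • x)
    (hQ.comp (measurable_const_add a)) (measurable_const_smul t)
  rw [Measure.map_addHaar_smul _ ht.ne', lintegral_smul_measure,
    lintegral_add_left_eq_self Q a] at h1
  rw [← h1, finrank_euclideanSpace_fin, abs_of_pos (by positivity), inv_pow, smul_eq_mul]

theorem lintegral_comp_add_smul_le (Q : Space n → ℝ≥0∞) (hQ : Measurable Q) (a : Space n)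
    {s t : ℝ} (hs : 0 < s) (hst : s ≤ t) :
    ∫⁻ x, Q (a + t • x) ≤ ENNReal.ofReal (s⁻¹ ^ n) * ∫⁻ x, Q x := by
  have := inv_nonneg.2 (hs.trans_le hst).le
  rw [lintegral_comp_add_smul Q hQ a (hs.trans_le hst)]
  gcongr

/-- With `m` the mean, the two integrals differ by `|K| (m - c)²`. -/
theorem lintegral_sub_average_sq_le_sub_const {K : Set (Space n)} (hK : volume K ≠ ⊤)
    {w : Space n → ℝ} (hw : MemLp w 2 (volume.restrict K)) (c : ℝ) :
    ∫⁻ x in K, ‖w x - ⨍ z in K, w z‖ₑ ^ 2 ≤ ∫⁻ x in K, ‖w x - c‖ₑ ^ 2 := by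
  have hfin : IsFiniteMeasure (volume.restrict K) := ⟨by simpa using hK.lt_top⟩
  set m := ⨍ z in K, w z with hm
  have hi : ∀ c : ℝ, Integrable (fun x => (w x - c) ^ 2) (volume.restrict K) := fun c =>
    (hw.sub (memLp_const c)).integrable_sq
  have he : ∀ c : ℝ, ∫⁻ x in K, ‖w x - c‖ₑ ^ 2 = ENNReal.ofReal (∫ x in K, (w x - c) ^ 2) := by
    intro c
    rw [ofReal_integral_eq_lintegral_ofReal (hi c) (Eventually.of_forall fun x => sq_nonneg _)]
    refine lintegral_congr fun x => ?_
    rw [← sq_abs, ENNReal.ofReal_pow (abs_nonneg _), ← Real.enorm_eq_ofReal_abs]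
  rw [he, he]
  refine ENNReal.ofReal_le_ofReal (sub_nonneg.1 ?_)
  have hwi := hw.integrable one_le_two
  have hmean : ∫ x in K, w x = (volume.restrict K).real Set.univ * m := by
    rw [hm, ← smul_eq_mul, measure_smul_average]
  rw [← integral_sub (hi c) (hi m)]
  have h1 : ∀ x, (w x - c) ^ 2 - (w x - m) ^ 2 = 2 * (m - c) * w x - (m - c) * (m + c) := by
    intro x; ring
  simp only [h1]
  rw [integral_sub (hwi.const_mul _) (integrable_const _), integral_const_mul, hmean,
    integral_const, smul_eq_mul]
  have h2 : 0 ≤ (volume.restrict K).real Set.univ := measureReal_nonneg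
  nlinarith [mul_nonneg h2 (sq_nonneg (m - c))]

/-- The constant of the Poincaré inequality on a domain that is star-shaped with respect to the
centre of a ball, `s` being the scaling that shrinks the domain into the ball. -/
def poincareConst (n : ℕ) (s : ℝ) : ℝ≥0∞ :=
  2 * ENNReal.ofReal (s⁻¹ ^ n) +
    8 * (ENNReal.ofReal ((s / 2)⁻¹ ^ n) * (1 + ENNReal.ofReal (s⁻¹ ^ n)))

theorem poincareConst_ne_top (n : ℕ) (s : ℝ) : poincareConst n s ≠ ⊤ := by
  simp [poincareConst, ENNReal.mul_eq_top]

theorem sq_enorm_sub_le (a b c : ℝ) :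
    ‖a - b‖ₑ ^ 2 ≤ 2 * ‖c - a‖ₑ ^ 2 + 2 * ‖b - c‖ₑ ^ 2 := by
  have h : ∀ x : ℝ, ‖x‖ₑ ^ 2 = ENNReal.ofReal (x ^ 2) := fun x => by
    rw [← sq_abs, ENNReal.ofReal_pow (abs_nonneg _), ← Real.enorm_eq_ofReal_abs]
  have h2 : (2 : ℝ≥0∞) = ENNReal.ofReal 2 := by simp
  rw [h, h, h, h2, ← ENNReal.ofReal_mul zero_le_two, ← ENNReal.ofReal_mul zero_le_two,
    ← ENNReal.ofReal_add (by positivity) (by positivity)]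
  -- The difference of the two sides is exactly `(a + b - 2c)²`.
  exact ENNReal.ofReal_le_ofReal (by nlinarith [sq_nonneg (a + b - 2 * c)])

/-- Poincaré inequality on a domain that is star-shaped with respect to the centre of a ball. -/
theorem lintegral_sub_average_sq_le {K : Set (Space n)} (hK : IsOpen K) (hK' : volume K ≠ ⊤)
    {c : Space n} (hstar : StarConvex ℝ c K) {r s d : ℝ} (hr : 0 < r)
    (hrK : Metric.ball c r ⊆ K) (hs : 0 < s) (hs1 : s ≤ 1)
    (hsK : ∀ x ∈ K, c + s • (x - c) ∈ Metric.ball c r) (hd : ∀ x ∈ K, ‖x - c‖ ≤ d) (hrd : r ≤ d)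
    {w : Space n → ℝ} (hwm : Measurable w) (hw : MemLp w 2 (volume.restrict K))
    {v : Fin n → Space n → ℝ} (hv : ∀ i, IntegrableOn (v i) K)
    (h : ∀ i, HasWeakDeriv K i w (v i)) {H : Space n → ℝ≥0∞} (hHm : Measurable H)
    (hH : ∀ᵐ x ∂(volume.restrict K), ∑ i, ‖v i x‖ₑ ≤ H x) :
    ∫⁻ x in K, ‖w x - ⨍ z in K, w z‖ₑ ^ 2 ≤
      poincareConst n s * (ENNReal.ofReal d ^ 2 * ∫⁻ x, H x ^ 2) := by
  have hwi := MemH1.integrableOn hK' hw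
  set B := Metric.ball c r with hB
  set I := ∫⁻ x, H x ^ 2 with hI
  set a := ENNReal.ofReal (s⁻¹ ^ n) with ha
  set b := ENNReal.ofReal ((s / 2)⁻¹ ^ n) with hb
  set D := ENNReal.ofReal d with hD
  have hBm : MeasurableSet B := Metric.isOpen_ball.measurableSet
  have hS : Measurable fun x : Space n => c + s • (x - c) := by fun_prop
  have hd0 : 0 < d := hr.trans_le hrd
  -- The contraction `x ↦ c + s • (x - c)` maps `K` into the ball.
  have hKB : volume K ≤ a * volume B := by
    have h1 := lintegral_comp_add_smul_le (B.indicator 1) (measurable_one.indicator hBm)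
      (c - s • c) hs le_rfl
    rw [lintegral_indicator_one hBm] at h1
    refine le_trans ?_ h1
    rw [← lintegral_indicator_one hK.measurableSet]
    refine lintegral_mono fun x => ?_
    by_cases hx : x ∈ K
    · have := hsK x hx
      rw [smul_sub, ← add_sub_assoc, add_sub_right_comm] at this
      simp [hx, this]
    · simp [hx]
  -- First leg: from `x` to its contracted image, along a ray that stays in `K` by star-shapedness.
  have h1 : ∫⁻ x in K, ‖w (c + s • (x - c)) - w x‖ₑ ^ 2 ≤ D ^ 2 * (a * I) := by
    refine lintegral_enorm_sub_sq_le (σ := volume.restrict K) hK hwi hv h hHm hH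
      (X := fun x => x) measurable_id hS ?_ ?_ ?_
    · filter_upwards [ae_restrict_mem hK.measurableSet] with x hx
      rw [segment_symm]
      refine le_trans ?_ (starConvex_iff_segment_subset.1 hstar hx)
      refine (convex_segment c x).segment_subset ?_ (right_mem_segment ℝ c x)
      rw [segment_eq_image']
      exact ⟨s, ⟨hs.le, hs1⟩, rfl⟩
    · filter_upwards [ae_restrict_mem hK.measurableSet] with x hx
      have : c + s • (x - c) - x = -((1 - s) • (x - c)) := by module
      rw [this, enorm_neg, ← ofReal_norm, hD]
      refine ENNReal.ofReal_le_ofReal ?_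
      rw [norm_smul, Real.norm_of_nonneg (by linarith)]
      nlinarith [hd x hx, norm_nonneg (x - c)]
    · intro θ hθ Q hQ
      refine (setLIntegral_le_lintegral K _).trans ?_
      have : ∀ x : Space n, x + θ • (c + s • (x - c) - x) =
          (θ * (1 - s)) • c + (1 - θ * (1 - s)) • x := fun x => by module
      simp only [this]
      exact lintegral_comp_add_smul_le Q hQ _ hs (by nlinarith [hθ.2])
  -- Second leg: from the contracted image of `x` to an arbitrary `y` of the ball, by convexity of
  -- the ball.
  have h2 : ∫⁻ z, ‖w z.2 - w (c + s • (z.1 - c))‖ₑ ^ 2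
      ∂((volume.restrict K).prod (volume.restrict B)) ≤
      (2 * D) ^ 2 * ((b * (1 + a) * volume B) * I) := by
    refine lintegral_enorm_sub_sq_le hK hwi hv h hHm hH (X := fun z : Space n × Space n => c + s • (z.1 - c))
      (Y := fun z => z.2) (hS.comp measurable_fst) measurable_snd ?_ ?_ ?_
    · rw [Measure.prod_restrict]
      filter_upwards [ae_restrict_mem (hK.measurableSet.prod hBm)] with z hz
      exact ((convex_ball c r).segment_subset (hsK _ hz.1) hz.2).trans hrK
    · rw [Measure.prod_restrict]
      filter_upwards [ae_restrict_mem (hK.measurableSet.prod hBm)] with z hz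
      have h3 := hsK _ hz.1
      have h4 : z.2 ∈ Metric.ball c r := hz.2
      rw [mem_ball_iff_norm] at h3 h4
      have h5 : z.2 - (c + s • (z.1 - c)) = (z.2 - c) - (c + s • (z.1 - c) - c) := by abel
      have h6 : 2 * D = ENNReal.ofReal (2 * d) := by
        rw [ENNReal.ofReal_mul zero_le_two, ENNReal.ofReal_ofNat]
      rw [← ofReal_norm, h6]
      refine ENNReal.ofReal_le_ofReal ?_
      rw [h5]
      exact (norm_sub_le _ _).trans (by linarith)
    · intro θ hθ Q hQ
      have hQm : Measurable fun z : Space n × Space n =>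
          Q (c + s • (z.1 - c) + θ • (z.2 - (c + s • (z.1 - c)))) := by fun_prop
      -- A point of the segment depends on `x` with factor `(1 - θ) s` and on `y` with factor `θ`.
      -- Integrating first in the variable whose factor is at least `s / 2` keeps the Jacobian
      -- bounded.
      rcases le_total θ (1 / 2) with h' | h'
      · rw [lintegral_prod_symm _ hQm.aemeasurable]
        calc _ ≤ ∫⁻ _ in B, b * ∫⁻ x, Q x := by
              refine lintegral_mono fun y => (setLIntegral_le_lintegral K _).trans ?_
              have : ∀ x : Space n, c + s • (x - c) + θ • (y - (c + s • (x - c))) =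
                  (((1 - θ) * (1 - s)) • c + θ • y) + ((1 - θ) * s) • x := fun x => by module
              simp only [this]
              exact lintegral_comp_add_smul_le Q hQ _ (by linarith) (by nlinarith)
          _ = b * 1 * volume B * ∫⁻ x, Q x := by
              simp only [lintegral_const, Measure.restrict_apply_univ]; ring
          _ ≤ _ := by gcongr; exact le_self_add
      · rw [lintegral_prod _ hQm.aemeasurable]
        calc _ ≤ ∫⁻ _ in K, b * ∫⁻ x, Q x := by
              refine lintegral_mono fun x => (setLIntegral_le_lintegral B _).trans ?_
              have : ∀ y : Space n, c + s • (x - c) + θ • (y - (c + s • (x - c))) =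
                  ((1 - θ) • (c + s • (x - c))) + θ • y := fun y => by module
              simp only [this]
              exact lintegral_comp_add_smul_le Q hQ _ (by linarith) (by linarith)
          _ = b * volume K * ∫⁻ x, Q x := by
              simp only [lintegral_const, Measure.restrict_apply_univ]; ring
          _ ≤ b * (a * volume B) * ∫⁻ x, Q x := by gcongr
          _ = b * a * volume B * ∫⁻ x, Q x := by ring
          _ ≤ _ := by gcongr; exact le_add_self
  have hwS : Measurable fun z : Space n × Space n =>
      ‖w (c + s • (z.1 - c)) - w z.1‖ₑ ^ 2 :=
    (((hwm.comp (hS.comp measurable_fst)).sub (hwm.comp measurable_fst)).enorm).pow_const 2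
  have hB0 : volume B ≠ 0 := (Metric.measure_ball_pos volume c hr).ne'
  have hBt : volume B ≠ ⊤ := measure_ball_lt_top.ne
  have h3 : volume B * ∫⁻ x in K, ‖w x - ⨍ z in K, w z‖ₑ ^ 2 ≤
      volume B * (poincareConst n s * (D ^ 2 * I)) := by
    calc volume B * ∫⁻ x in K, ‖w x - ⨍ z in K, w z‖ₑ ^ 2
        = ∫⁻ _ in B, (∫⁻ x in K, ‖w x - ⨍ z in K, w z‖ₑ ^ 2) := by
          simp only [lintegral_const, Measure.restrict_apply_univ]; ring
      _ ≤ ∫⁻ y in B, ∫⁻ x in K, ‖w x - w y‖ₑ ^ 2 :=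
          lintegral_mono fun y => lintegral_sub_average_sq_le_sub_const hK' hw _
      _ = ∫⁻ z, ‖w z.1 - w z.2‖ₑ ^ 2 ∂((volume.restrict K).prod (volume.restrict B)) := by
          rw [lintegral_prod_symm]
          exact ((((hwm.comp measurable_fst).sub
            (hwm.comp measurable_snd)).enorm).pow_const 2).aemeasurable
      _ ≤ ∫⁻ z, 2 * ‖w (c + s • (z.1 - c)) - w z.1‖ₑ ^ 2 +
            2 * ‖w z.2 - w (c + s • (z.1 - c))‖ₑ ^ 2
            ∂((volume.restrict K).prod (volume.restrict B)) :=
          lintegral_mono fun z => sq_enorm_sub_le _ _ _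
      _ ≤ 2 * (volume B * (D ^ 2 * (a * I))) +
            2 * ((2 * D) ^ 2 * ((b * (1 + a) * volume B) * I)) := by
          rw [lintegral_add_left (hwS.const_mul 2), lintegral_const_mul' _ _ (by simp),
            lintegral_const_mul' _ _ (by simp)]
          refine add_le_add (mul_le_mul' le_rfl ?_) (mul_le_mul' le_rfl h2)
          rw [lintegral_prod _ hwS.aemeasurable]
          simp only [lintegral_const, Measure.restrict_apply_univ]
          rw [lintegral_mul_const' _ _ hBt, mul_comm]
          gcongr
      _ = volume B * (poincareConst n s * (D ^ 2 * I)) := by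
          rw [poincareConst]; ring
  exact (ENNReal.mul_le_mul_iff_right hB0 hBt).1 h3

end Poincare

/-! ### Meshes, cell decompositions and the Poincaré inequality on cells. -/

section Meshes

variable {n : ℕ} {Ω K : Set (Space n)}

theorem IsPolytopal.isOpen (h : IsPolytopal K) : IsOpen K := by
  obtain ⟨S, rfl⟩ := h
  exact isOpen_interior

theorem isCompact_biUnion_convexHull (S : Finset (Finset (Space n))) :
    IsCompact (⋃ P ∈ S, convexHull ℝ (P : Set (Space n))) :=
  S.isCompact_biUnion fun P _ => P.finite_toSet.isCompact_convexHull ℝ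

theorem IsPolytopal.isBounded (h : IsPolytopal K) : Bornology.IsBounded K := by
  obtain ⟨S, rfl⟩ := h
  exact (isCompact_biUnion_convexHull S).isBounded.subset interior_subset

theorem IsPolytopal.volume_ne_top (h : IsPolytopal K) : volume K ≠ ⊤ :=
  h.isBounded.measure_lt_top.ne

/-- A point of the closure lies in one of the convex hulls, and not in its interior if it is outside
`K`; frontiers of convex sets are null. -/
theorem IsPolytopal.volume_closure_diff (h : IsPolytopal K) : volume (closure K \ K) = 0 := by
  obtain ⟨S, rfl⟩ := h
  have h1 : volume (⋃ P ∈ S, frontier (convexHull ℝ (P : Set (Space n)))) = 0 :=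
    (measure_biUnion_null_iff S.countable_toSet).2 fun P _ =>
      (convex_convexHull ℝ _).addHaar_frontier volume
  refine measure_mono_null ?_ h1
  rintro x ⟨hx, hx'⟩
  have hxC := closure_minimal interior_subset (isCompact_biUnion_convexHull S).isClosed hx
  simp only [Set.mem_iUnion] at hxC ⊢
  obtain ⟨P, hP, hxP⟩ := hxC
  refine ⟨P, hP, subset_closure hxP, fun hi => hx' ?_⟩
  exact interior_mono (Set.subset_biUnion_of_mem (u := fun P : Finset (Space n) =>
    convexHull ℝ (P : Set (Space n))) hP) hi

theorem l2norm_sq_eq {v : Space n → ℝ} (hv : MemLp v 2 (volume.restrict Ω)) :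
    ENNReal.ofReal (l2norm Ω v ^ 2) = ∫⁻ x in Ω, ‖v x‖ₑ ^ 2 := by
  rw [ENNReal.ofReal_pow (l2norm_nonneg _), l2norm, ENNReal.ofReal_toReal hv.eLpNorm_ne_top,
    eLpNorm_eq_lintegral_rpow_enorm_toReal two_ne_zero ENNReal.ofNat_ne_top,
    ENNReal.toReal_ofNat, ← ENNReal.rpow_natCast, ← ENNReal.rpow_mul]
  norm_num

theorem abs_setIntegral_mul_le {v w : Space n → ℝ} (hv : MemLp v 2 (volume.restrict Ω))
    (hw : MemLp w 2 (volume.restrict Ω)) :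
    |∫ x in Ω, v x * w x| ≤ l2norm Ω v * l2norm Ω w := by
  have h1 := abs_real_inner_le_norm (hv.toLp) (hw.toLp)
  rw [Lp.norm_toLp, Lp.norm_toLp, L2.inner_def] at h1
  refine le_trans (le_of_eq ?_) h1
  congr 1
  refine integral_congr_ae ?_
  filter_upwards [hv.coeFn_toLp, hw.coeFn_toLp] with x hx hy
  rw [hx, hy]
  simp [mul_comm]

theorem inner_eq_setIntegral (v w : L2 Ω) : inner ℝ v w = ∫ x in Ω, v x * w x := by
  rw [L2.inner_def]
  exact integral_congr_ae (Eventually.of_forall fun x => by simp [mul_comm])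

namespace Mesh

/-- The function with the value `c K` on each cell `K`. -/
def step (T : Mesh Ω) (c : Set (Space n) → ℝ) : Space n → ℝ :=
  fun x => ∑ K ∈ T.cells, K.indicator (fun _ => c K) x

variable (T : Mesh Ω)

theorem proj_eq_step (v : Space n → ℝ) : T.proj v = T.step fun K => ⨍ z in K, v z := rfl

theorem step_of_mem (c : Set (Space n) → ℝ) (hK : K ∈ T.cells) {x : Space n} (hx : x ∈ K) :
    T.step c x = c K := by
  rw [step, Finset.sum_eq_single_of_mem K hK, Set.indicator_of_mem hx]
  intro L hL hne
  refine Set.indicator_of_notMem (fun hxL => ?_) _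
  exact Set.disjoint_left.1 (T.disjoint K hK L hL hne.symm) hx hxL

theorem isOpen (hK : K ∈ T.cells) : IsOpen K := (T.polytopal K hK).isOpen

theorem volume_pos (hK : K ∈ T.cells) : 0 < volume K :=
  (T.isOpen hK).measure_pos _ (T.nonempty K hK)

theorem volume_ne_top (hK : K ∈ T.cells) : volume K ≠ ⊤ := (T.polytopal K hK).volume_ne_top

theorem memLp_step (c : Set (Space n) → ℝ) : MemLp (T.step c) 2 (volume.restrict Ω) := by
  refine memLp_finsetSum _ fun K hK => ?_
  exact (memLp_indicator_const 2 (T.isOpen hK).measurableSet _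
    (Or.inr (T.volume_ne_top hK))).restrict Ω

/-- A mesh only covers `Ω` by closed cells. Their boundaries are null, which makes the open cells a
partition up to a null set. -/
theorem ae_mem_cells (hΩ : IsOpen Ω) : ∀ᵐ x ∂(volume.restrict Ω), ∃ K ∈ T.cells, x ∈ K := by
  have h1 : volume (⋃ K ∈ T.cells, closure K \ K) = 0 :=
    (measure_biUnion_null_iff T.cells.countable_toSet).2 fun K hK =>
      (T.polytopal K hK).volume_closure_diff
  have h2 : ∀ᵐ x ∂(volume : Measure (Space n)), x ∉ ⋃ K ∈ T.cells, closure K \ K :=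
    measure_eq_zero_iff_ae_notMem.1 h1
  filter_upwards [ae_restrict_of_ae h2, ae_restrict_mem hΩ.measurableSet] with x hx hxΩ
  have hx' : x ∈ ⋃ K ∈ T.cells, closure K := T.cover ▸ subset_closure hxΩ
  simp only [Set.mem_iUnion, not_exists, Set.mem_sdiff, not_and, not_not] at hx hx'
  obtain ⟨K, hK, hxK⟩ := hx'
  exact ⟨K, hK, hx K hK hxK⟩

theorem restrict_eq (hΩ : IsOpen Ω) :
    volume.restrict Ω = volume.restrict (⋃ K ∈ T.cells, K) := by
  refine Measure.restrict_congr_set ?_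
  have h := T.ae_mem_cells hΩ
  rw [ae_restrict_iff' hΩ.measurableSet] at h
  filter_upwards [h] with x hx
  refine propext ⟨fun hxΩ => ?_, fun hxK => ?_⟩
  · obtain ⟨K, hK, hxK⟩ := hx hxΩ
    exact Set.mem_biUnion hK hxK
  · obtain ⟨K, hK, hxK⟩ := Set.mem_iUnion₂.1 hxK
    exact T.subset K hK hxK

theorem pairwiseDisjoint : (T.cells : Set (Set (Space n))).PairwiseDisjoint id :=
  fun K hK L hL hne => T.disjoint K hK L hL hne

theorem setIntegral_eq_sum (hΩ : IsOpen Ω) {f : Space n → ℝ} (hf : IntegrableOn f Ω) :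
    ∫ x in Ω, f x = ∑ K ∈ T.cells, ∫ x in K, f x := by
  rw [T.restrict_eq hΩ]
  exact integral_biUnion_finset T.cells (fun K hK => (T.isOpen hK).measurableSet)
    T.pairwiseDisjoint fun K hK => hf.mono_set (T.subset K hK)

theorem setLIntegral_eq_sum (hΩ : IsOpen Ω) (f : Space n → ℝ≥0∞) :
    ∫⁻ x in Ω, f x = ∑ K ∈ T.cells, ∫⁻ x in K, f x := by
  rw [T.restrict_eq hΩ]
  exact lintegral_biUnion_finset T.pairwiseDisjoint
    (fun K hK => (T.isOpen hK).measurableSet) f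

/-- `proj` is the orthogonal projection onto cellwise constants. -/
theorem setIntegral_mul_eq_proj (hΩ : IsOpen Ω) {v s : Space n → ℝ}
    (hv : MemLp v 2 (volume.restrict Ω)) (hs : MemLp s 2 (volume.restrict Ω))
    (hc : ∀ K ∈ T.cells, ∃ c : ℝ, ∀ᵐ x ∂(volume.restrict K), s x = c) :
    ∫ x in Ω, v x * s x = ∫ x in Ω, T.proj v x * s x := by
  rw [T.setIntegral_eq_sum hΩ (f := fun x => v x * s x) (hv.integrable_mul hs),
    T.setIntegral_eq_sum hΩ (f := fun x => T.proj v x * s x) ((T.memLp_step _).integrable_mul hs)]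
  refine Finset.sum_congr rfl fun K hK => ?_
  obtain ⟨c, hc⟩ := hc K hK
  have hKfin : IsFiniteMeasure (volume.restrict K) := ⟨by simpa using (T.volume_ne_top hK).lt_top⟩
  have e1 : ∫ x in K, v x * s x = ∫ x in K, v x * c :=
    integral_congr_ae (hc.mono fun x hx => by simp only [hx])
  have e2 : ∫ x in K, T.proj v x * s x = ∫ x in K, (⨍ z in K, v z) * c := by
    refine integral_congr_ae ?_
    filter_upwards [hc, ae_restrict_mem (T.isOpen hK).measurableSet] with x hx hxK
    rw [hx, T.proj_eq_step, T.step_of_mem _ hK hxK]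
  rw [e1, e2, integral_mul_const, integral_const, smul_eq_mul, ← mul_assoc]
  congr 1
  rw [← smul_eq_mul, measure_smul_average]

theorem diam_le_size (hK : K ∈ T.cells) : Metric.diam K ≤ T.size :=
  le_ciSup (f := fun K : T.cells => Metric.diam (K : Set (Space n)))
    (Set.finite_range _).bddAbove ⟨K, hK⟩

theorem size_nonneg : 0 ≤ T.size := Real.iSup_nonneg fun _ => Metric.diam_nonneg

theorem centroid_mem (hK : K ∈ T.cells) : centroid K ∈ K :=
  (T.starShaped K hK).mem (T.nonempty K hK)

theorem norm_sub_centroid_le (hK : K ∈ T.cells) {x : Space n} (hx : x ∈ K) :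
    ‖x - centroid K‖ ≤ Metric.diam K := by
  rw [← dist_eq_norm]
  exact Metric.dist_le_diam_of_mem (T.polytopal K hK).isBounded hx (T.centroid_mem hK)

theorem IsRegular.exists_ball {T : Mesh Ω} {η : ℝ} (hn : 0 < n) (hT : T.IsRegular η)
    (hK : K ∈ T.cells) : ∃ r, 0 < r ∧ Metric.ball (centroid K) r ⊆ K ∧ r ≤ Metric.diam K ∧
      Metric.diam K ≤ 4 * max η 1 * r := by
  set S := {r : ℝ | 0 < r ∧ Metric.ball (centroid K) r ⊆ K} with hS
  obtain ⟨r₀, hr₀, hr₀K⟩ := Metric.isOpen_iff.1 (T.isOpen hK) _ (T.centroid_mem hK)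
  have hhalf : ∀ r ∈ S, r / 2 ≤ Metric.diam K := by
    rintro r ⟨hr, hrK⟩
    let x : Space n := centroid K + EuclideanSpace.single ⟨0, hn⟩ (r / 2)
    have hx : ‖x - centroid K‖ = r / 2 := by
      simp only [x, add_sub_cancel_left, PiLp.norm_single]
      exact Real.norm_of_nonneg (by linarith)
    have hxK : x ∈ K := hrK (by rw [mem_ball_iff_norm, hx]; linarith)
    rw [← hx]
    exact T.norm_sub_centroid_le hK hxK
  -- Each admissible ball contains a point at distance `r / 2` from the centroid. Without this bound
  -- the supremum in `inradius` would take its default value `0`.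
  have hbdd : BddAbove S := ⟨2 * Metric.diam K, fun r hr => by linarith [hhalf r hr]⟩
  have hpos : 0 < inradius K := hr₀.trans_le (le_csSup hbdd ⟨hr₀, hr₀K⟩)
  obtain ⟨r, hr, hlt⟩ := exists_lt_of_lt_csSup (s := S) ⟨r₀, hr₀, hr₀K⟩ (half_lt_self hpos)
  -- One factor `2` is lost because the supremum need not be attained by the chosen `r`, another by
  -- halving `r` so that it is at most the diameter; hence the `4`.
  refine ⟨r / 2, half_pos hr.1, ?_, hhalf r hr, ?_⟩
  · exact (Metric.ball_subset_ball (half_le_self hr.1.le)).trans hr.2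
  · have h1 := (div_le_iff₀ hpos).1 (hT K hK)
    have h2 : η * inradius K ≤ max η 1 * (2 * r) := by
      refine mul_le_mul (le_max_left _ _) ?_ hpos.le (zero_le_one.trans (le_max_right _ _))
      have : inradius K / 2 < r := hlt
      linarith
    linarith

/-- Poincaré inequality on a cell of a regular mesh. -/
theorem IsRegular.lintegral_sub_average_sq_le {T : Mesh Ω} {η : ℝ} (hn : 0 < n)
    (hT : T.IsRegular η) (hK : K ∈ T.cells) {g : Space n → ℝ} (hg : Measurable g)
    (hgK : MemLp g 2 (volume.restrict K)) {v : Fin n → Space n → ℝ}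
    (hv : ∀ i, IntegrableOn (v i) K) (h : ∀ i, HasWeakDeriv K i g (v i)) {H : Space n → ℝ≥0∞}
    (hHm : Measurable H) (hH : ∀ᵐ x ∂(volume.restrict K), ∑ i, ‖v i x‖ₑ ≤ H x) :
    ∫⁻ x in K, ‖g x - ⨍ z in K, g z‖ₑ ^ 2 ≤ poincareConst n (1 / (4 * max η 1 + 1)) *
      (ENNReal.ofReal T.size ^ 2 * ∫⁻ x in K, H x ^ 2) := by
  obtain ⟨r, hr, hrK, hrd, hdr⟩ := hT.exists_ball hn hK
  have hη : 1 ≤ max η 1 := le_max_right _ _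
  have hKm := (T.isOpen hK).measurableSet
  have hH2 : ∫⁻ x in K, H x ^ 2 = ∫⁻ x, K.indicator H x ^ 2 := by
    rw [← lintegral_indicator hKm]
    refine lintegral_congr fun x => ?_
    by_cases hx : x ∈ K <;> simp [hx]
  rw [hH2]
  -- The `+ 1` in the scaling turns the bound on the diameter into the strict inequality needed to
  -- land in an open ball.
  refine (OptControl.lintegral_sub_average_sq_le (T.isOpen hK) (T.volume_ne_top hK)
    (T.starShaped K hK) hr hrK (s := 1 / (4 * max η 1 + 1)) (by positivity) ?_ ?_
    (fun x hx => T.norm_sub_centroid_le hK hx) hrd hg hgK hv h (hHm.indicator hKm) ?_).trans ?_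
  · rw [div_le_one (by positivity)]; linarith
  · intro x hx
    rw [mem_ball_iff_norm, add_sub_cancel_left, norm_smul, Real.norm_of_nonneg (by positivity),
      one_div, inv_mul_lt_iff₀ (by positivity)]
    have := T.norm_sub_centroid_le hK hx
    linarith
  · filter_upwards [hH, ae_restrict_mem hKm] with x hx hxK
    rwa [Set.indicator_of_mem hxK]
  · gcongr
    exact T.diam_le_size hK

end Mesh

end Meshes

/-! ### Truncation to an interval with possibly infinite bounds. -/

section Clip

/-- Truncation of a real number to the interval `[a, b]`. -/
def clip (a b : EReal) (t : ℝ) : ℝ := (max a (min (t : EReal) b)).toReal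

variable {a b : EReal}

theorem coe_clip (ha : a ≠ ⊤) (hb : b ≠ ⊥) (t : ℝ) :
    ((clip a b t : ℝ) : EReal) = max a (min (t : EReal) b) := by
  refine EReal.coe_toReal ?_ ?_
  · refine (max_lt ha.lt_top ?_).ne
    exact (min_le_left _ _).trans_lt (EReal.coe_lt_top t)
  · refine (lt_of_lt_of_le ?_ (le_max_right _ _)).ne'
    exact lt_min (EReal.bot_lt_coe t) hb.bot_lt

theorem le_clip (ha : a ≠ ⊤) (hb : b ≠ ⊥) (t : ℝ) : a ≤ (clip a b t : ℝ) := by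
  rw [coe_clip ha hb]; exact le_max_left _ _

theorem clip_le (hab : a ≤ b) (ha : a ≠ ⊤) (hb : b ≠ ⊥) (t : ℝ) : (clip a b t : ℝ) ≤ b := by
  rw [coe_clip ha hb]; exact max_le hab (min_le_right _ _)

/-- The variational characterisation of the projection onto `[a, b]`. It is the main tool for
truncations below and avoids case distinctions on infinite bounds. -/
theorem clip_variational (hab : a ≤ b) (ha : a ≠ ⊤) (hb : b ≠ ⊥) (t : ℝ) {s : ℝ}
    (hs : a ≤ (s : EReal)) (hs' : (s : EReal) ≤ b) : 0 ≤ (clip a b t - t) * (s - clip a b t) := by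
  have hc := coe_clip ha hb t
  rcases le_total (t : EReal) a with h | h
  · rw [max_eq_left ((min_le_left _ _).trans h)] at hc
    rw [← hc] at h hs
    exact mul_nonneg (sub_nonneg.2 (EReal.coe_le_coe_iff.1 h))
      (sub_nonneg.2 (EReal.coe_le_coe_iff.1 hs))
  · rcases le_total (t : EReal) b with h' | h'
    · rw [min_eq_left h', max_eq_right h] at hc
      rw [EReal.coe_injective hc, sub_self, zero_mul]
    · rw [min_eq_right h', max_eq_right hab] at hc
      rw [← hc] at h' hs'
      exact mul_nonneg_of_nonpos_of_nonpos (sub_nonpos.2 (EReal.coe_le_coe_iff.1 h'))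
        (sub_nonpos.2 (EReal.coe_le_coe_iff.1 hs'))

theorem clip_eq_self (ha : a ≠ ⊤) (hb : b ≠ ⊥) {t : ℝ} (h : a < (clip a b t : ℝ))
    (h' : (clip a b t : ℝ) < b) : clip a b t = t := by
  have hc := coe_clip ha hb t
  rcases max_choice a (min (t : EReal) b) with h1 | h1 <;> rw [h1] at hc
  · exact absurd hc h.ne'
  · rcases min_choice (t : EReal) b with h2 | h2 <;> rw [h2] at hc
    · exact EReal.coe_injective hc
    · exact absurd hc h'.ne

/-- Projections onto convex sets are non-expansive: each truncated value is used as competitor for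
the other. -/
theorem lipschitzWith_clip (hab : a ≤ b) (ha : a ≠ ⊤) (hb : b ≠ ⊥) :
    LipschitzWith 1 (clip a b) := by
  refine LipschitzWith.of_dist_le_mul fun s t => ?_
  have h1 := clip_variational hab ha hb s (le_clip ha hb t) (clip_le hab ha hb t)
  have h2 := clip_variational hab ha hb t (le_clip ha hb s) (clip_le hab ha hb s)
  rw [NNReal.coe_one, one_mul, Real.dist_eq, Real.dist_eq]
  set x := clip a b s
  set y := clip a b t
  rcases abs_cases (x - y) with h | h <;> rcases abs_cases (s - t) with h' | h' <;>
    nlinarith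

theorem minmod_nonneg (a b : EReal) : 0 ≤ minmod a b := by
  rw [minmod]
  split_ifs
  · exact le_rfl
  · exact ENNReal.toReal_nonneg

/-- `minmod a b` is the distance from `0` to `[a, b]`, that is `|clip a b 0|`; the Lipschitz bound
does the rest. -/
theorem abs_clip_le (hab : a ≤ b) (ha : a ≠ ⊤) (hb : b ≠ ⊥) (t : ℝ) :
    |clip a b t| ≤ minmod a b + |t| := by
  have h0 : ∀ t, |clip a b t| ≤ |clip a b 0| + |t| := by
    intro t
    have := (lipschitzWith_clip hab ha hb).dist_le_mul t 0
    rw [NNReal.coe_one, one_mul, Real.dist_eq, Real.dist_eq, sub_zero] at this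
    have h1 := abs_sub_abs_le_abs_sub (clip a b t) (clip a b 0)
    linarith
  refine (h0 t).trans (add_le_add ?_ le_rfl)
  have hc := coe_clip ha hb 0
  rw [EReal.coe_zero] at hc
  rcases lt_or_ge 0 a with ha0 | ha0
  · have hb0 : 0 < b := ha0.trans_le hab
    lift a to ℝ using ⟨ha, (EReal.bot_lt_zero.trans ha0).ne'⟩
    rw [min_eq_left hb0.le, max_eq_left ha0.le] at hc
    rw [EReal.coe_injective hc, minmod, if_neg (not_le.2 (EReal.mul_pos ha0 hb0)),
      min_eq_left]
    · rw [EReal.abs_def, ENNReal.toReal_ofReal (abs_nonneg _)]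
    · induction b with
      | bot => simp at hb
      | top => simp
      | coe b =>
        rw [EReal.abs_def, EReal.abs_def]
        have h1 : 0 < a := EReal.coe_pos.1 ha0
        have h2 : 0 < b := EReal.coe_pos.1 hb0
        rw [abs_of_pos h1, abs_of_pos h2]
        exact ENNReal.ofReal_le_ofReal (EReal.coe_le_coe_iff.1 hab)
  · rcases lt_or_ge b 0 with hb0 | hb0
    · have ha0' : a < 0 := hab.trans_lt hb0
      lift b to ℝ using ⟨(hb0.trans EReal.zero_lt_top).ne, hb⟩
      rw [min_eq_right hb0.le, max_eq_right hab] at hc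
      rw [EReal.coe_injective hc, minmod, if_neg (not_le.2 (EReal.mul_pos_iff.2 (Or.inr ⟨ha0', hb0⟩))),
        min_eq_right]
      · rw [EReal.abs_def, ENNReal.toReal_ofReal (abs_nonneg _)]
      · induction a with
        | bot => simp
        | top => simp at ha
        | coe a =>
          rw [EReal.abs_def, EReal.abs_def]
          have h1 : a < 0 := EReal.coe_neg'.1 ha0'
          have h2 : b < 0 := EReal.coe_neg'.1 hb0
          rw [abs_of_neg h1, abs_of_neg h2]
          exact ENNReal.ofReal_le_ofReal (neg_le_neg (EReal.coe_le_coe_iff.1 hab))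
    · rw [min_eq_left hb0, max_eq_right ha0, ← EReal.coe_zero] at hc
      rw [EReal.coe_injective hc, abs_zero]
      exact minmod_nonneg a b

/-! ### Truncation of averages. -/

section Average

variable {X : Type*} [MeasurableSpace X] {μ : Measure X} [IsFiniteMeasure μ] [NeZero μ]
  {g : X → ℝ}

theorem average_mem_of_ae_mul_nonneg (hg : Integrable g μ) {p q r : ℝ}
    (h : ∀ᵐ x ∂μ, 0 ≤ p * g x + q) (hr : r = ⨍ x, g x ∂μ) : 0 ≤ p * r + q := by
  have h1 : 0 ≤ ⨍ x, (p * g x + q) ∂μ := by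
    rw [average_eq]
    exact smul_nonneg (inv_nonneg.2 measureReal_nonneg) (integral_nonneg_of_ae h)
  have h2 : ⨍ x, (p * g x + q) ∂μ = p * (⨍ x, g x ∂μ) + q := by
    rw [average_eq, average_eq, integral_add (hg.const_mul p) (integrable_const q),
      integral_const_mul, integral_const, smul_eq_mul, smul_eq_mul, smul_eq_mul]
    have : μ.real Set.univ ≠ 0 := measureReal_univ_ne_zero
    field_simp
  rwa [h2, ← hr] at h1

/-- The fibre of `clip` over `c` is a closed interval, and a mean stays in a closed interval. In
variational form, the inequality for the mean and the averaged one add up to `-(clip m - c)² ≥ 0`.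
-/
theorem clip_average_eq_of_ae_eq (hab : a ≤ b) (ha : a ≠ ⊤) (hb : b ≠ ⊥) (hg : Integrable g μ)
    {c : ℝ} (h : ∀ᵐ x ∂μ, clip a b (g x) = c) : clip a b (⨍ x, g x ∂μ) = c := by
  set m := ⨍ x, g x ∂μ with hm
  obtain ⟨x, hx⟩ := h.exists
  have h1 := clip_variational hab ha hb m (s := c) (hx ▸ le_clip ha hb _)
    (hx ▸ clip_le hab ha hb _)
  have h2 : ∀ᵐ x ∂μ, 0 ≤ -(clip a b m - c) * g x + c * (clip a b m - c) := by
    filter_upwards [h] with x hx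
    have := clip_variational hab ha hb (g x) (le_clip ha hb m) (clip_le hab ha hb m)
    rw [hx] at this
    linarith
  have h3 := average_mem_of_ae_mul_nonneg hg h2 hm
  nlinarith

theorem clip_average_eq_average (hab : a ≤ b) (ha : a ≠ ⊤) (hb : b ≠ ⊥) (hg : Integrable g μ)
    (h : ∀ᵐ x ∂μ, clip a b (g x) = g x) : clip a b (⨍ x, g x ∂μ) = ⨍ x, g x ∂μ := by
  set m := ⨍ x, g x ∂μ with hm
  have h2 : ∀ᵐ x ∂μ, 0 ≤ (clip a b m - m) * g x + -((clip a b m - m) * clip a b m) := by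
    filter_upwards [h] with x hx
    have := clip_variational hab ha hb m (s := g x) (hx ▸ le_clip ha hb _)
      (hx ▸ clip_le hab ha hb _)
    linarith
  have h3 := average_mem_of_ae_mul_nonneg hg h2 hm
  nlinarith

/-- The preimage under `clip` of an interval is an interval, so it contains the mean as soon as it
contains almost all values of `g`. This needs no regularity of `g`, only of its truncation. -/
theorem abs_clip_average_sub_le (hab : a ≤ b) (ha : a ≠ ⊤) (hb : b ≠ ⊥) (hg : Integrable g μ)
    {L : ℝ} {G : Set X} (hG : ∀ᵐ x ∂μ, x ∈ G)
    (h : ∀ x ∈ G, ∀ y ∈ G, |clip a b (g x) - clip a b (g y)| ≤ L) {y : X} (hy : y ∈ G) :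
    |clip a b (⨍ x, g x ∂μ) - clip a b (g y)| ≤ L := by
  have hL : 0 ≤ L := (abs_nonneg _).trans (h y hy y hy)
  set m := ⨍ x, g x ∂μ with hm
  have hvar := clip_variational hab ha hb m (s := clip a b (g y)) (le_clip ha hb _)
    (clip_le hab ha hb _)
  rw [abs_le]
  constructor
  · by_contra hlt
    push Not at hlt
    -- Here `clip (g x)` exceeds `clip m`, so it is not the lower bound and `g x` is at least `clip
    -- (g x)`. Averaging then puts `m` above `clip m`, against `hvar`.
    have h1 : ∀ᵐ x ∂μ, 0 ≤ 1 * g x + -(clip a b (g y) - L) := by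
      filter_upwards [hG] with x hx
      have h2 := abs_le.1 (h x hx y hy)
      have h3 := clip_variational hab ha hb (g x) (le_clip ha hb m) (clip_le hab ha hb m)
      by_contra hcon
      nlinarith
    have h4 := average_mem_of_ae_mul_nonneg hg h1 hm
    nlinarith
  · by_contra hlt
    push Not at hlt
    have h1 : ∀ᵐ x ∂μ, 0 ≤ (-1) * g x + (clip a b (g y) + L) := by
      filter_upwards [hG] with x hx
      have h2 := abs_le.1 (h x hx y hy)
      have h3 := clip_variational hab ha hb (g x) (le_clip ha hb m) (clip_le hab ha hb m)
      by_contra hcon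
      nlinarith
    have h4 := average_mem_of_ae_mul_nonneg hg h1 hm
    nlinarith

end Average

end Clip

/-! ### Control error on a single cell. -/

section CellEstimates

variable {n : ℕ} {Ω K : Set (Space n)} {a b : EReal}

theorem enorm_weakDeriv_le_W1infNorm {u : Space n → ℝ} :
    ∀ᵐ x ∂(volume.restrict K), ∑ i, ‖weakDeriv K i u x‖ₑ ≤ n * W1infNorm K u := by
  have h : ∀ i, ∀ᵐ x ∂(volume.restrict K), ‖weakDeriv K i u x‖ₑ ≤ W1infNorm K u := by
    intro i
    filter_upwards [enorm_ae_le_eLpNormEssSup (weakDeriv K i u) (volume.restrict K)] with x hx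
    refine hx.trans ?_
    rw [← eLpNorm_exponent_top]
    exact (le_iSup (fun i => eLpNorm (weakDeriv K i u) ⊤ (volume.restrict K)) i).trans
      (le_max_right _ _)
  filter_upwards [ae_all_iff.2 h] with x hx
  refine (Finset.sum_le_sum fun i _ => hx i).trans_eq ?_
  simp

theorem MemW1.W1infNorm_ne_top (hK : IsOpen K) {u : Space n → ℝ} (h : MemW1 K ⊤ u) :
    W1infNorm K u ≠ ⊤ := by
  refine (max_lt h.1.eLpNorm_lt_top ?_).ne
  rcases isEmpty_or_nonempty (Fin n) with hn | hn
  · simp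
  · obtain ⟨i, hi⟩ := exists_eq_ciSup_of_finite
      (f := fun i => eLpNorm (weakDeriv K i u) ⊤ (volume.restrict K))
    rw [← hi]
    exact (h.memLp_weakDeriv hK i).eLpNorm_lt_top

namespace Mesh

variable {T : Mesh Ω}

/-- `brokenNorm` is a `toReal`, hence meaningful only if the supremum is finite; this holds because
there are finitely many cells and `w` is `W^{1,∞}` on each. -/
theorem W1infNorm_le_brokenNorm {w : L2 Ω} (hW : ∀ K ∈ T.cells₁ a b w, MemW1 K ⊤ w)
    (hK : K ∈ T.cells₁ a b w) : W1infNorm K w ≤ ENNReal.ofReal (T.brokenNorm a b w) := by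
  have hfin : (T.cells₁ a b w).Finite := T.cells.finite_toSet.subset fun K hK => hK.1
  have htop : ⨆ K ∈ T.cells₁ a b w, W1infNorm K w < ⊤ := by
    refine lt_of_le_of_lt (iSup₂_le (a := ∑ K ∈ hfin.toFinset, W1infNorm K w) fun K hK => ?_)
      (ENNReal.sum_lt_top.2 fun K hK => ?_)
    · exact Finset.single_le_sum (f := fun K => W1infNorm K w) (fun _ _ => zero_le)
        (hfin.mem_toFinset.2 hK)
    · rw [hfin.mem_toFinset] at hK
      exact (MemW1.W1infNorm_ne_top (T.isOpen hK.1) (hW K hK)).lt_top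
  rw [brokenNorm, ENNReal.ofReal_toReal htop.ne]
  exact le_iSup₂ (f := fun K (_ : K ∈ T.cells₁ a b w) => W1infNorm K w) K hK

/-- Only `w`, not `g`, is Lipschitz on these cells. The mean of `g` is controlled through the
oscillation of its truncation `w`. -/
theorem ae_abs_clip_average_sub_le (hab : a ≤ b) (ha : a ≠ ⊤) (hb : b ≠ ⊥) {w : L2 Ω}
    {g : Space n → ℝ} (hg : MemLp g 2 (volume.restrict Ω))
    (hwg : w =ᵐ[volume.restrict Ω] fun x => clip a b (g x))
    (hW : ∀ K ∈ T.cells₁ a b w, MemW1 K ⊤ w) (hK : K ∈ T.cells₁ a b w) :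
    ∀ᵐ x ∂(volume.restrict K), |clip a b (⨍ z in K, g z) - w x| ≤
      2 * n * T.size * T.brokenNorm a b w := by
  have hKo := T.isOpen hK.1
  have hfin : IsFiniteMeasure (volume.restrict K) :=
    ⟨by simpa using (T.volume_ne_top hK.1).lt_top⟩
  have hne : NeZero (volume.restrict K) :=
    ⟨by simpa [Measure.restrict_eq_zero] using (T.volume_pos hK.1).ne'⟩
  have hi : ∀ {f : Space n → ℝ}, MemLp f ⊤ (volume.restrict K) → IntegrableOn f K :=
    fun h => h.integrable le_top
  have hB : 0 ≤ T.brokenNorm a b w := ENNReal.toReal_nonneg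
  obtain ⟨G, hG, hGl⟩ := exists_forall_enorm_sub_le_of_starConvex hKo (hi (hW K hK).1)
    (fun i => hi ((hW K hK).memLp_weakDeriv hKo i)) (hW K hK).hasWeakDeriv
    enorm_weakDeriv_le_W1infNorm (T.starShaped K hK.1) (d := ENNReal.ofReal T.size)
    fun x hx => by
      rw [← ofReal_norm]
      exact ENNReal.ofReal_le_ofReal ((T.norm_sub_centroid_le hK.1 hx).trans (T.diam_le_size hK.1))
  have hwK := ae_restrict_of_ae_restrict_of_subset (T.subset K hK.1) hwg
  have hG' : ∀ᵐ x ∂(volume.restrict K), x ∈ G ∩ {x | w x = clip a b (g x)} := by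
    filter_upwards [hG, hwK] with x h1 h2 using ⟨h1, h2⟩
  have hbound : 2 * (ENNReal.ofReal T.size * (n * W1infNorm K w)) ≤
      ENNReal.ofReal (2 * n * T.size * T.brokenNorm a b w) := by
    have e : (2 : ℝ) * n * T.size * T.brokenNorm a b w =
        2 * (T.size * (n * T.brokenNorm a b w)) := by ring
    rw [e, ENNReal.ofReal_mul zero_le_two, ENNReal.ofReal_mul T.size_nonneg,
      ENNReal.ofReal_mul n.cast_nonneg, ENNReal.ofReal_ofNat, ENNReal.ofReal_natCast]
    gcongr
    exact W1infNorm_le_brokenNorm hW hK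
  have hosc : ∀ x ∈ G ∩ {x | w x = clip a b (g x)}, ∀ y ∈ G ∩ {x | w x = clip a b (g x)},
      |clip a b (g x) - clip a b (g y)| ≤ 2 * n * T.size * T.brokenNorm a b w := by
    rintro x ⟨hx, hx' : w x = _⟩ y ⟨hy, hy' : w y = _⟩
    have h1 := (hGl x hx y hy).trans hbound
    rw [hx', hy', Real.enorm_eq_ofReal_abs] at h1
    exact (ENNReal.ofReal_le_ofReal_iff (by
      have := T.size_nonneg
      positivity)).1 h1
  filter_upwards [hG'] with x hx
  have hwx : w x = clip a b (g x) := hx.2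
  rw [hwx]
  exact abs_clip_average_sub_le hab ha hb
    ((hg.mono_measure (Measure.restrict_mono_set _ (T.subset K hK.1))).integrable one_le_two)
    hG' hosc hx

/-- On an active cell `w` is constant and the truncated mean has the same value. On an inactive cell
truncation leaves both `g` and its mean unchanged. -/
theorem clip_average_of_mem_cells₂ (hab : a ≤ b) (ha : a ≠ ⊤) (hb : b ≠ ⊥) {w : L2 Ω}
    {g : Space n → ℝ} (hg : MemLp g 2 (volume.restrict Ω))
    (hwg : w =ᵐ[volume.restrict Ω] fun x => clip a b (g x)) (hK : K ∈ T.cells₂ a b w) :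
    (∀ᵐ x ∂(volume.restrict K), clip a b (⨍ z in K, g z) = w x) ∨
    ((∀ᵐ x ∂(volume.restrict K), w x = g x) ∧ clip a b (⨍ z in K, g z) = ⨍ z in K, g z) := by
  obtain ⟨hKT, hK⟩ := hK
  have hfin : IsFiniteMeasure (volume.restrict K) :=
    ⟨by simpa using (T.volume_ne_top hKT).lt_top⟩
  have hne : NeZero (volume.restrict K) :=
    ⟨by simpa [Measure.restrict_eq_zero] using (T.volume_pos hKT).ne'⟩
  have hgi : Integrable g (volume.restrict K) :=
    (hg.mono_measure (Measure.restrict_mono_set _ (T.subset K hKT))).integrable one_le_two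
  have hwK := ae_restrict_of_ae_restrict_of_subset (T.subset K hKT) hwg
  have hconst : ∀ e : EReal, (∀ᵐ x ∂(volume.restrict K), ((w x : ℝ) : EReal) = e) →
      ∀ᵐ x ∂(volume.restrict K), clip a b (⨍ z in K, g z) = w x := by
    intro e he
    have h1 : ∀ᵐ x ∂(volume.restrict K), w x = e.toReal :=
      he.mono fun x hx => by rw [← hx, EReal.toReal_coe]
    have h2 := clip_average_eq_of_ae_eq hab ha hb hgi (c := e.toReal) (by
      filter_upwards [h1, hwK] with x hx hx' using hx' ▸ hx)
    filter_upwards [h1] with x hx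
    rw [h2, hx]
  rcases hK with h | h | h
  · exact Or.inl (hconst a h)
  · exact Or.inl (hconst b h)
  · right
    have h1 : ∀ᵐ x ∂(volume.restrict K), clip a b (g x) = g x := by
      filter_upwards [h, hwK] with x hx hx'
      rw [hx'] at hx
      exact clip_eq_self ha hb hx.1 hx.2
    refine ⟨?_, clip_average_eq_average hab ha hb hgi h1⟩
    filter_upwards [h1, hwK] with x hx hx'
    rw [hx', hx]

theorem IsRegular.cells₂_estimate {η : ℝ} (hn : 0 < n) (hT : T.IsRegular η) (hΩ : IsOpen Ω)
    (hΩ' : volume Ω ≠ ⊤) (hab : a ≤ b) (ha : a ≠ ⊤) (hb : b ≠ ⊥) {w : L2 Ω}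
    {g : Space n → ℝ} (hgm : Measurable g) (hg : MemH1 Ω g)
    (hwg : w =ᵐ[volume.restrict Ω] fun x => clip a b (g x)) {H : Space n → ℝ≥0∞}
    (hHm : Measurable H)
    (hH : ∀ᵐ x ∂(volume.restrict Ω), ∑ i, ‖weakDeriv Ω i g x‖ₑ ≤ H x)
    (hK : K ∈ T.cells₂ a b w) :
    ∫ x in K, (clip a b (⨍ z in K, g z) - w x) = 0 ∧
    ∫⁻ x in K, ‖clip a b (⨍ z in K, g z) - w x‖ₑ ^ 2 ≤
      poincareConst n (1 / (4 * max η 1 + 1)) *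
        (ENNReal.ofReal T.size ^ 2 * ∫⁻ x in K, H x ^ 2) := by
  have hKΩ := T.subset K hK.1
  have hfin : IsFiniteMeasure (volume.restrict K) :=
    ⟨by simpa using (T.volume_ne_top hK.1).lt_top⟩
  have hgK := hg.1.mono_measure (Measure.restrict_mono_set _ hKΩ)
  rcases clip_average_of_mem_cells₂ hab ha hb hg.1 hwg hK with h | ⟨h, hm⟩
  · constructor
    · rw [integral_congr_ae (g := fun _ => (0 : ℝ)) (h.mono fun x hx => by simp [hx]),
        integral_zero]
    · rw [lintegral_congr_ae (g := fun _ => 0) (h.mono fun x hx => by simp [hx]), lintegral_zero]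
      exact zero_le
  · rw [hm]
    constructor
    · rw [integral_congr_ae (g := fun x => (⨍ z in K, g z) - g x)
        (h.mono fun x hx => by simp [hx]),
        integral_sub (integrable_const _) (hgK.integrable one_le_two), integral_const,
        measure_smul_average, sub_self]
    · rw [lintegral_congr_ae (g := fun x => ‖g x - ⨍ z in K, g z‖ₑ ^ 2)
        (h.mono fun x hx => by simp only [hx]; rw [enorm_sub_rev])]
      exact hT.lintegral_sub_average_sq_le hn hK.1 hgm hgK
        (fun i => (MemH1.integrableOn hΩ' (hg.memLp_weakDeriv hΩ i)).mono_set hKΩ)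
        (fun i => (hg.hasWeakDeriv i).mono hKΩ) hHm
        (ae_restrict_of_ae_restrict_of_subset hKΩ hH)

end Mesh

end CellEstimates

/-! ### Summation over the mesh. -/

section MeshEstimate

variable {n : ℕ} {Ω K : Set (Space n)} {a b : EReal}

theorem l2norm_sq_eq_toReal {v : Space n → ℝ} (hv : MemLp v 2 (volume.restrict Ω)) :
    l2norm Ω v ^ 2 = (∫⁻ x in Ω, ‖v x‖ₑ ^ 2).toReal := by
  rw [← l2norm_sq_eq hv, ENNReal.toReal_ofReal (sq_nonneg _)]

namespace Mesh

variable {T : Mesh Ω}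

theorem biUnion_cells₁_subset_region₁ (w : L2 Ω) :
    ⋃ K ∈ T.cells₁ a b w, K ⊆ T.region₁ a b w :=
  interior_maximal (Set.iUnion₂_mono fun _ _ => subset_closure)
    (isOpen_biUnion fun _ hK => T.isOpen hK.1)

theorem biUnion_cells₁_subset (w : L2 Ω) : ⋃ K ∈ T.cells₁ a b w, K ⊆ Ω :=
  Set.iUnion₂_subset fun K hK => T.subset K hK.1

/-- Where the second order comes from: on `T₂` the zero mean of the control error gains one power of
`h` from Poincaré and leaves only the oscillation of `z`; on `T₁` one power comes from the Lipschitz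
bound and the smallness of the region is used later. -/
theorem IsRegular.abs_setIntegral_step_sub_mul_le {η : ℝ} (hn : 0 < n) (hT : T.IsRegular η)
    (hΩ : IsOpen Ω) (hΩ' : volume Ω ≠ ⊤) (hab : a ≤ b) (ha : a ≠ ⊤) (hb : b ≠ ⊥) {w : L2 Ω}
    {g : Space n → ℝ} (hgm : Measurable g) (hg : MemH1 Ω g)
    (hwg : w =ᵐ[volume.restrict Ω] fun x => clip a b (g x))
    (hW : ∀ K ∈ T.cells₁ a b w, MemW1 K ⊤ w) {z : Space n → ℝ}
    (hz : MemLp z 2 (volume.restrict Ω)) :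
    |∫ x in Ω, (T.step (fun K => clip a b (⨍ y in K, g y)) x - w x) * z x| ≤
      2 * n * T.size * T.brokenNorm a b w * (∫ x in ⋃ K ∈ T.cells₁ a b w, K, |z x|) +
      √(poincareConst n (1 / (4 * max η 1 + 1))).toReal * T.size *
        (∑ i, l2norm Ω (weakDeriv Ω i g)) * l2norm Ω (fun x => z x - T.proj z x) := by
  classical
  set c : Set (Space n) → ℝ := fun K => clip a b (⨍ y in K, g y) with hc
  set P := poincareConst n (1 / (4 * max η 1 + 1)) with hP
  set N := ∑ i, l2norm Ω (weakDeriv Ω i g) with hN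
  set B := T.brokenNorm a b w with hB
  set h := T.size with hh
  have hN0 : 0 ≤ N := Finset.sum_nonneg fun _ _ => l2norm_nonneg _
  have hPt : P ≠ ⊤ := poincareConst_ne_top _ _
  obtain ⟨H, hHm, hH, hHN⟩ := MemW1.exists_measurable_bound hΩ hg
  have hHΩ : ∫⁻ x in Ω, H x ^ 2 ≤ ENNReal.ofReal (N ^ 2) := by
    rw [ENNReal.ofReal_pow hN0]
    exact (setLIntegral_le_lintegral _ _).trans hHN
  have hHK : ∀ K ∈ T.cells, ∫⁻ x in K, H x ^ 2 ≠ ⊤ := fun K hK =>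
    (((lintegral_mono_set (T.subset K hK)).trans hHΩ).trans_lt ENNReal.ofReal_lt_top).ne
  have hwm := Lp.memLp w
  have hdm : MemLp (fun x => T.step c x - w x) 2 (volume.restrict Ω) := (T.memLp_step c).sub hwm
  have hζm : MemLp (fun x => z x - T.proj z x) 2 (volume.restrict Ω) := hz.sub (T.memLp_step _)
  have hres : ∀ {f : Space n → ℝ} {K}, MemLp f 2 (volume.restrict Ω) → K ∈ T.cells →
      MemLp f 2 (volume.restrict K) := fun hf hK =>
    hf.mono_measure (Measure.restrict_mono_set _ (T.subset _ hK))
  have hfinK : ∀ {K}, K ∈ T.cells → IsFiniteMeasure (volume.restrict K) := fun hK =>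
    ⟨by simpa using (T.volume_ne_top hK).lt_top⟩
  let α : Set (Space n) → ℝ := fun K => √(P.toReal * (h ^ 2 * (∫⁻ x in K, H x ^ 2).toReal))
  let β : Set (Space n) → ℝ := fun K => l2norm K fun x => z x - T.proj z x
  have hcell : ∀ K ∈ T.cells, |∫ x in K, (T.step c x - w x) * z x| ≤
      (if K ∈ T.cells₁ a b w then 2 * n * h * B * ∫ x in K, |z x| else 0) + α K * β K := by
    intro K hK
    have := hfinK hK
    have hstep : ∀ᵐ x ∂(volume.restrict K), T.step c x = c K := by
      filter_upwards [ae_restrict_mem (T.isOpen hK).measurableSet] with x hx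
      exact T.step_of_mem c hK hx
    split_ifs with h1
    · refine le_add_of_le_of_nonneg ?_ (mul_nonneg (Real.sqrt_nonneg _) (l2norm_nonneg _))
      rw [← integral_const_mul]
      refine abs_integral_le_integral_abs.trans (integral_mono_ae ?_ ?_ ?_)
      · exact ((hres hdm hK).integrable_mul (hres hz hK)).abs
      · exact ((hres hz hK).integrable one_le_two).abs.const_mul _
      · filter_upwards [hstep, ae_abs_clip_average_sub_le hab ha hb hg.1 hwg hW h1] with x hx hx'
        rw [abs_mul, hx]
        exact mul_le_mul_of_nonneg_right hx' (abs_nonneg _)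
    · rw [zero_add]
      have h2 : K ∈ T.cells₂ a b w := by
        by_contra hcon
        exact h1 ⟨hK, hcon⟩
      obtain ⟨hzero, hsq⟩ := hT.cells₂_estimate hn hΩ hΩ' hab ha hb hgm hg hwg hHm hH h2
      have hdc : MemLp (fun x => c K - w x) 2 (volume.restrict K) :=
        (memLp_const _).sub (hres hwm hK)
      -- The control error has zero mean on `K`, so the cell mean of `z` can be subtracted for free.
      have e1 : ∫ x in K, (T.step c x - w x) * z x =
          ∫ x in K, (c K - w x) * (z x - T.proj z x) := by
        have e2 : ∫ x in K, (c K - w x) * (z x - T.proj z x) =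
            ∫ x in K, ((c K - w x) * z x - (c K - w x) * ⨍ y in K, z y) := by
          refine integral_congr_ae ?_
          filter_upwards [ae_restrict_mem (T.isOpen hK).measurableSet] with x hx
          rw [T.proj_eq_step, T.step_of_mem _ hK hx, mul_sub]
        rw [e2, integral_sub (f := fun x => (c K - w x) * z x) (hdc.integrable_mul (hres hz hK))
          ((hdc.integrable one_le_two).mul_const _), integral_mul_const, hzero, zero_mul, sub_zero]
        exact integral_congr_ae (hstep.mono fun x hx => by simp only [hx])
      rw [e1]
      refine (abs_setIntegral_mul_le hdc (hres hζm hK)).trans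
        (mul_le_mul_of_nonneg_right ?_ (l2norm_nonneg _))
      refine Real.le_sqrt_of_sq_le ?_
      rw [l2norm_sq_eq_toReal hdc]
      have h3 := ENNReal.toReal_mono (ENNReal.mul_ne_top hPt (ENNReal.mul_ne_top
        (ENNReal.pow_ne_top ENNReal.ofReal_ne_top) (hHK K hK))) hsq
      rwa [ENNReal.toReal_mul, ENNReal.toReal_mul, ENNReal.toReal_pow,
        ENNReal.toReal_ofReal T.size_nonneg] at h3
  rw [T.setIntegral_eq_sum hΩ (f := fun x => (T.step c x - w x) * z x) (hdm.integrable_mul hz)]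
  refine (Finset.abs_sum_le_sum_abs _ _).trans ((Finset.sum_le_sum hcell).trans ?_)
  rw [Finset.sum_add_distrib]
  refine add_le_add (le_of_eq ?_) ?_
  · rw [← Finset.sum_filter, ← Finset.mul_sum]
    congr 1
    have hU : ⋃ K ∈ T.cells₁ a b w, K = ⋃ K ∈ T.cells.filter (· ∈ T.cells₁ a b w), K := by
      ext x
      simp only [Set.mem_iUnion, Finset.mem_filter, exists_prop]
      exact ⟨fun ⟨K, hK, hx⟩ => ⟨K, ⟨hK.1, hK⟩, hx⟩, fun ⟨K, hK, hx⟩ => ⟨K, hK.2, hx⟩⟩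
    rw [hU]
    refine (integral_biUnion_finset _ (fun K hK => ?_) (fun K hK L hL hne => ?_)
      fun K hK => ?_).symm
    · exact (T.isOpen (Finset.mem_filter.1 hK).1).measurableSet
    · exact T.disjoint K (Finset.mem_filter.1 hK).1 L (Finset.mem_filter.1 hL).1 hne
    · have hK' := (Finset.mem_filter.1 hK).1
      have := hfinK hK'
      exact ((hres hz hK').integrable one_le_two).abs
  -- Cauchy–Schwarz over the cells: the local energies and the local oscillations each add up to
  -- their global value.
  · refine (Real.sum_mul_le_sqrt_mul_sqrt _ _ _).trans (mul_le_mul ?_ ?_ (Real.sqrt_nonneg _) ?_)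
    · have h4 : ∑ K ∈ T.cells, α K ^ 2 ≤ P.toReal * (h * N) ^ 2 := by
        have h5 : ∀ K ∈ T.cells, α K ^ 2 = P.toReal * h ^ 2 * (∫⁻ x in K, H x ^ 2).toReal := by
          intro K _
          rw [Real.sq_sqrt (by positivity)]
          ring
        rw [Finset.sum_congr rfl h5, ← Finset.mul_sum, ← ENNReal.toReal_sum hHK,
          ← T.setLIntegral_eq_sum hΩ, mul_pow, ← mul_assoc]
        refine mul_le_mul_of_nonneg_left ?_ (by positivity)
        have := ENNReal.toReal_mono ENNReal.ofReal_ne_top hHΩ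
        rwa [ENNReal.toReal_ofReal (sq_nonneg _)] at this
      refine (Real.sqrt_le_sqrt h4).trans_eq ?_
      rw [Real.sqrt_mul ENNReal.toReal_nonneg, Real.sqrt_sq (mul_nonneg T.size_nonneg hN0),
        mul_assoc]
    · refine Real.sqrt_le_iff.2 ⟨l2norm_nonneg _, le_of_eq ?_⟩
      rw [l2norm_sq_eq_toReal hζm, T.setLIntegral_eq_sum hΩ, ENNReal.toReal_sum]
      · exact Finset.sum_congr rfl fun K hK => l2norm_sq_eq_toReal (hres hζm hK)
      · intro K hK
        rw [← l2norm_sq_eq (hres hζm hK)]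
        exact ENNReal.ofReal_ne_top
    · have := T.size_nonneg
      positivity

/-- Hölder against the constant `1` on a region of measure at most `κ h`. The case `p = ⊤` is
included: `p.toReal = 0` and `1 / 0 = 0` give the exponent `1`. -/
theorem setIntegral_cells₁_abs_le {w : L2 Ω} {κ c : ℝ} (hc : 0 ≤ c) (hκ : 0 ≤ κ)
    (hvol : volume (T.region₁ a b w) ≤ ENNReal.ofReal (κ * T.size)) {z : Space n → ℝ}
    (hz : AEStronglyMeasurable z (volume.restrict Ω)) {p : ℝ≥0∞} (hp : 1 ≤ p)
    (h : eLpNorm z p (volume.restrict Ω) ≤ ENNReal.ofReal c) :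
    ∫ x in ⋃ K ∈ T.cells₁ a b w, K, |z x| ≤ c * (κ * T.size) ^ (1 - 1 / p.toReal) := by
  set R := ⋃ K ∈ T.cells₁ a b w, K with hR
  have hRΩ : volume.restrict R ≤ volume.restrict Ω :=
    Measure.restrict_mono_set _ (biUnion_cells₁_subset w)
  have hz' := hz.mono_measure hRΩ
  have hκh : 0 ≤ κ * T.size := mul_nonneg hκ T.size_nonneg
  have hexp : 0 ≤ 1 - 1 / p.toReal := by
    rw [sub_nonneg]
    rcases eq_or_ne p ⊤ with rfl | hpt
    · simp
    · have : 1 ≤ p.toReal := by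
        simpa using ENNReal.toReal_mono hpt hp
      exact (div_le_one (by linarith)).2 this
  have h1 := eLpNorm_le_eLpNorm_mul_rpow_measure_univ hp hz'
  have h2 : eLpNorm z 1 (volume.restrict R) ≤
      ENNReal.ofReal (c * (κ * T.size) ^ (1 - 1 / p.toReal)) := by
    refine h1.trans ?_
    rw [ENNReal.ofReal_mul hc, ← ENNReal.ofReal_rpow_of_nonneg hκh hexp, ENNReal.toReal_one,
      div_one, Measure.restrict_apply_univ]
    refine mul_le_mul' ((eLpNorm_mono_measure z hRΩ).trans h) (ENNReal.rpow_le_rpow ?_ hexp)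
    exact (measure_mono (biUnion_cells₁_subset_region₁ w)).trans hvol
  have h3 : ∫ x in R, |z x| = (eLpNorm z 1 (volume.restrict R)).toReal := by
    rw [eLpNorm_one_eq_lintegral_enorm]
    exact integral_norm_eq_lintegral_enorm hz'
  rw [h3]
  refine (ENNReal.toReal_mono ENNReal.ofReal_ne_top h2).trans_eq (ENNReal.toReal_ofReal ?_)
  positivity

end Mesh

end MeshEstimate

/-! ### Well-posedness and stability of the gradient scheme. -/

section Scheme

variable {n : ℕ} {Ω : Set (Space n)} {A : Space n → Matrix (Fin n) (Fin n) ℝ}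

theorem IsDiffusion.integrable_flux (hA : IsDiffusion Ω A) {G H : Fin n → Space n → ℝ}
    (hG : ∀ i, MemLp (G i) 2 (volume.restrict Ω)) (hH : ∀ i, MemLp (H i) 2 (volume.restrict Ω)) :
    Integrable (fun x => (A x *ᵥ fun j => G j x) ⬝ᵥ fun i => H i x) (volume.restrict Ω) := by
  obtain ⟨Λ, hΛ⟩ := hA.2.1
  simp only [dotProduct, Matrix.mulVec, Finset.sum_mul]
  refine integrable_finsetSum _ fun i _ => integrable_finsetSum _ fun j _ => ?_
  have h1 : Integrable (fun x => A x i j * (G j x * H i x)) (volume.restrict Ω) :=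
    ((hG j).integrable_mul (hH i)).bdd_mul (hA.1 i j).aestronglyMeasurable
      (hΛ.mono fun x hx => hx i j)
  exact h1.congr (Eventually.of_forall fun x => (mul_assoc _ _ _).symm)

theorem IsDiffusion.fluxForm_comm (hA : IsDiffusion Ω A) (G H : Fin n → Space n → ℝ) :
    fluxForm Ω A G H = fluxForm Ω A H G := by
  refine integral_congr_ae ?_
  filter_upwards [hA.2.2.1] with x hx
  rw [dotProduct_comm, Matrix.dotProduct_mulVec, ← Matrix.mulVec_transpose, hx.eq]

theorem IsDiffusion.le_fluxForm {a₀ : ℝ} (hA : IsDiffusion Ω A)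
    (ha : ∀ᵐ x ∂(volume.restrict Ω), ∀ ξ : Fin n → ℝ, a₀ * (ξ ⬝ᵥ ξ) ≤ (A x *ᵥ ξ) ⬝ᵥ ξ)
    (G : L2vec Ω) : a₀ * ‖G‖ ^ 2 ≤ fluxForm Ω A (fun j => G j) (fun i => G i) := by
  have h1 : ‖G‖ ^ 2 = ∫ x in Ω, (fun j => G j x) ⬝ᵥ fun j => G j x := by
    simp only [dotProduct]
    rw [PiLp.norm_sq_eq_of_L2, integral_finsetSum]
    · refine Finset.sum_congr rfl fun i _ => ?_
      rw [← real_inner_self_eq_norm_sq, inner_eq_setIntegral]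
    · exact fun i _ => (Lp.memLp (G i)).integrable_mul (Lp.memLp (G i))
  rw [h1, ← integral_const_mul]
  refine integral_mono_ae ?_ (hA.integrable_flux (fun i => Lp.memLp (G i)) fun i => Lp.memLp (G i))
    (ha.mono fun x hx => hx _)
  refine Integrable.const_mul ?_ _
  simp only [dotProduct]
  exact integrable_finsetSum _ fun i _ => (Lp.memLp (G i)).integrable_mul (Lp.memLp (G i))

namespace GradDisc

variable (D : GradDisc.{u} Ω)

theorem form_comm (hA : IsDiffusion Ω A) (z w : D.X) : D.form A z w = D.form A w z :=
  hA.fluxForm_comm _ _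

theorem integrable_form (hA : IsDiffusion Ω A) (z w : D.X) :
    Integrable (fun x => (A x *ᵥ fun j => D.grad z j x) ⬝ᵥ fun i => D.grad w i x)
      (volume.restrict Ω) :=
  hA.integrable_flux (fun _ => Lp.memLp _) fun _ => Lp.memLp _

theorem form_add_left (hA : IsDiffusion Ω A) (z z' w : D.X) :
    D.form A (z + z') w = D.form A z w + D.form A z' w := by
  rw [form, form, form, fluxForm, fluxForm, fluxForm,
    ← integral_add (D.integrable_form hA z w) (D.integrable_form hA z' w)]
  refine integral_congr_ae ?_
  have h : ∀ᵐ x ∂(volume.restrict Ω), ∀ j, D.grad (z + z') j x = D.grad z j x + D.grad z' j x := by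
    refine ae_all_iff.2 fun j => ?_
    rw [map_add, PiLp.add_apply]
    exact Lp.coeFn_add _ _
  filter_upwards [h] with x hx
  rw [← add_dotProduct, ← Matrix.mulVec_add]
  congr 2
  exact funext hx

theorem form_smul_left (c : ℝ) (z w : D.X) :
    D.form A (c • z) w = c * D.form A z w := by
  rw [form, form, fluxForm, fluxForm, ← integral_const_mul]
  refine integral_congr_ae ?_
  have h : ∀ᵐ x ∂(volume.restrict Ω), ∀ j, D.grad (c • z) j x = c * D.grad z j x := by
    refine ae_all_iff.2 fun j => ?_
    rw [map_smul, PiLp.smul_apply]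
    exact Lp.coeFn_smul _ _
  filter_upwards [h] with x hx
  rw [← smul_eq_mul, ← smul_dotProduct, ← Matrix.mulVec_smul]
  congr 2
  exact funext hx

theorem form_sub_left (hA : IsDiffusion Ω A) (z z' w : D.X) :
    D.form A (z - z') w = D.form A z w - D.form A z' w := by
  rw [eq_sub_iff_add_eq, ← D.form_add_left hA, sub_add_cancel]

theorem IsSol.sub {D : GradDisc.{u} Ω} (hA : IsDiffusion Ω A) {F F' : L2 Ω} {z z' : D.X}
    (h : D.IsSol A F z) (h' : D.IsSol A F' z') : D.IsSol A (F - F') (z - z') := fun w => by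
  rw [D.form_sub_left hA, h w, h' w, inner_sub_left]

/-- Coercivity makes the operator injective, and in finite dimension injective means surjective. -/
theorem exists_isSol (hA : IsDiffusion Ω A) (F : L2 Ω) : ∃ z, D.IsSol A F z := by
  obtain ⟨a₀, ha₀, hco⟩ := hA.2.2.2
  let B : D.X →ₗ[ℝ] Module.Dual ℝ D.X := LinearMap.mk₂ ℝ (D.form A) (D.form_add_left hA)
    D.form_smul_left
    (fun z w w' => by
      rw [D.form_comm hA, D.form_add_left hA, D.form_comm hA w, D.form_comm hA w'])
    (fun c z w => by rw [D.form_comm hA, D.form_smul_left, D.form_comm hA w, smul_eq_mul])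
  have hinj : Function.Injective B := by
    refine (injective_iff_map_eq_zero B).2 fun z hz => D.eq_zero_of_grad z ?_
    have h1 : D.form A z z = 0 := LinearMap.congr_fun hz z
    have h2 := hA.le_fluxForm hco (D.grad z)
    have h3 : a₀ * ‖D.grad z‖ ^ 2 ≤ 0 := h2.trans_eq h1
    have h4 : ‖D.grad z‖ ^ 2 ≤ 0 := by
      by_contra hcon
      nlinarith
    exact pow_eq_zero_iff two_ne_zero |>.1 (le_antisymm h4 (sq_nonneg _))
  have hsurj : Function.Surjective B :=
    (LinearMap.injective_iff_surjective_of_finrank_eq_finrank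
      (Subspace.dual_finrank_eq (K := ℝ) (V := D.X)).symm).1 hinj
  obtain ⟨z, hz⟩ := hsurj ((innerₛₗ ℝ F) ∘ₗ D.recon)
  exact ⟨z, fun w => LinearMap.congr_fun hz w⟩

/-- Finite dimension bounds the quotients, so the supremum in `coercConst` is not the default value
`0`. The bound `M` may be negative when there is no nonzero `w`, hence `max M 0`. -/
theorem norm_recon_le {M : ℝ} (hM : D.coercConst ≤ M) (w : D.X) :
    ‖D.recon w‖ ≤ max M 0 * ‖D.grad w‖ := by
  rcases eq_or_ne w 0 with rfl | hw
  · simp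
  have hpos : ∀ w : D.X, w ≠ 0 → 0 < ‖D.grad w‖ := fun w hw =>
    (norm_nonneg _).lt_of_ne' fun h => hw (D.eq_zero_of_grad w h)
  have hinj : Function.Injective D.grad := (injective_iff_map_eq_zero D.grad).2 fun z hz =>
    D.eq_zero_of_grad z (by rw [hz, norm_zero])
  let e := LinearEquiv.ofInjective D.grad hinj
  let f : LinearMap.range D.grad →L[ℝ] L2 Ω :=
    LinearMap.toContinuousLinearMap (D.recon ∘ₗ (e.symm : LinearMap.range D.grad →ₗ[ℝ] D.X))
  have hf : ∀ w, ‖D.recon w‖ ≤ ‖f‖ * ‖D.grad w‖ := by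
    intro w
    have h1 := f.le_opNorm (e w)
    have h2 : f (e w) = D.recon w := by simp [f]
    rw [h2] at h1
    exact h1
  have hbdd : BddAbove (Set.range fun w : {w : D.X // w ≠ 0} =>
      ‖D.recon w‖ / ‖D.grad w‖) := by
    refine ⟨‖f‖, ?_⟩
    rintro _ ⟨w, rfl⟩
    exact (div_le_iff₀ (hpos w w.2)).2 (hf w)
  have h1 : ‖D.recon w‖ / ‖D.grad w‖ ≤ M := (le_ciSup hbdd ⟨w, hw⟩).trans hM
  rw [div_le_iff₀ (hpos w hw)] at h1
  exact h1.trans (mul_le_mul_of_nonneg_right (le_max_left _ _) (norm_nonneg _))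

/-- The energy estimate assumes only a bound of the right-hand side by `‖D.recon z‖`. It thus also
covers sources whose smallness is known only when tested against reconstructions, as in (A1)(ii). -/
theorem norm_grad_le {a₀ M : ℝ} (hA : IsDiffusion Ω A) (ha₀ : 0 < a₀)
    (hco : ∀ᵐ x ∂(volume.restrict Ω), ∀ ξ : Fin n → ℝ, a₀ * (ξ ⬝ᵥ ξ) ≤ (A x *ᵥ ξ) ⬝ᵥ ξ)
    (hM : D.coercConst ≤ M) {z : D.X} {C : ℝ} (hC : 0 ≤ C)
    (h : D.form A z z ≤ C * ‖D.recon z‖) : ‖D.grad z‖ ≤ max M 0 / a₀ * C := by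
  have h1 : a₀ * ‖D.grad z‖ ^ 2 ≤ D.form A z z := hA.le_fluxForm hco (D.grad z)
  have h2 := mul_le_mul_of_nonneg_left (D.norm_recon_le hM z) hC
  have h3 : a₀ * ‖D.grad z‖ ^ 2 ≤ (max M 0 * C) * ‖D.grad z‖ := by linarith
  have h4 : a₀ * ‖D.grad z‖ ≤ max M 0 * C := by
    rcases (norm_nonneg (D.grad z)).eq_or_lt' with h0 | h0
    · rw [h0, mul_zero]; exact mul_nonneg (le_max_right _ _) hC
    · refine le_of_mul_le_mul_right ?_ h0
      linarith
  rw [div_mul_eq_mul_div, le_div_iff₀ ha₀]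
  linarith

theorem norm_recon_le_of_form_le {a₀ M : ℝ} (hA : IsDiffusion Ω A) (ha₀ : 0 < a₀)
    (hco : ∀ᵐ x ∂(volume.restrict Ω), ∀ ξ : Fin n → ℝ, a₀ * (ξ ⬝ᵥ ξ) ≤ (A x *ᵥ ξ) ⬝ᵥ ξ)
    (hM : D.coercConst ≤ M) {z : D.X} {C : ℝ} (hC : 0 ≤ C)
    (h : D.form A z z ≤ C * ‖D.recon z‖) : ‖D.recon z‖ ≤ max M 0 ^ 2 / a₀ * C := by
  refine (D.norm_recon_le hM z).trans ((mul_le_mul_of_nonneg_left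
    (D.norm_grad_le hA ha₀ hco hM hC h) (le_max_right _ _)).trans_eq ?_)
  ring

theorem IsSol.form_le {D : GradDisc.{u} Ω} {F : L2 Ω} {z : D.X} (h : D.IsSol A F z) :
    D.form A z z ≤ ‖F‖ * ‖D.recon z‖ := by
  rw [h z]
  exact real_inner_le_norm _ _

end GradDisc

end Scheme

/-! ### The optimal control as a truncation, and the auxiliary discrete control. -/

section Controls

variable {n : ℕ} {Ω : Set (Space n)} {a b : EReal}

theorem bounds_of_mem_Uad (hΩ : IsOpen Ω) (hΩn : Ω.Nonempty) {w : L2 Ω} (hw : w ∈ Uad Ω a b) :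
    a ≤ b ∧ a ≠ ⊤ ∧ b ≠ ⊥ := by
  have hne : NeZero (volume.restrict Ω) :=
    ⟨by simpa [Measure.restrict_eq_zero] using (hΩ.measure_pos volume hΩn).ne'⟩
  have hw' : ∀ᵐ x ∂(volume.restrict Ω), a ≤ ((w x : ℝ) : EReal) ∧ ((w x : ℝ) : EReal) ≤ b := hw
  obtain ⟨x, hx⟩ := hw'.exists
  exact ⟨hx.1.trans hx.2, (hx.1.trans_lt (EReal.coe_lt_top _)).ne,
    ((EReal.bot_lt_coe _).trans_le hx.2).ne'⟩

theorem memLp_clip (hΩ' : volume Ω ≠ ⊤) (hab : a ≤ b) (ha : a ≠ ⊤) (hb : b ≠ ⊥) (g : L2 Ω) :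
    MemLp (fun x => clip a b (g x)) 2 (volume.restrict Ω) ∧
      l2norm Ω (fun x => clip a b (g x)) ≤
        minmod a b * l2norm Ω (fun _ => (1 : ℝ)) + ‖g‖ := by
  have hfin : IsFiniteMeasure (volume.restrict Ω) := ⟨by simpa using hΩ'.lt_top⟩
  have h1 : MemLp (fun _ : Space n => minmod a b * 1) 2 (volume.restrict Ω) := memLp_const _
  have h2 : MemLp (fun x => ‖g x‖) 2 (volume.restrict Ω) := (Lp.memLp g).norm
  have hle : ∀ x, ‖clip a b (g x)‖ ≤ ‖minmod a b * 1 + ‖g x‖‖ := fun x => by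
    rw [Real.norm_of_nonneg (add_nonneg (by simpa using minmod_nonneg a b) (norm_nonneg _)),
      mul_one]
    exact abs_clip_le hab ha hb _
  have h3 : MemLp (fun x => clip a b (g x)) 2 (volume.restrict Ω) :=
    (h1.add h2).mono ((lipschitzWith_clip hab ha hb).continuous.comp_aestronglyMeasurable
      (Lp.aestronglyMeasurable g)) (Eventually.of_forall hle)
  refine ⟨h3, ?_⟩
  have h4 : l2norm Ω (fun x => clip a b (g x)) ≤ l2norm Ω fun x => minmod a b * 1 + ‖g x‖ :=
    ENNReal.toReal_mono (h1.add h2).eLpNorm_ne_top (eLpNorm_mono hle)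
  refine h4.trans ((l2norm_add_le h1 h2).trans (add_le_add (le_of_eq ?_) (le_of_eq ?_)))
  · rw [l2norm_const_mul, abs_of_nonneg (minmod_nonneg a b)]
  · rw [← l2norm_coe, l2norm, eLpNorm_norm, l2norm]

theorem mem_Uad_toLp_clip (hab : a ≤ b) (ha : a ≠ ⊤) (hb : b ≠ ⊥) {g : L2 Ω}
    (h : MemLp (fun x => clip a b (g x)) 2 (volume.restrict Ω)) : h.toLp ∈ Uad Ω a b := by
  change ∀ᵐ x ∂(volume.restrict Ω), _
  filter_upwards [h.coeFn_toLp] with x hx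
  rw [hx]
  exact ⟨le_clip ha hb _, clip_le hab ha hb _⟩

/-- The optimality condition says that the control is the truncation of `ud - α⁻¹ p`. -/
theorem control_ae_eq_clip (hΩ' : volume Ω ≠ ⊤) (hab : a ≤ b) (ha : a ≠ ⊤) (hb : b ≠ ⊥)
    {α : ℝ} (hα : 0 < α) {p ud w : L2 Ω} (hw : w ∈ Uad Ω a b)
    (h : ∀ v ∈ Uad Ω a b, 0 ≤ inner ℝ (p + α • (w - ud)) (v - w)) :
    w =ᵐ[volume.restrict Ω] fun x => clip a b ((ud - α⁻¹ • p : L2 Ω) x) := by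
  set g : L2 Ω := ud - α⁻¹ • p with hg
  have hm := (memLp_clip hΩ' hab ha hb g).1
  set v : L2 Ω := hm.toLp with hv
  have hvg := hm.coeFn_toLp
  have h1 := h v (mem_Uad_toLp_clip hab ha hb hm)
  have e1 : p + α • (w - ud) = α • (w - g) := by
    rw [hg, ← sub_add, smul_add, smul_smul, mul_inv_cancel₀ hα.ne', one_smul, add_comm]
  rw [e1, real_inner_smul_left] at h1
  have h2 : 0 ≤ inner ℝ (w - g) (v - w) := nonneg_of_mul_nonneg_right h1 hα
  have h3 : 0 ≤ inner ℝ (v - g) (w - v) := by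
    rw [inner_eq_setIntegral]
    refine integral_nonneg_of_ae ?_
    have hw' : ∀ᵐ x ∂(volume.restrict Ω), a ≤ ((w x : ℝ) : EReal) ∧ ((w x : ℝ) : EReal) ≤ b := hw
    filter_upwards [hvg, hw', Lp.coeFn_sub v g, Lp.coeFn_sub w v] with x hx hx' h4 h5
    rw [h4, h5, Pi.sub_apply, Pi.sub_apply, hx]
    exact clip_variational hab ha hb (g x) hx'.1 hx'.2
  -- Two solutions of the same projection inequality, each tested with the other, must coincide.
  have h4 : inner ℝ (w - g) (v - w) + inner ℝ (v - g) (w - v) = -‖w - v‖ ^ 2 := by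
    rw [← real_inner_self_eq_norm_sq, ← neg_sub w v, inner_neg_right, ← sub_eq_neg_add,
      ← inner_sub_left, ← inner_neg_left]
    congr 1
    abel
  have h5 : w = v := by
    rw [← sub_eq_zero, ← norm_eq_zero]
    nlinarith [norm_nonneg (w - v)]
  rw [h5]
  exact hvg

namespace Mesh

variable {T : Mesh Ω}

/-- The piecewise constant control whose cell values are the truncated means of `g`. -/
def meanControl (T : Mesh Ω) (a b : EReal) (g : L2 Ω) : L2 Ω :=
  (T.memLp_step fun K => clip a b (⨍ y in K, g y)).toLp

theorem coeFn_meanControl (g : L2 Ω) : T.meanControl a b g =ᵐ[volume.restrict Ω]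
    T.step fun K => clip a b (⨍ y in K, g y) :=
  MemLp.coeFn_toLp _

theorem meanControl_ae_eq (g : L2 Ω) {K : Set (Space n)} (hK : K ∈ T.cells) :
    ∀ᵐ x ∂(volume.restrict K), T.meanControl a b g x = clip a b (⨍ y in K, g y) := by
  filter_upwards [ae_restrict_of_ae_restrict_of_subset (T.subset K hK) (coeFn_meanControl g),
    ae_restrict_mem (T.isOpen hK).measurableSet] with x hx hxK
  rw [hx, T.step_of_mem _ hK hxK]

theorem meanControl_mem (hΩ : IsOpen Ω) (hab : a ≤ b) (ha : a ≠ ⊤) (hb : b ≠ ⊥) (g : L2 Ω) :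
    T.meanControl a b g ∈ Uad Ω a b ∩ T.piecewiseConst := by
  refine ⟨?_, fun K hK => ⟨_, meanControl_ae_eq g hK⟩⟩
  change ∀ᵐ x ∂(volume.restrict Ω), _
  filter_upwards [coeFn_meanControl g, T.ae_mem_cells hΩ] with x hx ⟨K, hK, hxK⟩
  rw [hx, T.step_of_mem _ hK hxK]
  exact ⟨le_clip ha hb _, clip_le hab ha hb _⟩

/-- On a cell the test direction is constant, so `g` may be replaced by its mean, and the scalar
inequality for the truncation applies. The auxiliary control is the projection of `g` onto the
discrete admissible set. -/
theorem inner_meanControl_sub_nonneg (hΩ : IsOpen Ω) (hab : a ≤ b) (ha : a ≠ ⊤) (hb : b ≠ ⊥)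
    (g : L2 Ω) {v : L2 Ω} (hv : v ∈ Uad Ω a b ∩ T.piecewiseConst) :
    0 ≤ inner ℝ (T.meanControl a b g - g) (v - T.meanControl a b g) := by
  set u := T.meanControl a b g with hu
  rw [inner_eq_setIntegral, T.setIntegral_eq_sum hΩ
    (f := fun x => (u - g : L2 Ω) x * (v - u : L2 Ω) x)
    ((Lp.memLp (u - g)).integrable_mul (Lp.memLp (v - u)))]
  refine Finset.sum_nonneg fun K hK => ?_
  have hfin : IsFiniteMeasure (volume.restrict K) :=
    ⟨by simpa using (T.volume_ne_top hK).lt_top⟩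
  have hne : NeZero (volume.restrict K) :=
    ⟨by simpa [Measure.restrict_eq_zero] using (T.volume_pos hK).ne'⟩
  have hKr := fun {p : Space n → Prop} (h : ∀ᵐ x ∂(volume.restrict Ω), p x) =>
    ae_restrict_of_ae_restrict_of_subset (T.subset K hK) h
  have hgi : Integrable g (volume.restrict K) :=
    ((Lp.memLp g).mono_measure (Measure.restrict_mono_set _ (T.subset K hK))).integrable one_le_two
  obtain ⟨d, hd⟩ := hv.2 K hK
  have hvU : ∀ᵐ x ∂(volume.restrict K),
      a ≤ ((v x : ℝ) : EReal) ∧ ((v x : ℝ) : EReal) ≤ b := hKr hv.1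
  obtain ⟨x₀, hx₀, hx₀'⟩ := (hd.and hvU).exists
  rw [hx₀] at hx₀'
  have e : ∫ x in K, (u - g : L2 Ω) x * (v - u : L2 Ω) x =
      ∫ x in K, (clip a b (⨍ y in K, g y) - g x) * (d - clip a b (⨍ y in K, g y)) := by
    refine integral_congr_ae ?_
    filter_upwards [hKr (Lp.coeFn_sub u g), hKr (Lp.coeFn_sub v u), hd,
      meanControl_ae_eq g hK] with x h1 h2 h3 h4
    rw [h1, h2, Pi.sub_apply, Pi.sub_apply, h3, hu, h4]
  have hm := measure_smul_average (volume.restrict K) g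
  rw [smul_eq_mul] at hm
  rw [e, integral_mul_const, integral_sub (integrable_const _) hgi, integral_const, ← hm,
    smul_eq_mul, ← mul_sub, mul_assoc]
  exact mul_nonneg measureReal_nonneg (clip_variational hab ha hb _ hx₀'.1 hx₀'.2)

end Mesh

end Controls

/-! ### Error splitting for the coupled system. -/

section Superconvergence

variable {n : ℕ} {Ω : Set (Space n)} {a b : EReal} {A : Space n → Matrix (Fin n) (Fin n) ℝ}

theorem MemH1.L2_add {f g : L2 Ω} (hf : MemH1 Ω f) (hg : MemH1 Ω g) :
    MemH1 Ω (f + g : L2 Ω) :=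
  (MemW1.add hf hg).congr (Lp.coeFn_add f g).symm

theorem MemH1.L2_smul {f : L2 Ω} (hf : MemH1 Ω f) (c : ℝ) : MemH1 Ω (c • f : L2 Ω) :=
  (MemW1.const_mul hf c).congr (Lp.coeFn_smul c f).symm

theorem H1norm_L2_add_le (hΩ : IsOpen Ω) {f g : L2 Ω} (hf : MemH1 Ω f) (hg : MemH1 Ω g) :
    H1norm Ω (f + g : L2 Ω) ≤ (1 + n) * (H1norm Ω f + H1norm Ω g) := by
  rw [← H1norm_congr hΩ (MemW1.add hf hg) (Lp.coeFn_add f g).symm]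
  exact H1norm_add_le hΩ hf hg

theorem H1norm_L2_smul_le (hΩ : IsOpen Ω) {f : L2 Ω} (hf : MemH1 Ω f) (c : ℝ) :
    H1norm Ω (c • f : L2 Ω) ≤ (1 + n) * (|c| * H1norm Ω f) := by
  rw [← H1norm_congr hΩ (MemW1.const_mul hf c) (Lp.coeFn_smul c f).symm]
  exact H1norm_const_mul_le hΩ hf c

theorem MemH1.L2_sub_smul {f g : L2 Ω} (hf : MemH1 Ω f) (hg : MemH1 Ω g) (c : ℝ) :
    MemH1 Ω (f - c • g : L2 Ω) := by
  rw [sub_eq_add_neg, ← neg_smul]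
  exact hf.L2_add (hg.L2_smul _)

theorem H1norm_L2_sub_smul_le (hΩ : IsOpen Ω) {f g : L2 Ω} (hf : MemH1 Ω f) (hg : MemH1 Ω g)
    {c : ℝ} (hc : 0 ≤ c) :
    H1norm Ω (f - c • g : L2 Ω) ≤ (1 + n) ^ 2 * (H1norm Ω f + c * H1norm Ω g) := by
  rw [sub_eq_add_neg, ← neg_smul]
  have h1 := H1norm_L2_add_le hΩ hf (hg.L2_smul (-c))
  have h2 := H1norm_L2_smul_le hΩ hg (-c)
  rw [abs_neg, abs_of_nonneg hc] at h2
  have h3 : (0 : ℝ) ≤ n := n.cast_nonneg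
  have h4 : 0 ≤ H1norm Ω f := H1norm_nonneg _
  nlinarith [mul_nonneg h3 h4, mul_nonneg h3 (mul_nonneg h3 h4)]

theorem sum_l2norm_weakDeriv_le (g : Space n → ℝ) :
    ∑ i, l2norm Ω (weakDeriv Ω i g) ≤ n * H1norm Ω g := by
  refine (Finset.sum_le_sum fun i _ => l2norm_weakDeriv_le_H1norm g i).trans_eq ?_
  simp

/-- Gives the `H¹` bound on the control that superconvergence needs for the source `f + w`; this is
where `minmod a b` enters the data norm. -/
theorem MemH1.of_ae_eq_clip (hΩ : IsOpen Ω) (hΩ' : volume Ω ≠ ⊤) (hab : a ≤ b) (ha : a ≠ ⊤)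
    (hb : b ≠ ⊥) {g w : L2 Ω} (hg : MemH1 Ω g)
    (hwg : w =ᵐ[volume.restrict Ω] fun x => clip a b (g x)) :
    MemH1 Ω w ∧ H1norm Ω w ≤
      minmod a b * l2norm Ω (fun _ => (1 : ℝ)) + (1 + n ^ 2) * H1norm Ω g := by
  obtain ⟨hm, hml⟩ := memLp_clip hΩ' hab ha hb g
  obtain ⟨h1, h2⟩ := MemH1.lipschitz_comp hΩ hΩ' (Lp.stronglyMeasurable g).measurable hg
    (lipschitzWith_clip hab ha hb) hm
  refine ⟨h1.congr hwg.symm, ?_⟩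
  rw [← H1norm_congr hΩ h1 hwg.symm]
  refine (H1norm_le_sum _).trans ?_
  have h3 := Finset.sum_le_sum fun i (_ : i ∈ Finset.univ) =>
    (h2 i).trans (sum_l2norm_weakDeriv_le g)
  simp only [Finset.sum_const, Finset.card_univ, Fintype.card_fin, nsmul_eq_mul] at h3
  have h4 := l2norm_le_H1norm (U := Ω) g
  rw [l2norm_coe] at h4
  linarith

/-- Error estimate for the state and the adjoint state in terms of the consistency errors of the
schemes at the optimal control and at an auxiliary piecewise constant control `u`. -/
theorem state_adjoint_error_le {D : GradDisc.{u} Ω} {T : Mesh Ω} (hΩ : IsOpen Ω)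
    (hA : IsDiffusion Ω A) {S : ℝ} (hS : 0 ≤ S)
    (hstab : ∀ (z : D.X) (C : ℝ), 0 ≤ C → D.form A z z ≤ C * ‖D.recon z‖ → ‖D.recon z‖ ≤ S * C)
    {α : ℝ} (hα : 0 < α) {f yd ud y p wh u τy τp : L2 Ω} {yD pD yS yH pS : D.X}
    (hD : IsDiscreteKKT D T A a b α f yd ud yD pD wh) (hu : u ∈ Uad Ω a b ∩ T.piecewiseConst)
    (huv : 0 ≤ inner ℝ (p + α • (u - ud)) (wh - u))
    (hyH : D.IsSol A (f + u) yH) (hpS : D.IsSol A (y - yd) pS)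
    {E₁ E₂ E₃ E₄ E₅ : ℝ} (h₁ : ‖D.recon (yH - yS)‖ ≤ E₁) (h₂ : ‖D.recon yS - τy‖ ≤ E₂)
    (h₃ : ‖D.recon pS - τp‖ ≤ E₃)
    (h₄ : ∀ v : D.X, |inner ℝ (y - τy) (D.recon v)| ≤ E₄ * ‖D.recon v‖) (hE₄ : 0 ≤ E₄)
    (h₅ : l2norm Ω (T.proj (p - τp : L2 Ω)) ≤ E₅) :
    ‖τy - D.recon yD‖ ≤ E₂ + E₁ + S * (α⁻¹ * (S * (E₁ + E₂ + E₄) + E₃ + E₅)) ∧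
    ‖τp - D.recon pD‖ ≤ S * (E₁ + E₂ + E₄) + E₃ +
      S * (S * (α⁻¹ * (S * (E₁ + E₂ + E₄) + E₃ + E₅))) := by
  have hE₁ : 0 ≤ E₁ := (norm_nonneg _).trans h₁
  have hE₂ : 0 ≤ E₂ := (norm_nonneg _).trans h₂
  obtain ⟨pH, hpH⟩ := D.exists_isSol hA (D.recon yH - yd)
  have hyD : D.IsSol A (f + wh) yD := hD.state
  have hpD : D.IsSol A (D.recon yD - yd) pD := fun v => by rw [D.form_comm hA, hD.adjoint]
  -- The source splits into `Π yH - τ y`, small in norm, and `y - τ y`, small only when tested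
  -- against reconstructions.
  have hq : ‖D.recon (pH - pS)‖ ≤ S * (E₁ + E₂ + E₄) := by
    refine hstab _ _ (by positivity) ?_
    rw [(hpH.sub hA hpS) (pH - pS)]
    have e : D.recon yH - yd - (y - yd) = (D.recon yH - τy) - (y - τy) := by abel
    rw [e, inner_sub_left]
    have h6 : ‖D.recon yH - τy‖ ≤ E₁ + E₂ := by
      have e2 : D.recon yH - τy = D.recon (yH - yS) + (D.recon yS - τy) := by
        rw [map_sub]; abel
      rw [e2]
      exact (norm_add_le _ _).trans (add_le_add h₁ h₂)
    have h7 := (real_inner_le_norm (D.recon yH - τy) (D.recon (pH - pS))).trans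
      (mul_le_mul_of_nonneg_right h6 (norm_nonneg _))
    have h8 := (abs_le.1 (h₄ (pH - pS))).1
    linarith
  have hp5 : ‖D.recon pH - τp‖ ≤ S * (E₁ + E₂ + E₄) + E₃ := by
    have e2 : D.recon pH - τp = D.recon (pH - pS) + (D.recon pS - τp) := by
      rw [map_sub]; abel
    rw [e2]
    exact (norm_add_le _ _).trans (add_le_add hq h₃)
  -- Sum of the discrete inequality tested with `u` and of the inequality `huv` tested with `wh`.
  have hvar : α * ‖u - wh‖ ^ 2 ≤ inner ℝ (D.recon pD - p) (u - wh) := by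
    have h6 := hD.optimality u hu
    rw [← neg_sub u wh, inner_neg_right] at huv
    have e : inner ℝ (D.recon pD + α • (wh - ud)) (u - wh) -
        inner ℝ (p + α • (u - ud)) (u - wh) =
        inner ℝ (D.recon pD - p) (u - wh) - α * ‖u - wh‖ ^ 2 := by
      rw [← real_inner_self_eq_norm_sq, ← real_inner_smul_left, ← inner_sub_left,
        ← inner_sub_left]
      congr 1
      module
    linarith
  -- The control-to-adjoint map is monotone: by symmetry of the form the pairing equals `-‖Π (yH -
  -- yD)‖²`.
  have hmono : inner ℝ (D.recon (pD - pH)) (u - wh) ≤ 0 := by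
    have hy := hyH.sub hA hyD
    have hp := hpD.sub hA hpH
    have e1 : f + u - (f + wh) = u - wh := by abel
    have e2 : D.recon yD - yd - (D.recon yH - yd) = -D.recon (yH - yD) := by
      rw [map_sub]; abel
    rw [e1] at hy
    rw [e2] at hp
    rw [real_inner_comm, ← hy (pD - pH), D.form_comm hA, hp (yH - yD), inner_neg_left,
      real_inner_self_eq_norm_sq]
    exact neg_nonpos.2 (sq_nonneg _)
  -- `u - wh` is piecewise constant, so only the cell means of `p - τp` matter.
  have hproj : inner ℝ (τp - p) (u - wh) ≤ E₅ * ‖u - wh‖ := by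
    rw [← neg_sub p τp, inner_neg_left, inner_eq_setIntegral,
      T.setIntegral_mul_eq_proj hΩ (Lp.memLp _) (Lp.memLp _)]
    · refine (neg_le_abs _).trans ((abs_setIntegral_mul_le (T.memLp_step _)
        (Lp.memLp (u - wh))).trans ?_)
      rw [l2norm_coe]
      exact mul_le_mul_of_nonneg_right h₅ (norm_nonneg _)
    · intro K hK
      obtain ⟨c, hc⟩ := hu.2 K hK
      obtain ⟨d, hd⟩ := hD.mem_w.2 K hK
      refine ⟨c - d, ?_⟩
      filter_upwards [hc, hd, ae_restrict_of_ae_restrict_of_subset (T.subset K hK)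
        (Lp.coeFn_sub u wh)] with x h1 h2 h3
      rw [h3, Pi.sub_apply, h1, h2]
  have hctrl : ‖u - wh‖ ≤ α⁻¹ * (S * (E₁ + E₂ + E₄) + E₃ + E₅) := by
    rw [← div_eq_inv_mul, le_div_iff₀ hα]
    have e : D.recon pD - p = D.recon (pD - pH) + (D.recon pH - τp) + (τp - p) := by
      rw [map_sub]; abel
    rw [e, inner_add_left, inner_add_left] at hvar
    have h7 := (real_inner_le_norm (D.recon pH - τp) (u - wh)).trans
      (mul_le_mul_of_nonneg_right hp5 (norm_nonneg _))
    have h8 : α * ‖u - wh‖ ^ 2 ≤ (S * (E₁ + E₂ + E₄) + E₃ + E₅) * ‖u - wh‖ := by linarith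
    rcases (norm_nonneg (u - wh)).eq_or_lt' with h0 | h0
    · rw [h0, zero_mul]
      have := (norm_nonneg _).trans hp5
      have := (l2norm_nonneg _).trans h₅
      linarith
    · refine le_of_mul_le_mul_right ?_ h0
      linarith
  have hy7 : ‖D.recon (yH - yD)‖ ≤ S * (α⁻¹ * (S * (E₁ + E₂ + E₄) + E₃ + E₅)) := by
    refine (hstab _ _ (norm_nonneg _) (hyH.sub hA hyD).form_le).trans
      (mul_le_mul_of_nonneg_left ?_ hS)
    rwa [add_sub_add_left_eq_sub]
  have hp7 : ‖D.recon (pH - pD)‖ ≤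
      S * (S * (α⁻¹ * (S * (E₁ + E₂ + E₄) + E₃ + E₅))) := by
    refine (hstab _ _ (norm_nonneg _) (hpH.sub hA hpD).form_le).trans
      (mul_le_mul_of_nonneg_left ?_ hS)
    rwa [sub_sub_sub_cancel_right, ← map_sub]
  constructor
  · have e : τy - D.recon yD = -(D.recon yS - τy) - D.recon (yH - yS) + D.recon (yH - yD) := by
      rw [map_sub, map_sub]; abel
    rw [e]
    refine (norm_add_le _ _).trans (add_le_add ((norm_sub_le _ _).trans (add_le_add ?_ h₁)) hy7)
    rwa [norm_neg]
  · have e : τp - D.recon pD = -(D.recon pH - τp) + D.recon (pH - pD) := by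
      rw [map_sub]; abel
    rw [e]
    refine (norm_add_le _ _).trans (add_le_add ?_ hp7)
    rwa [norm_neg]

/-- Duality estimate of the effect of replacing the optimal control by its cell means. -/
theorem norm_recon_sub_le_of_meanControl {D : GradDisc.{u} Ω} {T : Mesh Ω} {η κ G Λ : ℝ}
    (hn : 0 < n) (hΩ : IsOpen Ω) (hΩ' : volume Ω ≠ ⊤) (hA : IsDiffusion Ω A)
    (hT : T.IsRegular η) (hab : a ≤ b) (ha : a ≠ ⊤) (hb : b ≠ ⊥) (hκ : 0 ≤ κ) (hG : 0 ≤ G)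
    (hΛ₀ : 0 ≤ Λ)
    (hgrad : ∀ (F : L2 Ω) (z : D.X), D.IsSol A F z → ‖D.grad z‖ ≤ G * ‖F‖)
    (hP : ProjAssumption D T κ) {f g w : L2 Ω} (hg : MemH1 Ω g)
    (hwg : w =ᵐ[volume.restrict Ω] fun x => clip a b (g x))
    (hW : ∀ K ∈ T.cells₁ a b w, MemW1 K ⊤ w)
    (hΛ : ∀ (F : L2 Ω) (z : D.X), D.IsSol A F z →
      ∫ x in ⋃ K ∈ T.cells₁ a b w, K, |D.recon z x| ≤ Λ * ‖F‖)
    {yS yH : D.X} (hyS : D.IsSol A (f + w) yS)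
    (hyH : D.IsSol A (f + T.meanControl a b g) yH) :
    ‖D.recon (yH - yS)‖ ≤ 2 * n * (T.size * Λ * T.brokenNorm a b w) +
      √(poincareConst n (1 / (4 * max η 1 + 1))).toReal * κ * G * T.size ^ 2 *
        (n * H1norm Ω g) := by
  set e := yH - yS with he
  set u := T.meanControl a b g with hu
  have hes : D.IsSol A (u - w) e := by
    have := hyH.sub hA hyS
    rwa [add_sub_add_left_eq_sub] at this
  -- Aubin–Nitsche argument: the error itself is the source of the dual problem.
  obtain ⟨ζ, hζ⟩ := D.exists_isSol hA (D.recon e)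
  have hB : 0 ≤ T.brokenNorm a b w := ENNReal.toReal_nonneg
  have hh := T.size_nonneg
  have h1 : ‖D.recon e‖ ^ 2 = inner ℝ (u - w) (D.recon ζ) := by
    rw [← real_inner_self_eq_norm_sq, ← hζ e, D.form_comm hA, hes ζ]
  have h2 : inner ℝ (u - w) (D.recon ζ) =
      ∫ x in Ω, (T.step (fun K => clip a b (⨍ y in K, g y)) x - w x) * D.recon ζ x := by
    rw [inner_eq_setIntegral]
    refine integral_congr_ae ?_
    filter_upwards [Lp.coeFn_sub u w, T.coeFn_meanControl (a := a) (b := b) g] with x hx hx'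
    rw [hx, Pi.sub_apply, ← hx']
  have h3 := (le_abs_self _).trans (hT.abs_setIntegral_step_sub_mul_le hn hΩ hΩ' hab ha hb
    (Lp.stronglyMeasurable g).measurable hg hwg hW (Lp.memLp (D.recon ζ)))
  rw [← h2, ← h1] at h3
  have h4 := hΛ _ _ hζ
  have h5 := (hP ζ).trans (mul_le_mul_of_nonneg_left (hgrad _ _ hζ) (mul_nonneg hκ hh))
  set Q := √(poincareConst n (1 / (4 * max η 1 + 1))).toReal
  have hQ : 0 ≤ Q := Real.sqrt_nonneg _
  have hN := sum_l2norm_weakDeriv_le (Ω := Ω) g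
  set N := ∑ i, l2norm Ω (weakDeriv Ω i g)
  have hN0 : 0 ≤ N := Finset.sum_nonneg fun _ _ => l2norm_nonneg _
  have h6 : 2 * n * T.size * T.brokenNorm a b w *
      (∫ x in ⋃ K ∈ T.cells₁ a b w, K, |D.recon ζ x|) ≤
      2 * n * T.size * T.brokenNorm a b w * (Λ * ‖D.recon e‖) :=
    mul_le_mul_of_nonneg_left h4 (by positivity)
  have h7 : Q * T.size * N * l2norm Ω (fun x => D.recon ζ x - T.proj (D.recon ζ) x) ≤
      Q * T.size * (n * H1norm Ω g) * (κ * T.size * (G * ‖D.recon e‖)) :=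
    mul_le_mul (mul_le_mul_of_nonneg_left hN (by positivity)) h5 (l2norm_nonneg _)
      (mul_nonneg (by positivity) (hN0.trans hN))
  rcases (norm_nonneg (D.recon e)).eq_or_lt' with h0 | h0
  · rw [h0]
    have := hN0.trans hN
    positivity
  · refine le_of_mul_le_mul_right ?_ h0
    nlinarith

end Superconvergence

/-! ### Assembling the constants. -/

section Superconvergence

variable {n : ℕ} {Ω : Set (Space n)} {A : Space n → Matrix (Fin n) (Fin n) ℝ}

theorem ApproxAssumption.mono {D : GradDisc.{u} Ω} {T : Mesh Ω} {κ κ' : ℝ} {τ : L2 Ω → L2 Ω}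
    (h : ApproxAssumption D T A κ τ) (hκ : κ ≤ κ') : ApproxAssumption D T A κ' τ := by
  refine ⟨fun w g hw hg hs z hz => (h.superconv w g hw hg hs z hz).trans ?_,
    fun w hw v => (h.inner_le w hw v).trans ?_, fun w hw => (h.proj_le w hw).trans ?_⟩
  · have := H1norm_nonneg (U := Ω) g
    gcongr
  · have := H2norm_nonneg (U := Ω) w
    gcongr
  · have := H2norm_nonneg (U := Ω) w
    gcongr

theorem ProjAssumption.mono {D : GradDisc.{u} Ω} {T : Mesh Ω} {κ κ' : ℝ}
    (h : ProjAssumption D T κ) (hκ : κ ≤ κ') : ProjAssumption D T κ' := fun v => by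
  refine (h v).trans ?_
  have := T.size_nonneg
  gcongr

/-- `β` stands for `α⁻¹`. It occurs to the first power only, so `(1 + β) * X` absorbs it and the
constants stay independent of `α`. -/
theorem error_constants_le {S k₁ k₂ k₃ κ X Z β : ℝ} (hS : 0 ≤ S) (h₁ : 0 ≤ k₁) (h₂ : 0 ≤ k₂)
    (h₃ : 0 ≤ k₃) (hκ : 0 ≤ κ) (hX : 0 ≤ X) (hβ : 0 ≤ β) (hZ : (1 + β) * X ≤ Z) {k₅ k₆ k₇ : ℝ}
    (hk₅ : k₅ = S * (k₁ + k₂ + κ) + k₃) (hk₆ : k₆ = k₂ + k₁ + S * (k₅ + κ))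
    (hk₇ : k₇ = k₅ + S * (S * (k₅ + κ))) :
    k₂ * X + k₁ * X + S * (β * (S * (k₁ * X + k₂ * X + κ * X) + k₃ * X + κ * X)) ≤
      (k₆ + k₇) * Z ∧
    S * (k₁ * X + k₂ * X + κ * X) + k₃ * X +
      S * (S * (β * (S * (k₁ * X + k₂ * X + κ * X) + k₃ * X + κ * X))) ≤ (k₆ + k₇) * Z := by
  have h₅ : 0 ≤ k₅ := by rw [hk₅]; positivity
  have h₆ : 0 ≤ k₆ := by rw [hk₆]; positivity
  have h₇ : 0 ≤ k₇ := by rw [hk₇]; positivity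
  have hXZ : X ≤ Z := by nlinarith [mul_nonneg hβ hX]
  have hβZ : β * X ≤ Z := by nlinarith
  have hZ0 := hX.trans hXZ
  have e : S * (k₁ * X + k₂ * X + κ * X) + k₃ * X = k₅ * X := by rw [hk₅]; ring
  have hc : S * (k₅ + κ) * (β * X) ≤ S * (k₅ + κ) * Z :=
    mul_le_mul_of_nonneg_left hβZ (by positivity)
  have hc' := mul_le_mul_of_nonneg_left hc hS
  rw [e]
  have i1 := mul_le_mul_of_nonneg_left hXZ (add_nonneg h₂ h₁)
  have i2 := mul_le_mul_of_nonneg_left hXZ h₅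
  have i6 := mul_nonneg h₆ hZ0
  have i7 := mul_nonneg h₇ hZ0
  constructor
  · have : k₆ * Z = (k₂ + k₁) * Z + S * (k₅ + κ) * Z := by rw [hk₆]; ring
    linarith
  · have : k₇ * Z = k₅ * Z + S * (S * (k₅ + κ) * Z) := by rw [hk₇]; ring
    linarith

set_option maxHeartbeats 1000000 in
/-- Super-convergence of the state and adjoint variables, given a bound `Λ` of the `L¹` norm, on
the cells of `T₁`, of the solutions of the gradient scheme. -/
theorem exists_superconvergence_const (hn : 0 < n) (hΩ : IsBoundedDomain Ω)
    (hA : IsDiffusion Ω A) {a₀ : ℝ} (ha₀ : 0 < a₀)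
    (hco : ∀ᵐ x ∂(volume.restrict Ω), ∀ ξ : Fin n → ℝ, a₀ * (ξ ⬝ᵥ ξ) ≤ (A x *ᵥ ξ) ⬝ᵥ ξ)
    (M η : ℝ) {κ : ℝ} (hκ : 0 ≤ κ) :
    ∃ k : ℝ, 0 ≤ k ∧ ∀ (D : GradDisc.{u} Ω) (_ : D.coercConst ≤ M)
      (T : Mesh Ω) (_ : T.IsRegular η)
      (a b : EReal) (α : ℝ) (_ : 0 < α) (f yd ud y p w : L2 Ω)
      (_ : IsKKT Ω A a b α f yd ud y p w)
      (yD pD : D.X) (wh : L2 Ω) (_ : IsDiscreteKKT D T A a b α f yd ud yD pD wh)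
      (_ : MemH2 Ω ud) (_ : MemH2 Ω y) (_ : MemH2 Ω p) (_ : MemH1 Ω yd) (_ : MemH1 Ω f)
      (τ : L2 Ω → L2 Ω) (_ : ApproxAssumption D T A κ τ) (_ : ProjAssumption D T κ)
      (_ : ∀ K ∈ T.cells₁ a b w, MemW1 K ⊤ w) (Λ : ℝ) (_ : 0 ≤ Λ)
      (_ : ∀ (F : L2 Ω) (z : D.X), D.IsSol A F z →
        ∫ x in ⋃ K ∈ T.cells₁ a b w, K, |D.recon z x| ≤ Λ * ‖F‖),
      ‖τ y - D.recon yD‖ ≤ k * ((1 + α⁻¹) ^ 2 * (T.size * Λ * T.brokenNorm a b w) +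
        (1 + α⁻¹) ^ 2 * T.size ^ 2 * dataNorm a b yd ud f y p) ∧
      ‖τ p - D.recon pD‖ ≤ k * ((1 + α⁻¹) ^ 2 * (T.size * Λ * T.brokenNorm a b w) +
        (1 + α⁻¹) ^ 2 * T.size ^ 2 * dataNorm a b yd ud f y p) := by
  set V := l2norm Ω (fun _ => (1 : ℝ)) with hV
  have hV0 : 0 ≤ V := l2norm_nonneg _
  set G := max M 0 / a₀ with hGdef
  set S := max M 0 ^ 2 / a₀ with hSdef
  have hM0 : 0 ≤ max M 0 := le_max_right _ _
  have hG : 0 ≤ G := by positivity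
  have hS : 0 ≤ S := by positivity
  set Q := √(poincareConst n (1 / (4 * max η 1 + 1))).toReal with hQdef
  have hQ : 0 ≤ Q := Real.sqrt_nonneg _
  have hn0 : (0 : ℝ) ≤ n := n.cast_nonneg
  -- `k₁`, `k₂`, `k₃` are the constants of the three consistency errors: replacing `w` by `u`,
  -- superconvergence for the state, superconvergence for the adjoint.
  set k₁ := 2 * n + Q * κ * G * (n * (1 + n) ^ 2) with hk₁
  set k₂ := κ * ((1 + n) * (1 + V + (1 + n ^ 2) * (1 + n) ^ 2)) with hk₂
  set k₃ := κ * (1 + n) ^ 2 with hk₃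
  set k₅ := S * (k₁ + k₂ + κ) + k₃ with hk₅
  have hk₁0 : 0 ≤ k₁ := by positivity
  have hk₂0 : 0 ≤ k₂ := by positivity
  have hk₃0 : 0 ≤ k₃ := by positivity
  have hk₅0 : 0 ≤ k₅ := by positivity
  refine ⟨k₂ + k₁ + S * (k₅ + κ) + (k₅ + S * (S * (k₅ + κ))), by positivity, ?_⟩
  intro D hM T hT a b α hα f yd ud y p w hK yD pD wh hD hud hy hp hyd hf τ hτ hP hW Λ hΛ₀ hΛ
  have hΩo := hΩ.1
  have hΩ' : volume Ω ≠ ⊤ := hΩ.2.2.measure_lt_top.ne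
  obtain ⟨hab, ha, hb⟩ := bounds_of_mem_Uad hΩo hΩ.2.1.nonempty hK.mem_w
  set g : L2 Ω := ud - α⁻¹ • p with hg
  have hα' : 0 < α⁻¹ := inv_pos.2 hα
  have hwg := control_ae_eq_clip hΩ' hab ha hb hα hK.mem_w hK.optimality
  rw [← hg] at hwg
  have hgH : MemH1 Ω g := MemH1.L2_sub_smul hud.1 hp.1 _
  obtain ⟨hwH, hwn⟩ := MemH1.of_ae_eq_clip hΩo hΩ' hab ha hb hgH hwg
  set u := T.meanControl a b g with hu
  obtain ⟨yS, hyS⟩ := D.exists_isSol hA (f + w)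
  obtain ⟨yH, hyH⟩ := D.exists_isSol hA (f + u)
  obtain ⟨pS, hpS⟩ := D.exists_isSol hA (y - yd)
  set h := T.size with hh
  have hh0 : 0 ≤ h := T.size_nonneg
  set B := T.brokenNorm a b w with hB
  have hB0 : 0 ≤ B := ENNReal.toReal_nonneg
  set F := dataNorm a b yd ud f y p with hF
  have q1 := minmod_nonneg a b
  have q2 := H1norm_nonneg (U := Ω) yd
  have q3 := H2norm_nonneg (U := Ω) ud
  have q4 := H1norm_nonneg (U := Ω) f
  have q5 := H2norm_nonneg (U := Ω) y
  have q6 := H2norm_nonneg (U := Ω) p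
  have hFd : F = minmod a b + H1norm Ω yd + H2norm Ω ud + H1norm Ω f + H2norm Ω y +
    H2norm Ω p := rfl
  have hF0 : 0 ≤ F := by rw [hFd]; positivity
  set s := 1 + α⁻¹ with hs
  have hs1 : 1 ≤ s := by linarith
  have hFs : F ≤ s * F := le_mul_of_one_le_left hF0 hs1
  -- The factor `s = 1 + α⁻¹` accounts for `α⁻¹ • p` in `g`; a second one will come from dividing
  -- the control estimate by `α`.
  set X := h * Λ * B + h ^ 2 * (s * F) with hX
  have hX1 : 0 ≤ h * Λ * B := by positivity
  have hX2 : 0 ≤ h ^ 2 * (s * F) := by positivity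
  have hX0 : 0 ≤ X := add_nonneg hX1 hX2
  have hhF : h ^ 2 * F ≤ X :=
    (mul_le_mul_of_nonneg_left hFs (sq_nonneg h)).trans (le_add_of_nonneg_left hX1)
  have hgn : H1norm Ω g ≤ (1 + n) ^ 2 * (s * F) := by
    refine (H1norm_L2_sub_smul_le hΩo hud.1 hp.1 hα'.le).trans ?_
    refine mul_le_mul_of_nonneg_left ?_ (by positivity)
    have r1 := H1norm_le_H2norm (U := Ω) ud
    have r2 := H1norm_le_H2norm (U := Ω) p
    have r3 : H2norm Ω ud ≤ F := by linarith
    have r4 : H2norm Ω p ≤ F := by linarith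
    have r5 := mul_le_mul_of_nonneg_left (r2.trans r4) hα'.le
    rw [hs, add_mul, one_mul]
    linarith
  have hsF0 : 0 ≤ s * F := by positivity
  have hgrad : ∀ (F : L2 Ω) (z : D.X), D.IsSol A F z → ‖D.grad z‖ ≤ G * ‖F‖ := fun F z hz =>
    D.norm_grad_le hA ha₀ hco hM (norm_nonneg _) hz.form_le
  have hE₁ : ‖D.recon (yH - yS)‖ ≤ k₁ * X := by
    refine (norm_recon_sub_le_of_meanControl hn hΩo hΩ' hA hT hab ha hb hκ hG hΛ₀ hgrad hP hgH hwg
      hW hΛ hyS hyH).trans ?_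
    have r1 : Q * κ * G * h ^ 2 * (n * H1norm Ω g) ≤
        Q * κ * G * h ^ 2 * (n * ((1 + n) ^ 2 * (s * F))) := by gcongr
    have r2 : 0 ≤ 2 * n * (h ^ 2 * (s * F)) := by positivity
    have r3 : 0 ≤ Q * κ * G * (n * (1 + n) ^ 2) * (h * Λ * B) := by positivity
    refine (add_le_add le_rfl r1).trans ?_
    rw [hk₁, hX]
    linarith
  have hE₂ : ‖D.recon yS - τ y‖ ≤ k₂ * X := by
    refine (hτ.superconv y (f + w) hy (MemH1.L2_add hf hwH) ⟨hK.mem_y, hK.state⟩ yS hyS).trans ?_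
    have r1 : H1norm Ω (f + w : L2 Ω) ≤
        (1 + n) * ((1 + V + (1 + n ^ 2) * (1 + n) ^ 2) * (s * F)) := by
      refine (H1norm_L2_add_le hΩo hf hwH).trans (mul_le_mul_of_nonneg_left ?_ (by positivity))
      have r2 : H1norm Ω f ≤ s * F := by linarith
      have r3 : minmod a b * V ≤ s * F * V :=
        mul_le_mul_of_nonneg_right (by linarith) hV0
      have r4 := mul_le_mul_of_nonneg_left hgn (by positivity : (0 : ℝ) ≤ 1 + n ^ 2)
      linarith
    calc κ * h ^ 2 * H1norm Ω (f + w : L2 Ω)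
        ≤ κ * h ^ 2 * ((1 + n) * ((1 + V + (1 + n ^ 2) * (1 + n) ^ 2) * (s * F))) := by gcongr
      _ = k₂ * (h ^ 2 * (s * F)) := by rw [hk₂]; ring
      _ ≤ k₂ * X := mul_le_mul_of_nonneg_left (le_add_of_nonneg_left hX1) hk₂0
  have hE₃ : ‖D.recon pS - τ p‖ ≤ k₃ * X := by
    have hsub : MemH1 Ω (y - yd : L2 Ω) := by
      simpa using MemH1.L2_sub_smul hy.1 hyd 1
    refine (hτ.superconv p (y - yd) hp hsub ⟨hK.mem_p, fun v hv => ?_⟩ pS hpS).trans ?_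
    -- The adjoint equation is a direct one because `A` is symmetric.
    · rw [← hK.adjoint v hv]
      exact hA.fluxForm_comm _ _
    have r1 : H1norm Ω (y - yd : L2 Ω) ≤ (1 + n) ^ 2 * F := by
      have r2 := H1norm_L2_sub_smul_le hΩo hy.1 hyd zero_le_one
      rw [one_smul, one_mul] at r2
      refine r2.trans (mul_le_mul_of_nonneg_left ?_ (by positivity))
      have := H1norm_le_H2norm (U := Ω) y
      linarith
    calc κ * h ^ 2 * H1norm Ω (y - yd : L2 Ω) ≤ κ * h ^ 2 * ((1 + n) ^ 2 * F) := by gcongr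
      _ = k₃ * (h ^ 2 * F) := by rw [hk₃]; ring
      _ ≤ k₃ * X := mul_le_mul_of_nonneg_left hhF hk₃0
  have hκX : ∀ {c : ℝ}, c ≤ F → κ * h ^ 2 * c ≤ κ * X := fun hc => by
    rw [mul_assoc]
    exact mul_le_mul_of_nonneg_left
      ((mul_le_mul_of_nonneg_left hc (sq_nonneg h)).trans hhF) hκ
  have hE₄ : ∀ v : D.X, |inner ℝ (y - τ y) (D.recon v)| ≤ κ * X * ‖D.recon v‖ := fun v =>
    (hτ.inner_le y hy v).trans
      (mul_le_mul_of_nonneg_right (hκX (by linarith)) (norm_nonneg _))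
  have hE₅ : l2norm Ω (T.proj (p - τ p : L2 Ω)) ≤ κ * X :=
    (hτ.proj_le p hp).trans (hκX (by linarith))
  have huv : 0 ≤ inner ℝ (p + α • (u - ud)) (wh - u) := by
    have e : p + α • (u - ud) = α • (u - g) := by
      rw [hg, ← sub_add, smul_add, smul_smul, mul_inv_cancel₀ hα.ne', one_smul, add_comm]
    rw [e, real_inner_smul_left]
    exact mul_nonneg hα.le (T.inner_meanControl_sub_nonneg hΩo hab ha hb g hD.mem_w)
  have hstab : ∀ (z : D.X) (C : ℝ), 0 ≤ C → D.form A z z ≤ C * ‖D.recon z‖ →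
      ‖D.recon z‖ ≤ S * C := fun z C hC hz => D.norm_recon_le_of_form_le hA ha₀ hco hM hC hz
  obtain ⟨r1, r2⟩ := state_adjoint_error_le hΩo hA hS hstab hα hD
    (T.meanControl_mem hΩo hab ha hb g) huv hyH hpS hE₁ hE₂ hE₃ hE₄ (by positivity) hE₅
  have hsX : s * X ≤ s ^ 2 * (h * Λ * B) + s ^ 2 * h ^ 2 * F := by
    have : s * (h * Λ * B) ≤ s ^ 2 * (h * Λ * B) :=
      mul_le_mul_of_nonneg_right (le_self_pow₀ hs1 two_ne_zero) hX1
    calc s * X = s * (h * Λ * B) + s ^ 2 * h ^ 2 * F := by rw [hX]; ring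
      _ ≤ _ := add_le_add this le_rfl
  obtain ⟨r3, r4⟩ := error_constants_le hS hk₁0 hk₂0 hk₃0 hκ hX0 hα'.le hsX hk₅ rfl rfl
  exact ⟨r1.trans r3, r2.trans r4⟩

end Superconvergence

end

end OptControl

theorem corollary3p7 :
    -- `C₁` depends only on `α`, and `C₂` only on `α` and `δ`
    ∃ (C₁ : ℝ → ℝ) (C₂ : ℝ → ℝ → ℝ),
    ∀ (n : ℕ) (_ : 2 ≤ n) (_ : n ≤ 3) (Ω : Set (Space n)) (_ : IsBoundedDomain Ω)
      (A : Space n → Matrix (Fin n) (Fin n) ℝ) (_ : IsDiffusion Ω A)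
      -- upper bound of `C_D`, mesh regularity, hidden constants of the assumptions
      (M η κ : ℝ),
    ∃ Cη : ℝ,
    ∀ (D : GradDisc.{u} Ω) (_ : D.coercConst ≤ M)
      (T : Mesh Ω) (_ : T.IsRegular η)
      (a b : EReal) (α : ℝ) (_ : 0 < α) (f yd ud y p w : L2 Ω)
      (_ : IsKKT Ω A a b α f yd ud y p w)
      (yD pD : D.X) (wh : L2 Ω) (_ : IsDiscreteKKT D T A a b α f yd ud yD pD wh)
      (_ : MemH2 Ω ud) (_ : MemH2 Ω y) (_ : MemH2 Ω p) (_ : MemH1 Ω yd) (_ : MemH1 Ω f)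
      (τ : L2 Ω → L2 Ω) (_ : ApproxAssumption D T A κ τ) (_ : ProjAssumption D T κ)
      (_ : ControlAssumption T a b w κ),
    (∀ (q : ℝ) (_ : IsSobolevExponent n q) (_ : SobolevAssumption D q κ),
      ‖τ y - D.recon yD‖ ≤
        Cη * (C₁ α * T.size ^ (2 - 1 / q) * T.brokenNorm a b w
          + C₁ α * T.size ^ 2 * dataNorm a b yd ud f y p) ∧
      ‖τ p - D.recon pD‖ ≤
        Cη * (C₁ α * T.size ^ (2 - 1 / q) * T.brokenNorm a b w
          + C₁ α * T.size ^ 2 * dataNorm a b yd ud f y p)) ∧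
    (∀ (δ : ℝ) (_ : 0 < δ) (_ : LinftyAssumption D A δ),
      ‖τ y - D.recon yD‖ ≤
        Cη * (C₂ α δ * T.size ^ 2 * T.brokenNorm a b w
          + C₂ α δ * T.size ^ 2 * dataNorm a b yd ud f y p) ∧
      ‖τ p - D.recon pD‖ ≤
        Cη * (C₂ α δ * T.size ^ 2 * T.brokenNorm a b w
          + C₂ α δ * T.size ^ 2 * dataNorm a b yd ud f y p)) := by
  -- The square collects both occurrences of `α⁻¹`: in `g` and in the control estimate. The factor
  -- `1 + δ` absorbs the `δ` of the `L^∞` bound.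
  refine ⟨fun α => (1 + α⁻¹) ^ 2, fun α δ => (1 + α⁻¹) ^ 2 * (1 + δ), ?_⟩
  intro n hn hn3 Ω hΩ A hA M η κ
  obtain ⟨a₀, ha₀, hco⟩ := hA.2.2.2
  -- The sign of `κ` is not prescribed, while the estimates need a non-negative constant.
  set κ' := max κ 0 with hκ'
  have hκ0 : 0 ≤ κ' := le_max_right _ _
  have hκκ : κ ≤ κ' := le_max_left _ _
  obtain ⟨k, hk, hmain⟩ := exists_superconvergence_const.{u} (by omega) hΩ hA ha₀ hco M η hκ0
  set G := max M 0 / a₀ with hG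
  have hG0 : 0 ≤ G := div_nonneg (le_max_right _ _) ha₀.le
  -- One constant for both parts: `κ' * G * (1 + κ')` serves the Sobolev case and `κ'` the `L^∞`
  -- case.
  refine ⟨k * (1 + κ' * G * (1 + κ') + κ'), ?_⟩
  intro D hM T hT a b α hα f yd ud y p w hK yD pD wh hD hud hy hp hyd hf τ hτ hP hW
  have key := hmain D hM T hT a b α hα f yd ud y p w hK yD pD wh hD hud hy hp hyd hf τ
    (hτ.mono hκκ) (hP.mono hκκ) hW.2
  have hh : 0 ≤ T.size := T.size_nonneg
  have hvol : volume (T.region₁ a b w) ≤ ENNReal.ofReal (κ' * T.size) :=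
    hW.1.trans (ENNReal.ofReal_le_ofReal (mul_le_mul_of_nonneg_right hκκ hh))
  have hB : 0 ≤ T.brokenNorm a b w := ENNReal.toReal_nonneg
  have hF : 0 ≤ dataNorm a b yd ud f y p := by
    have q1 := minmod_nonneg a b
    have q2 := H1norm_nonneg (U := Ω) yd
    have q3 := H2norm_nonneg (U := Ω) ud
    have q4 := H1norm_nonneg (U := Ω) f
    have q5 := H2norm_nonneg (U := Ω) y
    have q6 := H2norm_nonneg (U := Ω) p
    rw [dataNorm]
    positivity
  set B := T.brokenNorm a b w
  set F := dataNorm a b yd ud f y p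
  set s := (1 + α⁻¹) ^ 2 with hs
  have hs0 : 0 ≤ s := sq_nonneg _
  set h := T.size
  constructor
  · intro q hq hSob
    have hq2 : 2 ≤ q := by
      rcases (by omega : n = 2 ∨ n = 3) with hn' | hn'
      · exact hq.1 hn'
      · have h3 : (n : ℝ) = 3 := by exact_mod_cast hn'
        rw [hq.2 hn'.ge, h3]
        norm_num
    have hq1 : 1 / q ≤ 1 := (div_le_one (by linarith)).2 (by linarith)
    have hq0 : 0 ≤ 1 / q := by positivity
    have hΛ : ∀ (F : L2 Ω) (z : D.X), D.IsSol A F z →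
        ∫ x in ⋃ K ∈ T.cells₁ a b w, K, |D.recon z x| ≤
          κ' * G * (κ' * h) ^ (1 - 1 / q) * ‖F‖ := by
      intro F z hz
      have h1 := Mesh.setIntegral_cells₁_abs_le (c := κ' * (G * ‖F‖)) (by positivity) hκ0 hvol
        (Lp.aestronglyMeasurable (D.recon z)) (p := ENNReal.ofReal q)
        (by rw [ENNReal.one_le_ofReal]; linarith)
        ((hSob z).trans (ENNReal.ofReal_le_ofReal (mul_le_mul hκκ
          (D.norm_grad_le hA ha₀ hco hM (norm_nonneg _) hz.form_le) (norm_nonneg _) hκ0)))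
      rw [ENNReal.toReal_ofReal (by linarith)] at h1
      linarith
    -- Makes the constant independent of the exponent `q`, which is free in dimension two.
    have hκq : κ' ^ (1 - 1 / q) ≤ 1 + κ' := by
      rcases le_total κ' 1 with h1 | h1
      · exact (Real.rpow_le_one hκ0 h1 (by linarith)).trans (by linarith)
      · refine (Real.rpow_le_rpow_of_exponent_le h1 (by linarith : 1 - 1 / q ≤ 1)).trans ?_
        rw [Real.rpow_one]
        linarith
    have hpow : h * h ^ (1 - 1 / q) = h ^ (2 - 1 / q) := by
      have : (2 : ℝ) - 1 / q = 1 + (1 - 1 / q) := by ring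
      rw [this, Real.rpow_add_of_nonneg hh zero_le_one (by linarith), Real.rpow_one]
    have hle : h * (κ' * G * (κ' * h) ^ (1 - 1 / q)) ≤ κ' * G * (1 + κ') * h ^ (2 - 1 / q) := by
      rw [Real.mul_rpow hκ0 hh, ← hpow]
      calc h * (κ' * G * (κ' ^ (1 - 1 / q) * h ^ (1 - 1 / q)))
          = κ' * G * κ' ^ (1 - 1 / q) * (h * h ^ (1 - 1 / q)) := by ring
        _ ≤ κ' * G * (1 + κ') * (h * h ^ (1 - 1 / q)) := by gcongr
    have hbound : k * (s * (h * (κ' * G * (κ' * h) ^ (1 - 1 / q)) * B) + s * h ^ 2 * F) ≤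
        k * (1 + κ' * G * (1 + κ') + κ') * (s * h ^ (2 - 1 / q) * B + s * h ^ 2 * F) := by
      rw [mul_assoc k]
      refine mul_le_mul_of_nonneg_left ?_ hk
      set r := h ^ (2 - 1 / q)
      have hr : 0 ≤ r := Real.rpow_nonneg hh _
      set m := κ' * G * (1 + κ')
      have hm : 0 ≤ m := by positivity
      have h1 : s * (h * (κ' * G * (κ' * h) ^ (1 - 1 / q)) * B) ≤ s * (m * r * B) := by gcongr
      have h2 : 0 ≤ (1 + κ') * (s * r * B) := by positivity
      have h3 : 0 ≤ (m + κ') * (s * h ^ 2 * F) := by positivity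
      linarith
    obtain ⟨r1, r2⟩ := key _ (by positivity) hΛ
    exact ⟨r1.trans hbound, r2.trans hbound⟩
  · intro δ hδ hL
    have hΛ : ∀ (F : L2 Ω) (z : D.X), D.IsSol A F z →
        ∫ x in ⋃ K ∈ T.cells₁ a b w, K, |D.recon z x| ≤ δ * (κ' * h) * ‖F‖ := by
      intro F z hz
      have h1 := Mesh.setIntegral_cells₁_abs_le (c := δ * ‖F‖) (by positivity) hκ0 hvol
        (Lp.aestronglyMeasurable (D.recon z)) (p := ⊤) le_top (hL F z hz)
      rw [ENNReal.toReal_top, div_zero, sub_zero, Real.rpow_one] at h1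
      linarith
    have hbound : k * (s * (h * (δ * (κ' * h)) * B) + s * h ^ 2 * F) ≤
        k * (1 + κ' * G * (1 + κ') + κ') *
          (s * (1 + δ) * h ^ 2 * B + s * (1 + δ) * h ^ 2 * F) := by
      rw [mul_assoc k]
      refine mul_le_mul_of_nonneg_left ?_ hk
      set m := κ' * G * (1 + κ')
      have hm : 0 ≤ m := by positivity
      have h1 : 0 ≤ (1 + m) * (s * (1 + δ) * h ^ 2 * B) + κ' * (s * h ^ 2 * B) := by positivity
      have h2 : 0 ≤ (m + κ') * (s * (1 + δ) * h ^ 2 * F) + δ * (s * h ^ 2 * F) := by positivity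
      linarith
    obtain ⟨r1, r2⟩ := key _ (by positivity) hΛ
    exact ⟨r1.trans hbound, r2.trans hbound⟩
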